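/- \textbf{Setting.} Let $\mathcal K$ (alternatives, $|\mathcal K|\ge 2$) and $\mathcal C$ (contexts, nonempty) be finite sets, $F:\mathcal K\times\mathcal C\to\mathbb R$ an unknown reward such that for every $c$ the best alternative $\pi^*(c)=\arg\max_k F(k,c)$ is unique, and $\sigma^2(k,c)>0$ known noise variances. Observations are $y^n(k,c)=F(k,c)+\epsilon^n(k,c)$ with $\epsilon^n(k,c)\sim\mathcal N(0,\sigma^2(k,c))$ independent across $n,k,c$. At each time one pair $(k,c)$ is sampled; $N_n(k,c)$ is the number of the first $n$ samples drawn from $(k,c)$, and $\hat p_n(k,c)=N_n(k,c)/n$. \textbf{Prior.} The rewards of each alternative $k$ are modelled by a Gaussian process over $\mathcal C$ with a fixed prior mean $\mu_0(k,\cdot)$ and a fixed, positive definite prior covariance matrix $\Sigma_0(\mathcal C,\mathcal C;k)$, independently across alternatives. With $D_n(k)$, $Y_n(k)$ the contexts and values of the first $n$ observations that belong to alternative $k$, and $A_n(k)=\Sigma_0(D_n(k),D_n(k);k)+\mathrm{diag}(\sigma^2(k,D_n(k)))$, the posterior mean and covariance are $$\mu_n(k,c)=\mu_0(k,c)+\Sigma_0(c,D_n(k);k)A_n(k)^{-1}(Y_n(k)-\mu_0(k,D_n(k))),$$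 $$\Sigma_n(c,c';k)=\Sigma_0(c,c';k)-\Sigma_0(c,D_n(k);k)A_n(k)^{-1}\Sigma_0(D_n(k),c';k),\qquad \Sigma_n(k,c)=\Sigma_n(c,c;k).$$ Assume that the prior is diagonal across contexts: $\Sigma_0(\mathcal C,\mathcal C;k)=\mathrm{diag}([\Sigma_0(k,c)]_{c\in\mathcal C})$ for all $k$. The uninformative prior $\Sigma_0(k,c)=\infty$ is also allowed, where $\mu_n(k,c)$ is the average of the samples of $(k,c)$ and $\Sigma_n(k,c)=\sigma^2(k,c)/N_n(k,c)$, provided that every pair is sampled at least once in the initial stage. \textbf{Policy (GP-C-OCBA).} The first $N_0\ge 0$ samples follow a predetermined design. At each time $n\ge N_0$ let $\pi^n(c)\in\arg\max_k\mu_n(k,c)$, and for $k\ne\pi^n(c)$ let $$\zeta(k,c)=\frac{(\mu_n(\pi^n(c),c)-\mu_n(k,c))^2}{\Sigma_n(\pi^n(c),c)+\Sigma_n(k,c)},\quad \psi^{(1)}(c)=\frac{\hat p_n(\pi^n(c),c)}{\Sigma_n(\pi^n(c),c)},\quad \psi^{(2)}(c)=\sum_{k\ne\pi^n(c)}\frac{\hat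 p_n(k,c)}{\Sigma_n(k,c)}$$ (at $n=0$ put $\hat p_0=0$). Choose $(\tilde k,\tilde c)\in\arg\min_{c,\,k\ne\pi^n(c)}\zeta(k,c)$; sample $(\pi^n(\tilde c),\tilde c)$ if $\psi^{(1)}(\tilde c)<\psi^{(2)}(\tilde c)$, and $(\tilde k,\tilde c)$ otherwise. Ties are broken arbitrarily, as a (measurable) function of past observations. \textbf{Optimal static allocation.} For positive $p=(p(k,c))$ with $\sum_{k,c}p(k,c)=1$ and $k\neq\pi^*(c)$ put $$\eta_p(k,c)=\frac{(F(\pi^*(c),c)-F(k,c))^2}{\sigma^2(\pi^*(c),c)/p(\pi^*(c),c)+\sigma^2(k,c)/p(k,c)},$$ and let the rate function be $p\mapsto\min_{c}\min_{k\ne\pi^*(c)}\tfrac12\eta_p(k,c)$. Write $\hat\eta_n=\eta_{\hat p_n}$. \textbf{Theorem.} Almost surely, as $n\to\infty$, $$\frac{\hat p_n(\pi^*(c),c)^2}{\sigma^2(\pi^*(c),c)}-\sum_{k\ne\pi^*(c)}\frac{\hat p_n(k,c)^2}{\sigma^2(k,c)}\to0\quad\text{for all }c,$$ $$\hat\eta_n(k,c)-\hat\eta_n(k',c)\to0\quad\text{for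 all }c\text{ and }k,k'\ne\pi^*(c),$$ $$\hat\eta_n(k,c)-\hat\eta_n(k',c')\to0\quad\text{for all }c\ne c',\ k\ne\pi^*(c),\ k'\ne\pi^*(c').$$ Moreover, the rate function has a unique maximizer $p^*$ over the positive allocations summing to one, and almost surely $\hat p_n(k,c)\to p^*(k,c)$ for all $k,c$. -/

import Mathlib

open MeasureTheory ProbabilityTheory Filter Topology
open scoped NNReal

namespace GPCOCBA

/-! Contextual ranking and selection with a separate Gaussian process for each alternative.
`K` is the finite set of alternatives, `C` the finite set of contexts. In the definitions about
data, `a m` is the pair sampled by the `(m+1)`-st observation, `y m` the value observed, and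
the state "at time `n`" uses the observations `m = 0, …, n - 1`. -/

/-- The number `N_n(k, c)` of samples drawn from `(k, c)` among the first `n` observations. -/
def sampleCount {K C : Type*} [DecidableEq K] [DecidableEq C]
    (a : ℕ → K × C) (n : ℕ) (k : K) (c : C) : ℕ :=
  ((Finset.range n).filter (fun m => a m = (k, c))).card

/-- The empirical allocation fraction `N_n(k, c) / n`. -/
noncomputable def allocFrac {K C : Type*} [DecidableEq K] [DecidableEq C]
    (a : ℕ → K × C) (n : ℕ) (k : K) (c : C) : ℝ :=
  (sampleCount a n k c : ℝ) / (n : ℝ)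

/-- The average of the samples drawn from `(k, c)` among the first `n` observations. -/
noncomputable def sampleMean {K C : Type*} [DecidableEq K] [DecidableEq C]
    (a : ℕ → K × C) (y : ℕ → ℝ) (n : ℕ) (k : K) (c : C) : ℝ :=
  (∑ m ∈ (Finset.range n).filter (fun m => a m = (k, c)), y m) / (sampleCount a n k c : ℝ)

/-- The times before `n` at which alternative `k` was observed; they index the data `D_n(k)`,
`Y_n(k)` of the Gaussian process of alternative `k`. -/
def obsTimes {K C : Type*} [DecidableEq K] (a : ℕ → K × C) (n : ℕ) (k : K) : Finset ℕ :=
  (Finset.range n).filter (fun m => (a m).1 = k)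

/-- `Σ₀(D_n(k), D_n(k); k) + diag(σ²(k, D_n(k)))`, for the prior covariance matrices `S`
and the noise variances `v`. -/
noncomputable def gramMatrix {K C : Type*} [DecidableEq K] (S : K → Matrix C C ℝ)
    (v : K → C → ℝ≥0) (a : ℕ → K × C) (n : ℕ) (k : K) :
    Matrix (obsTimes a n k) (obsTimes a n k) ℝ :=
  Matrix.of (fun i j : obsTimes a n k => S k (a i).2 (a j).2) +
    Matrix.diagonal (fun i : obsTimes a n k => (v k (a i).2 : ℝ))

/-- Posterior mean of the Gaussian process of alternative `k` at context `c`. -/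
noncomputable def gpMean {K C : Type*} [DecidableEq K] (m0 : K → C → ℝ) (S : K → Matrix C C ℝ)
    (v : K → C → ℝ≥0) (a : ℕ → K × C) (y : ℕ → ℝ) (n : ℕ) (k : K) (c : C) : ℝ :=
  m0 k c + (fun i : obsTimes a n k => S k c (a i).2) ⬝ᵥ
    ((gramMatrix S v a n k)⁻¹.mulVec (fun i : obsTimes a n k => y i - m0 k (a i).2))

/-- Posterior covariance of the Gaussian process of alternative `k` at contexts `c`, `c'`. -/
noncomputable def gpCov {K C : Type*} [DecidableEq K] (S : K → Matrix C C ℝ)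
    (v : K → C → ℝ≥0) (a : ℕ → K × C) (n : ℕ) (k : K) (c c' : C) : ℝ :=
  S k c c' - (fun i : obsTimes a n k => S k c (a i).2) ⬝ᵥ
    ((gramMatrix S v a n k)⁻¹.mulVec (fun i : obsTimes a n k => S k (a i).2 c'))

/-- A prior: either a Gaussian process prior for every alternative, with mean `m0 k` and
covariance matrix `S k` over the contexts, or the uninformative (infinite variance) prior. -/
inductive Prior (K C : Type*) where
  | gaussian (m0 : K → C → ℝ) (S : K → Matrix C C ℝ) : Prior K C
  | uninformative : Prior K C

/-- Posterior mean `μ_n(k, c)`; under the uninformative prior it is the sample mean. -/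
noncomputable def Prior.postMean {K C : Type*} [DecidableEq K] [DecidableEq C]
    (prior : Prior K C) (v : K → C → ℝ≥0) (a : ℕ → K × C) (y : ℕ → ℝ) (n : ℕ) (k : K) (c : C) :
    ℝ :=
  match prior with
  | .gaussian m0 S => gpMean m0 S v a y n k c
  | .uninformative => sampleMean a y n k c

/-- Posterior variance `Σ_n(k, c)`; under the uninformative prior it is `σ²(k, c) / N_n(k, c)`. -/
noncomputable def Prior.postVar {K C : Type*} [DecidableEq K] [DecidableEq C]
    (prior : Prior K C) (v : K → C → ℝ≥0) (a : ℕ → K × C) (n : ℕ) (k : K) (c : C) : ℝ :=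
  match prior with
  | .gaussian _ S => gpCov S v a n k c c
  | .uninformative => (v k c : ℝ) / (sampleCount a n k c : ℝ)

/-- The prior covariance matrices are positive definite and diagonal (no correlation between
contexts). The uninformative prior is also admitted, provided that the initial design
`init 0, …, init (N0 - 1)` contains every pair, as otherwise its posterior does not exist. -/
def Prior.Independent {K C : Type*} [DecidableEq C] (prior : Prior K C)
    (N0 : ℕ) (init : ℕ → K × C) : Prop :=
  match prior with
  | .gaussian _ S => ∀ k, (S k).PosDef ∧ S k = Matrix.diagonal (fun c => S k c c)
  | .uninformative => ∀ k c, ∃ n < N0, init n = (k, c)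

/-- `ζ(k, c)`, for posterior means `mu`, posterior variances `V`, predicted best `b`. -/
noncomputable def zeta {K C : Type*} (mu V : K → C → ℝ) (b : C → K) (k : K) (c : C) : ℝ :=
  (mu (b c) c - mu k c) ^ 2 / (V (b c) c + V k c)

/-- `ψ⁽¹⁾(c)`. -/
noncomputable def psi1 {K C : Type*} (phat V : K → C → ℝ) (b : C → K) (c : C) : ℝ :=
  phat (b c) c / V (b c) c

/-- `ψ⁽²⁾(c)`. -/
noncomputable def psi2 {K C : Type*} [Fintype K] [DecidableEq K]
    (phat V : K → C → ℝ) (b : C → K) (c : C) : ℝ :=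
  ∑ k ∈ Finset.univ.filter (fun k => k ≠ b c), phat k c / V k c

/-- One iteration of GP-C-OCBA may choose to sample the pair `x`: `b` is the predicted best
alternative in each context, `(k, c)` minimizes `ζ` over the pairs with `k ≠ b c`, and `x` is
`(b c, c)` if `ψ⁽¹⁾(c) < ψ⁽²⁾(c)` and `(k, c)` otherwise. Ties in the two optimizations may be
resolved in any way. -/
def IsStep {K C : Type*} [Fintype K] [DecidableEq K]
    (mu V phat : K → C → ℝ) (x : K × C) : Prop :=
  ∃ b : C → K, (∀ c k, mu k c ≤ mu (b c) c) ∧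
    ∃ (k : K) (c : C), k ≠ b c ∧
      (∀ k' c', k' ≠ b c' → zeta mu V b k c ≤ zeta mu V b k' c') ∧
      (psi1 phat V b c < psi2 phat V b c → x = (b c, c)) ∧
      (¬ psi1 phat V b c < psi2 phat V b c → x = (k, c))

/-- The observations `y^n = F(k, c) + ε^n(k, c)` at the sampled pairs `(k, c) = A n`. -/
def observation {K C Ω : Type*} (F : K → C → ℝ) (ε : ℕ → K → C → Ω → ℝ) (A : ℕ → Ω → K × C)
    (n : ℕ) (ω : Ω) : ℝ :=
  F (A n ω).1 (A n ω).2 + ε n (A n ω).1 (A n ω).2 ω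

/-- The σ-algebra generated by the first `n` observations. -/
@[reducible] def history {K C Ω : Type*} (F : K → C → ℝ) (ε : ℕ → K → C → Ω → ℝ) (A : ℕ → Ω → K × C)
    (n : ℕ) : MeasurableSpace Ω :=
  ⨆ m : Fin n, MeasurableSpace.comap (observation F ε A m) inferInstance

/-- The (random) sampling decisions `A` are produced by GP-C-OCBA: the first `N0` samples follow
the predetermined design `init`, each later one is chosen by the algorithm from the posterior
mean and variance, and each decision is a function of the observations made before it. -/
structure IsPolicy {K C Ω : Type*} [Fintype K] [DecidableEq K] [DecidableEq C]
    (F : K → C → ℝ) (v : K → C → ℝ≥0) (ε : ℕ → K → C → Ω → ℝ) (prior : Prior K C)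
    (N0 : ℕ) (init : ℕ → K × C) (A : ℕ → Ω → K × C) : Prop where
  initial : ∀ n < N0, ∀ ω, A n ω = init n
  nonanticipating : ∀ n x, MeasurableSet[history F ε A n] {ω | A n ω = x}
  step : ∀ n, N0 ≤ n → ∀ ω,
    IsStep (prior.postMean v (fun m => A m ω) (fun m => observation F ε A m ω) n)
      (prior.postVar v (fun m => A m ω) n)
      (allocFrac (fun m => A m ω) n)
      (A n ω)

/-- `(F(π*(c), c) - F(k, c))² / (σ²(π*(c), c) / p(π*(c), c) + σ²(k, c) / p(k, c))`,
where `b` stands for `π*`. -/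
noncomputable def eta {K C : Type*} (F : K → C → ℝ) (v : K → C → ℝ≥0) (b : C → K)
    (p : K → C → ℝ) (k : K) (c : C) : ℝ :=
  (F (b c) c - F k c) ^ 2 / ((v (b c) c : ℝ) / p (b c) c + (v k c : ℝ) / p k c)

/-- The large deviations rate of the contextual probability of false selection under the static
allocation `p`: the minimum of `eta / 2` over all contexts `c` and alternatives `k ≠ π*(c)`. -/
noncomputable def rate {K C : Type*} (F : K → C → ℝ) (v : K → C → ℝ≥0) (b : C → K)
    (p : K → C → ℝ) : ℝ :=
  ⨅ x : {x : K × C // x.1 ≠ b x.2}, eta F v b p x.1.1 x.1.2 / 2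

/-- Static allocations: positive fractions that add up to one. -/
def allocations (K C : Type*) [Fintype K] [Fintype C] : Set (K → C → ℝ) :=
  {p | (∀ k c, 0 < p k c) ∧ ∑ k, ∑ c, p k c = 1}

/-- `p` is an optimal static allocation: it maximizes the rate function. -/
def IsOptimal {K C : Type*} [Fintype K] [Fintype C] (F : K → C → ℝ) (v : K → C → ℝ≥0)
    (b : C → K) (p : K → C → ℝ) : Prop :=
  p ∈ allocations K C ∧ IsMaxOn (rate F v b) (allocations K C) p

end GPCOCBA

/-!
The optimal allocation is explicit up to one scalar per context. In every context there is a
*profile* `X` (`IsProfile`): sample sizes at which all the ratios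
`(F(π*) - F(k))² / (σ²(π*) / X(π*) + σ²(k) / X(k))` are one and `X(π*)² / σ²(π*)` is balanced
against `∑ X(k)² / σ²(k)`. It exists by the intermediate value theorem. The tangent lines of `1 / x`
at the profile, added up with suitable multipliers, show that all other sample sizes with ratios of
at least one have a larger total (`IsProfile.sum_sq_le`). Hence the normalized profiles are the
unique maximizer of the rate function (`isOptimal_profile_div`), and it remains to prove that the
empirical allocation converges to them.

If every pair is sampled infinitely often, the posterior means converge, `ζ` is asymptotically the
ratio at the current sample sizes, and the policy becomes a greedy balancing rule: it samples the
best alternative only when this is undersampled relative to its competitors, and a competitor only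
when its ratio is minimal and the best alternative is not undersampled. Looking at the last time at
which an alternative was sampled, one finds that no sample size exceeds its share of the profile,
scaled by the minimal ratio `m`; the ratios are at least `m` by definition, so no sample size falls
below its share either (`IsProfile.tendsto`, `IsTrajectory.tendsto_allocFrac`).

That every pair is sampled infinitely often is the probabilistic part. Otherwise `ζ` stays bounded
at the selected pairs, while in a context that is selected infinitely often it tends to infinity for
alternatives with different rewards that are both sampled infinitely often. Suboptimal alternatives
may however have equal rewards, and their posterior means have to be separated by chance. A Gaussian
random walk follows a prescribed line over a window of any length with a probability that does not
depend on the length, because its bridge is independent of its endpoint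
(`exists_le_measure_near_line`); so the walks of all alternatives of a context follow widely
separated lines infinitely often (`ae_tendsto_and_isSpread`). In such a window no two alternatives
are close enough to be selected against each other, so the sample sizes could never leave it
(`IsTrajectory.tendsto_sampleCount`).

These statements concern the noise in the order in which each pair meets it. Although the times of
the samples of a pair depend on the past, this noise, completed by independent variables, is again
an independent Gaussian array (`map_stackLim`). This reduces the theorem to properties of single
trajectories (`IsPolicy.ae_exists_isTrajectory`). The posterior enters only through one precision
per pair, since the prior is diagonal (`Prior.Independent.exists_precision`).
-/

/-! ### The optimal profile of one context -/

namespace GPCOCBA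

/-- `X` is the profile of one context at unit rate: the alternative `b` has positive gaps `d k`
to the others, all ratios `d k ^ 2 / (v b / X b + v k / X k)` are equal to one, and the sample
sizes of `b` and of its competitors are balanced. -/
structure IsProfile {K : Type*} [Fintype K] [DecidableEq K] (b : K) (v d X : K → ℝ) : Prop where
  pos : ∀ k, 0 < X k
  level : ∀ k, k ≠ b → v b / X b + v k / X k = d k ^ 2
  balance : X b ^ 2 / v b = ∑ k ∈ Finset.univ.filter (fun k => k ≠ b), X k ^ 2 / v k

section Profile

variable {K : Type*} [Fintype K] [DecidableEq K] {b : K} {v d X : K → ℝ}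

theorem exists_isProfile [Nontrivial K] (b : K) (hv : ∀ k, 0 < v k) (hd : ∀ k, k ≠ b → 0 < d k) :
    ∃ X, IsProfile b v d X := by
  set s := Finset.univ.filter (fun k : K => k ≠ b) with hs
  obtain ⟨k1, hk1⟩ := exists_ne b
  have hmem : ∀ k, k ∈ s ↔ k ≠ b := fun k => by simp [hs]
  obtain ⟨k0, hk0, hmin⟩ := s.exists_min_image (fun k => d k ^ 2) ⟨k1, (hmem _).2 hk1⟩
  rw [hmem] at hk0
  set t0 := d k0 ^ 2 with ht0
  have ht0pos : 0 < t0 := pow_pos (hd _ hk0) 2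
  have hge : ∀ k, k ≠ b → t0 ≤ d k ^ 2 := fun k hk => hmin k ((hmem k).2 hk)
  -- the unknown is `l`, with `v b / X b = l * t0`
  set g : ℝ → ℝ := fun l => v b / l ^ 2 - ∑ k ∈ s, v k * t0 ^ 2 / (d k ^ 2 - l * t0) ^ 2 with hg
  set V := ∑ k ∈ s, v k with hV
  have hVk : v k0 ≤ V := Finset.single_le_sum (fun k _ => (hv k).le) ((hmem k0).2 hk0)
  have hVpos : 0 < V := (hv k0).trans_le hVk
  have hden : ∀ l, l < 1 → ∀ k, k ≠ b → (1 - l) * t0 ≤ d k ^ 2 - l * t0 := by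
    intro l _ k hk
    linarith [hge k hk]
  set B := √(v b)
  have hB : 0 < B := Real.sqrt_pos.2 (hv b)
  have hB2 : B ^ 2 = v b := Real.sq_sqrt (hv b).le
  have key : ∀ W : ℝ, 0 < W → 0 < B / (B + √W) ∧ B / (B + √W) < 1 ∧
      v b / (B / (B + √W)) ^ 2 = W / (1 - B / (B + √W)) ^ 2 := by
    intro W hW
    have h1 : 0 < √W := Real.sqrt_pos.2 hW
    have h2 : √W ^ 2 = W := Real.sq_sqrt hW.le
    refine ⟨by positivity, (div_lt_one (by positivity)).2 (by linarith), ?_⟩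
    have : 1 - B / (B + √W) = √W / (B + √W) := by field_simp; ring
    rw [this, div_pow, div_pow, hB2, h2, div_div_cancel₀ (hv b).ne', div_div_cancel₀ hW.ne']
  obtain ⟨p1, q1, e1⟩ := key V hVpos
  obtain ⟨p2, q2, e2⟩ := key (v k0) (hv k0)
  set l1 := B / (B + √V)
  set l2 := B / (B + √(v k0))
  have hl : l1 ≤ l2 := by
    have : 0 < √(v k0) := Real.sqrt_pos.2 (hv k0)
    exact div_le_div_of_nonneg_left hB.le (by positivity)
      (by linarith [Real.sqrt_le_sqrt hVk])
  have hg1 : 0 ≤ g l1 := by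
    have : ∑ k ∈ s, v k * t0 ^ 2 / (d k ^ 2 - l1 * t0) ^ 2 ≤ ∑ k ∈ s, v k / (1 - l1) ^ 2 := by
      refine Finset.sum_le_sum fun k hk => ?_
      have h1 := hden l1 q1 k ((hmem k).1 hk)
      have h2 : 0 < (1 - l1) * t0 := mul_pos (by linarith) ht0pos
      have h3 : v k / (1 - l1) ^ 2 = v k * t0 ^ 2 / ((1 - l1) * t0) ^ 2 := by
        have : 1 - l1 ≠ 0 := by linarith
        field_simp
      rw [h3]
      exact div_le_div_of_nonneg_left (by have := hv k; positivity) (by positivity)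
        (by gcongr)
    rw [← Finset.sum_div, ← hV] at this
    simp only [hg]
    linarith
  have hg2 : g l2 ≤ 0 := by
    have h0 : v k0 * t0 ^ 2 / (d k0 ^ 2 - l2 * t0) ^ 2
        ≤ ∑ k ∈ s, v k * t0 ^ 2 / (d k ^ 2 - l2 * t0) ^ 2 :=
      Finset.single_le_sum (f := fun k => v k * t0 ^ 2 / (d k ^ 2 - l2 * t0) ^ 2)
        (fun k _ => by have := (hv k).le; positivity) ((hmem k0).2 hk0)
    have h1 : v k0 * t0 ^ 2 / (d k0 ^ 2 - l2 * t0) ^ 2 = v k0 / (1 - l2) ^ 2 := by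
      rw [← ht0]
      have : 1 - l2 ≠ 0 := by linarith
      have : t0 - l2 * t0 = (1 - l2) * t0 := by ring
      rw [this]
      field_simp
    simp only [hg]
    linarith
  have hcont : ContinuousOn g (Set.Icc l1 l2) := by
    refine ContinuousOn.sub ?_ (continuousOn_finsetSum _ fun k hk => ?_)
    · refine ContinuousOn.div (by fun_prop) (by fun_prop) fun l hl => ?_
      have := p1.trans_le hl.1
      positivity
    · refine ContinuousOn.div (by fun_prop) (by fun_prop) fun l hl => ?_
      have h1 := hden l (hl.2.trans_lt q2) k ((hmem k).1 hk)
      have h2 : 0 < (1 - l) * t0 := mul_pos (by linarith [hl.2]) ht0pos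
      have := h2.trans_le h1
      positivity
  obtain ⟨l, hlI, hl0⟩ := intermediate_value_Icc' hl hcont ⟨hg2, hg1⟩
  have hlpos : 0 < l := p1.trans_le hlI.1
  have hl1 : l < 1 := hlI.2.trans_lt q2
  have hdp : ∀ k, k ≠ b → 0 < d k ^ 2 - l * t0 := fun k hk =>
    (mul_pos (by linarith) ht0pos).trans_le (hden l hl1 k hk)
  refine ⟨fun k => if k = b then v b / (l * t0) else v k / (d k ^ 2 - l * t0), ?_, ?_, ?_⟩
  · intro k
    by_cases hk : k = b
    · simp only [hk, if_true]
      have := hv b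
      positivity
    · simp only [hk, if_false]
      exact div_pos (hv k) (hdp k hk)
  · intro k hk
    simp only [hk, if_false, if_true]
    have h1 := (hdp k hk).ne'
    have h2 := (hv k).ne'
    have h3 := (hv b).ne'
    rw [div_div_cancel₀ h3, div_div_cancel₀ h2]
    ring
  · simp only [if_true]
    have h3 := (hv b).ne'
    have hsum : ∑ k ∈ s, (if k = b then v b / (l * t0) else v k / (d k ^ 2 - l * t0)) ^ 2 / v k
        = (∑ k ∈ s, v k * t0 ^ 2 / (d k ^ 2 - l * t0) ^ 2) / t0 ^ 2 := by
      rw [Finset.sum_div]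
      refine Finset.sum_congr rfl fun k hk => ?_
      have h1 := (hdp k ((hmem k).1 hk)).ne'
      have h2 := (hv k).ne'
      rw [if_neg ((hmem k).1 hk)]
      field_simp
    rw [hsum]
    have : ∑ k ∈ s, v k * t0 ^ 2 / (d k ^ 2 - l * t0) ^ 2 = v b / l ^ 2 := by
      simp only [hg] at hl0
      linarith
    rw [this]
    field_simp

/-- There is no state `z` in which `k` attains the minimal ratio up to a factor `1 + δ` although it
is oversampled, by a factor `1 + ε`, relative to the profile: `b` would be undersampled and all its
competitors oversampled, against the balance condition. -/
theorem IsProfile.not_oversampled (hX : IsProfile b v d X) (hv : ∀ k, 0 < v k)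
    {k : K} (hk : k ≠ b) {ε : ℝ} (hε : 0 < ε) :
    ∃ δ > 0, ∀ z : K → ℝ, (∀ l, 0 < z l) → (∀ l, l ≠ b → v b / z b + v l / z l ≤ d l ^ 2) →
      d k ^ 2 ≤ (1 + δ) * (v b / z b + v k / z k) →
      (∑ l ∈ Finset.univ.filter (fun l => l ≠ b), z l ^ 2 / v l) ≤ (1 + δ) * (z b ^ 2 / v b) →
      z k < (1 + ε) * X k := by
  have hXb := hX.pos b
  have hXk := hX.pos k
  have hvb := hv b
  have hvk := hv k
  have hD : 0 < d k ^ 2 := by rw [← hX.level k hk]; positivity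
  -- `γ` is the surplus of `v b / z b` over `v b / X b`, `r` the resulting ratio of `X b` to `z b`
  set γ := v k / X k * (ε / (1 + ε)) / 2 with hγ
  have hγpos : 0 < γ := by positivity
  set r := 1 + γ * X b / v b with hr
  have hrpos : 1 < r := by
    have : 0 < γ * X b / v b := by positivity
    linarith
  refine ⟨min (γ / d k ^ 2) (r - 1), lt_min (by positivity) (by linarith), ?_⟩
  intro z hz hle hk1 hbal
  set δ := min (γ / d k ^ 2) (r - 1) with hδ
  have hδpos : 0 < δ := lt_min (by positivity) (by linarith)
  have hδ1 : δ * d k ^ 2 ≤ γ := by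
    have : δ ≤ γ / d k ^ 2 := min_le_left _ _
    rwa [le_div_iff₀ hD] at this
  have hδ2 : 1 + δ ≤ r := by linarith [min_le_right (γ / d k ^ 2) (r - 1)]
  by_contra hcon
  push Not at hcon
  have hzb := hz b
  have hzk := hz k
  have h1 : v k / z k ≤ v k / X k - 2 * γ := by
    have : v k / z k ≤ v k / ((1 + ε) * X k) :=
      div_le_div_of_nonneg_left hvk.le (by positivity) hcon
    have h : v k / ((1 + ε) * X k) = v k / X k - 2 * γ := by
      rw [hγ]; field_simp; ring
    linarith
  have h2 : d k ^ 2 - γ ≤ v b / z b + v k / z k := by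
    have hS : v b / z b + v k / z k ≤ d k ^ 2 := hle k hk
    nlinarith [mul_le_mul_of_nonneg_left hS hδpos.le]
  have h3 : v b / X b + γ ≤ v b / z b := by
    have := hX.level k hk
    linarith
  have h4 : r * z b ≤ X b := by
    have : r * (v b / X b) ≤ v b / z b := by
      have : r * (v b / X b) = v b / X b + γ := by rw [hr]; field_simp
      linarith
    rw [le_div_iff₀ hzb, mul_comm, ← mul_assoc, ← mul_div_assoc, div_le_iff₀ hXb] at this
    nlinarith
  have h5 : ∀ l, l ≠ b → X l ≤ z l := by
    intro l hl
    have h6 := hX.level l hl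
    have h7 := hle l hl
    have h8 : v l / z l ≤ v l / X l := by linarith
    rw [div_le_div_iff₀ (hz l) (hX.pos l)] at h8
    exact le_of_mul_le_mul_left h8 (hv l)
  have h6 : X b ^ 2 / v b ≤ (1 + δ) * (z b ^ 2 / v b) := by
    rw [hX.balance]
    refine le_trans (Finset.sum_le_sum fun l hl => ?_) hbal
    have hl' : l ≠ b := by simpa using hl
    have := hX.pos l
    have := hv l
    have := h5 l hl'
    gcongr
  have h7 : X b ^ 2 ≤ (1 + δ) * z b ^ 2 := by
    rw [← mul_div_assoc] at h6
    exact (div_le_div_iff_of_pos_right hvb).1 h6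
  have h8 : (r * z b) ^ 2 ≤ X b ^ 2 := by
    have : 0 < r * z b := by positivity
    gcongr
  have : (1 + δ) * z b ^ 2 ≤ r * z b ^ 2 := by gcongr
  have h9 : r * (r * z b ^ 2) ≤ 1 * (r * z b ^ 2) := by nlinarith
  have h10 : 0 < r * z b ^ 2 := by positivity
  have := le_of_mul_le_mul_right h9 h10
  linarith

end Profile

theorem exists_last_increment {N : ℕ → ℕ} {T n : ℕ} (hTn : T ≤ n) (h : N T < N n) :
    ∃ s, T ≤ s ∧ s < n ∧ N (s + 1) ≠ N s ∧ N (s + 1) = N n := by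
  induction n, hTn using Nat.le_induction with
  | base => exact absurd h (lt_irrefl _)
  | succ n hTn ih =>
    by_cases hne : N (n + 1) = N n
    · obtain ⟨s, h1, h2, h3, h4⟩ := ih (hne ▸ h)
      exact ⟨s, h1, h2.trans (Nat.lt_succ_self n), h3, h4.trans hne.symm⟩
    · exact ⟨n, hTn, Nat.lt_succ_self n, hne, rfl⟩

theorem eventually_exists_last_increment {N : ℕ → ℕ} (hN : Tendsto N atTop atTop) (T : ℕ) :
    ∀ᶠ n in atTop, ∃ s, T ≤ s ∧ s < n ∧ N (s + 1) ≠ N s ∧ N (s + 1) = N n := by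
  filter_upwards [eventually_ge_atTop T, hN.eventually_gt_atTop (N T)] with n h1 h2
  exact exists_last_increment h1 h2

section Balance

variable {K : Type*} [Fintype K] [DecidableEq K] [Nontrivial K] {b : K} {v d X : K → ℝ}

/-- The sample sizes of one context follow the profile, scaled by the global minimal rate `m`,
as soon as, up to factors tending to one, `b` is sampled only when it is undersampled relative to
its competitors, and a competitor only when `b` is not undersampled and its own ratio is minimal. -/
theorem IsProfile.tendsto (hX : IsProfile b v d X) (hv : ∀ k, 0 < v k)
    {N : ℕ → K → ℕ} {m : ℕ → ℝ} {n0 : ℕ}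
    (hstep : ∀ n k, N (n + 1) k ≤ N n k + 1)
    (hinf : ∀ k, Tendsto (fun n => N n k) atTop atTop)
    (hNpos : ∀ n, n0 ≤ n → ∀ k, 0 < N n k) (hmpos : ∀ n, n0 ≤ n → 0 < m n)
    (hmmono : ∀ i j, n0 ≤ i → i ≤ j → m i ≤ m j)
    (hE : ∀ n, n0 ≤ n → ∀ k, k ≠ b → m n * (v b / N n b + v k / N n k) ≤ d k ^ 2)
    (hb : ∀ δ > 0, ∀ᶠ n in atTop, N (n + 1) b ≠ N n b → (N n b : ℝ) ^ 2 / v b ≤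
      (1 + δ) * ∑ k ∈ Finset.univ.filter (fun k => k ≠ b), (N n k : ℝ) ^ 2 / v k)
    (hk : ∀ δ > 0, ∀ᶠ n in atTop, ∀ k, k ≠ b → N (n + 1) k ≠ N n k →
      (∑ l ∈ Finset.univ.filter (fun l => l ≠ b), (N n l : ℝ) ^ 2 / v l)
          ≤ (1 + δ) * ((N n b : ℝ) ^ 2 / v b) ∧
        d k ^ 2 ≤ (1 + δ) * (m n * (v b / N n b + v k / N n k))) :
    ∀ k, Tendsto (fun n => (N n k : ℝ) / m n) atTop (𝓝 (X k)) := by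
  -- at the last increment before `n`, the sample size is that at `n`, up to a factor `1 + δ`
  have hlast : ∀ δ > 0, ∀ k, ∀ T, ∀ᶠ n in atTop, ∃ s, T ≤ s ∧ s < n ∧ N (s + 1) k ≠ N s k ∧
      (N n k : ℝ) ≤ (1 + δ) * N s k := by
    intro δ hδ k T
    have h1 : ∀ᶠ s in atTop, 1 / δ ≤ (N s k : ℝ) :=
      (tendsto_natCast_atTop_atTop.comp (hinf k)).eventually_ge_atTop (1 / δ)
    obtain ⟨T1, hT1⟩ := eventually_atTop.1 h1
    filter_upwards [eventually_exists_last_increment (hinf k) (max T T1)] with n ⟨s, h2, h3, h4, h5⟩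
    refine ⟨s, (le_max_left _ _).trans h2, h3, h4, ?_⟩
    have h6 := hT1 s ((le_max_right _ _).trans h2)
    rw [div_le_iff₀ hδ] at h6
    have h7 : (N n k : ℝ) ≤ N s k + 1 := by
      rw [← h5]
      exact_mod_cast hstep s k
    linarith
  -- competitors are not oversampled
  have hup : ∀ ε > 0, ∀ k, k ≠ b → ∀ᶠ n in atTop, (N n k : ℝ) ≤ (1 + ε) * (m n * X k) := by
    intro ε hε k hkb
    have hδ : 0 < ε / (2 + ε) := by positivity
    obtain ⟨δ, hδpos, hstat⟩ := hX.not_oversampled hv hkb (half_pos hε)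
    obtain ⟨T, hT⟩ := eventually_atTop.1 (hk δ hδpos)
    filter_upwards [hlast (ε / (2 + ε)) hδ k (max T n0)] with n ⟨s, h1, h2, h3, h4⟩
    have hs0 := (le_max_right _ _).trans h1
    obtain ⟨h5, h6⟩ := hT s ((le_max_left _ _).trans h1) k hkb h3
    have hm := hmpos s hs0
    have hdiv : ∀ l, v l / ((N s l : ℝ) / m s) = m s * (v l / N s l) := by
      intro l; rw [div_div_eq_mul_div]; ring
    have := hstat (fun l => (N s l : ℝ) / m s)
      (fun l => div_pos (by exact_mod_cast hNpos s hs0 l) hm)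
      (fun l hl => by
        have := hE s hs0 l hl
        simp only [hdiv]; linarith)
      (by simp only [hdiv]; linarith)
      (by
        simp only [div_pow, div_right_comm _ (m s ^ 2)]
        rw [← Finset.sum_div, ← mul_div_assoc]
        gcongr)
    rw [div_lt_iff₀ hm] at this
    have h7 := hmmono s n hs0 h2.le
    have h8 := hX.pos k
    calc (N n k : ℝ) ≤ (1 + ε / (2 + ε)) * ((1 + ε / 2) * X k * m s) := by
          refine h4.trans ?_
          gcongr
      _ ≤ (1 + ε / (2 + ε)) * ((1 + ε / 2) * X k * m n) := by gcongr
      _ = (1 + ε) * (m n * X k) := by field_simp; ring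
  -- neither is `b`
  have hupb : ∀ ε > 0, ∀ᶠ n in atTop, (N n b : ℝ) ≤ (1 + ε) * (m n * X b) := by
    intro ε hε
    have hcont : Tendsto (fun δ : ℝ => (1 + δ) ^ 5) (𝓝[>] 0) (𝓝 1) := by
      have : Tendsto (fun δ : ℝ => (1 + δ) ^ 5) (𝓝 0) (𝓝 ((1 + 0) ^ 5)) :=
        Continuous.tendsto (by fun_prop) 0
      simpa using this.mono_left nhdsWithin_le_nhds
    obtain ⟨δ, hδ1, hδ⟩ := ((hcont.eventually (gt_mem_nhds (show (1 : ℝ) < (1 + ε) ^ 2 by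
      nlinarith))).and self_mem_nhdsWithin).exists
    have hδ : 0 < δ := hδ
    have hall : ∀ᶠ n in atTop, ∀ k, k ≠ b → (N n k : ℝ) ≤ (1 + δ) * (m n * X k) := by
      rw [eventually_all]
      intro k
      by_cases hkb : k = b
      · simp [hkb]
      · filter_upwards [hup δ hδ k hkb] with n hn _ using hn
    obtain ⟨T, hT⟩ := eventually_atTop.1 (hall.and (hb δ hδ))
    filter_upwards [hlast δ hδ b (max T n0)] with n ⟨s, h1, h2, h3, h4⟩
    have hs0 := (le_max_right _ _).trans h1
    obtain ⟨h5, h6⟩ := hT s ((le_max_left _ _).trans h1)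
    have h6 := h6 h3
    have hm := hmpos s hs0
    have h7 := hmmono s n hs0 h2.le
    have hXb := hX.pos b
    have h8 : (N s b : ℝ) ^ 2 / v b ≤ (1 + δ) * ((1 + δ) * m s) ^ 2 * (X b ^ 2 / v b) := by
      rw [hX.balance, mul_assoc]
      refine h6.trans (mul_le_mul_of_nonneg_left ?_ (by positivity))
      rw [Finset.mul_sum]
      refine Finset.sum_le_sum fun k hkm => ?_
      have hkb : k ≠ b := by simpa using hkm
      rw [← mul_div_assoc, ← mul_pow]
      have := hv k
      have := h5 k hkb
      gcongr
      linarith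
    rw [← mul_div_assoc] at h8
    have h9 := (div_le_div_iff_of_pos_right (hv b)).1 h8
    have h10 : ((N n b : ℝ)) ^ 2 ≤ ((1 + ε) * (m n * X b)) ^ 2 := by
      calc ((N n b : ℝ)) ^ 2 ≤ ((1 + δ) * N s b) ^ 2 := by gcongr
        _ = (1 + δ) ^ 2 * (N s b : ℝ) ^ 2 := by ring
        _ ≤ (1 + δ) ^ 2 * ((1 + δ) * ((1 + δ) * m s) ^ 2 * X b ^ 2) := by gcongr
        _ = (1 + δ) ^ 5 * (m s * X b) ^ 2 := by ring
        _ ≤ (1 + ε) ^ 2 * (m n * X b) ^ 2 := by gcongr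
        _ = _ := by ring
    have hmn := hm.trans_le h7
    exact le_of_sq_le_sq h10 (by positivity)
  have hupall : ∀ ε > 0, ∀ k, ∀ᶠ n in atTop, (N n k : ℝ) ≤ (1 + ε) * (m n * X k) := by
    intro ε hε k
    by_cases hkb : k = b
    · exact hkb ▸ hupb ε hε
    · exact hup ε hε k hkb
  -- lower bounds for one member of a pair follow from the upper bound for the other
  have hlow : ∀ k l, (∀ᶠ n in atTop, m n * (v l / N n l + v k / N n k) ≤ v l / X l + v k / X k) →
      Tendsto (fun n => (N n k : ℝ) / m n) atTop (𝓝 (X k)) := by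
    intro k l hkl
    have hlim : Tendsto (fun n => v k / ((N n k : ℝ) / m n)) atTop (𝓝 (v k / X k)) := by
      rw [tendsto_order]
      have hvk := hv k
      have hvl := hv l
      have hXk := hX.pos k
      have hXl := hX.pos l
      -- an upper bound on a sample size, in terms of reciprocals
      have hinv : ∀ ε > 0, ∀ j, ∀ᶠ n in atTop, v j / X j / (1 + ε) ≤ m n * (v j / N n j) := by
        intro ε hε j
        filter_upwards [hupall ε hε j, eventually_ge_atTop n0] with n h1 h2
        have h3 : (0 : ℝ) < N n j := by exact_mod_cast hNpos n h2 j
        have h4 := hX.pos j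
        have h5 := hv j
        rw [div_div, ← mul_div_assoc, div_le_div_iff₀ (by positivity) h3]
        nlinarith
      have hconv : ∀ x : ℝ, Tendsto (fun ε : ℝ => x / (1 + ε)) (𝓝[>] 0) (𝓝 x) := by
        intro x
        have : Tendsto (fun ε : ℝ => x / (1 + ε)) (𝓝 0) (𝓝 (x / (1 + 0))) :=
          tendsto_const_nhds.div (tendsto_const_nhds.add tendsto_id) (by norm_num)
        simpa using this.mono_left nhdsWithin_le_nhds
      have hrw : ∀ n, v k / ((N n k : ℝ) / m n) = m n * (v k / N n k) := by
        intro n; rw [div_div_eq_mul_div]; ring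
      simp only [hrw]
      constructor
      · intro a ha
        obtain ⟨ε, h1, h2⟩ := (((hconv (v k / X k)).eventually (lt_mem_nhds ha)).and
          self_mem_nhdsWithin).exists
        filter_upwards [hinv ε h2 k] with n hn using h1.trans_le hn
      · intro a ha
        obtain ⟨ε, h1, h2⟩ := (((hconv (v l / X l)).eventually
          (lt_mem_nhds (show v l / X l + v k / X k - a < v l / X l by linarith))).and
          self_mem_nhdsWithin).exists
        filter_upwards [hinv ε h2 l, hkl] with n hn hn'
        linarith
    have h1 : Tendsto (fun n => v k / (v k / ((N n k : ℝ) / m n))) atTop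
        (𝓝 (v k / (v k / X k))) :=
      tendsto_const_nhds.div hlim (div_pos (hv k) (hX.pos k)).ne'
    simpa only [div_div_cancel₀ (hv k).ne'] using h1
  intro k
  by_cases hkb : k = b
  · obtain ⟨l, hl⟩ := exists_ne b
    subst hkb
    refine hlow k l ?_
    filter_upwards [eventually_ge_atTop n0] with n hn
    have h1 := hE n hn l hl
    have h2 := hX.level l hl
    rw [add_comm (v l / X l), h2, add_comm (v l / (N n l : ℝ))]
    exact h1
  · refine hlow k b ?_
    filter_upwards [eventually_ge_atTop n0] with n hn
    rw [hX.level k hkb]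
    exact hE n hn k hkb

end Balance

/-! ### The optimal static allocation -/

/-- The profile minimizes the total sample size of a context among all states with rate at least
one, with an explicit gap: the inequalities `1 / x ≥ 1 / X - (x - X) / X ^ 2`, with remainder
`(x - X) ^ 2 / (x * X ^ 2)`, are added up with the multipliers `X k ^ 2 / v k`. -/
theorem IsProfile.sum_sq_le {K : Type*} [Fintype K] [DecidableEq K] {b : K} {v d X x : K → ℝ}
    (hX : IsProfile b v d X) (hv : ∀ k, 0 < v k) (hx : ∀ k, 0 < x k)
    (h : ∀ k, k ≠ b → v b / x b + v k / x k ≤ d k ^ 2) :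
    ∑ k, (x k - X k) ^ 2 / x k ≤ ∑ k, x k - ∑ k, X k := by
  have h1 : ∀ k, (x k - X k) ^ 2 / x k = X k ^ 2 / x k - X k + (x k - X k) := by
    intro k
    have := (hx k).ne'
    field_simp
    ring
  have hsplit : ∀ f : K → ℝ, ∑ k, f k = f b + ∑ k ∈ Finset.univ.filter (fun k => k ≠ b), f k := by
    intro f
    rw [Finset.filter_ne', Finset.add_sum_erase _ _ (Finset.mem_univ b)]
  have h2 : ∑ k, (X k ^ 2 / x k - X k) ≤ 0 := by
    have h3 : X b ^ 2 / x b - X b = ∑ k ∈ Finset.univ.filter (fun k => k ≠ b),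
        X k ^ 2 / v k * (v b / x b - v b / X b) := by
      rw [← Finset.sum_mul, ← hX.balance]
      have := (hx b).ne'
      have := (hX.pos b).ne'
      have := (hv b).ne'
      field_simp
    rw [hsplit, h3, ← Finset.sum_add_distrib]
    refine Finset.sum_nonpos fun k hk => ?_
    have hkb : k ≠ b := by simpa using hk
    have h4 : X k ^ 2 / x k - X k = X k ^ 2 / v k * (v k / x k - v k / X k) := by
      have := (hx k).ne'
      have := (hX.pos k).ne'
      have := (hv k).ne'
      field_simp
    rw [h4, ← mul_add]
    have h5 := hX.level k hkb
    have h6 := h k hkb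
    have h7 : 0 ≤ X k ^ 2 / v k := by have := hv k; positivity
    exact mul_nonpos_of_nonneg_of_nonpos h7 (by linarith)
  rw [Finset.sum_congr rfl fun k _ => h1 k, Finset.sum_add_distrib, Finset.sum_sub_distrib]
  rw [Finset.sum_sub_distrib] at h2 ⊢
  linarith

section Optimal

variable {K C : Type*} [Fintype K] [Fintype C]
  {F : K → C → ℝ} {v : K → C → ℝ≥0} {b : C → K} {X : K → C → ℝ}

instance nonempty_suboptimal {K C : Type*} [Nontrivial K] [Nonempty C] (b : C → K) :
    Nonempty {x : K × C // x.1 ≠ b x.2} := by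
  obtain ⟨c⟩ := ‹Nonempty C›
  obtain ⟨k, hk⟩ := exists_ne (b c)
  exact ⟨⟨(k, c), hk⟩⟩

theorem rate_le {K C : Type*} [Finite K] [Finite C] {F : K → C → ℝ} {v : K → C → ℝ≥0} {b : C → K}
    (p : K → C → ℝ) {k : K} {c : C} (hk : k ≠ b c) :
    rate F v b p ≤ eta F v b p k c / 2 :=
  ciInf_le (f := fun x : {x : K × C // x.1 ≠ b x.2} => eta F v b p x.1.1 x.1.2 / 2)
    (Set.finite_range _).bddBelow ⟨(k, c), hk⟩

variable [DecidableEq K]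

theorem sum_profile_pos [Nonempty K] [Nonempty C]
    (hX : ∀ c, IsProfile (b c) (fun k => (v k c : ℝ)) (fun k => F (b c) c - F k c)
      (fun k => X k c)) :
    0 < ∑ k, ∑ c, X k c :=
  Finset.sum_pos (fun k _ => Finset.sum_pos (fun c _ => (hX c).pos k) Finset.univ_nonempty)
    Finset.univ_nonempty

theorem eta_profile_div {K C : Type*} [Fintype K] [DecidableEq K] {F : K → C → ℝ}
    {v : K → C → ℝ≥0} {b : C → K} {X : K → C → ℝ} (hbest : ∀ c k, k ≠ b c → F k c < F (b c) c)
    (hX : ∀ c, IsProfile (b c) (fun k => (v k c : ℝ)) (fun k => F (b c) c - F k c) (fun k => X k c))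
    {T : ℝ} (hT : 0 < T) {k : K} {c : C} (hk : k ≠ b c) :
    eta F v b (fun k c => X k c / T) k c = 1 / T := by
  have h1 := (hX c).level k hk
  have h2 : 0 < F (b c) c - F k c := sub_pos.2 (hbest c k hk)
  unfold eta
  rw [div_div_eq_mul_div, div_div_eq_mul_div, mul_div_right_comm, mul_div_right_comm, ← add_mul, h1]
  field_simp

variable [Nontrivial K] [Nonempty C]

/-- Scaled by the total of the profiles, an allocation of at least the same rate satisfies the
hypothesis of `IsProfile.sum_sq_le` in every context, while its total is that of the profiles. -/
theorem eq_of_rate_ge (hv : ∀ k c, 0 < v k c)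
    (hX : ∀ c, IsProfile (b c) (fun k => (v k c : ℝ)) (fun k => F (b c) c - F k c) (fun k => X k c))
    {p : K → C → ℝ} (hp : p ∈ allocations K C)
    (hrate : 1 / (∑ k, ∑ c, X k c) / 2 ≤ rate F v b p) :
    p = fun k c => X k c / ∑ k, ∑ c, X k c := by
  have hT := sum_profile_pos hX
  set T := ∑ k, ∑ c, X k c with hTdef
  obtain ⟨hp0, hp1⟩ := hp
  have hxpos : ∀ k c, 0 < T * p k c := fun k c => mul_pos hT (hp0 k c)
  have h1 : ∀ c, ∑ k, (T * p k c - X k c) ^ 2 / (T * p k c) ≤ ∑ k, T * p k c - ∑ k, X k c := by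
    intro c
    refine (hX c).sum_sq_le (fun k => by exact_mod_cast hv k c) (fun k => hxpos k c) ?_
    intro k hk
    have h2 : 1 / T ≤ eta F v b p k c := by
      have := hrate.trans (rate_le p hk)
      linarith
    have h3 : 0 < (v (b c) c : ℝ) / p (b c) c + (v k c : ℝ) / p k c := by
      have h4 : (0 : ℝ) < v (b c) c := by exact_mod_cast hv _ _
      have h5 : (0 : ℝ) < v k c := by exact_mod_cast hv _ _
      have := hp0 (b c) c
      have := hp0 k c
      positivity
    unfold eta at h2
    rw [div_le_div_iff₀ hT h3] at h2
    rw [mul_comm T, mul_comm T, ← div_div, ← div_div, ← add_div, div_le_iff₀ hT]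
    linarith
  have h2 : ∑ c, ∑ k, (T * p k c - X k c) ^ 2 / (T * p k c) ≤ 0 := by
    refine (Finset.sum_le_sum fun c _ => h1 c).trans ?_
    rw [Finset.sum_sub_distrib, Finset.sum_comm, Finset.sum_comm (f := fun c k => X k c)]
    simp only [← Finset.mul_sum]
    rw [hp1, mul_one, hTdef, sub_self]
  have hterm : ∀ k c, 0 ≤ (T * p k c - X k c) ^ 2 / (T * p k c) := fun k c => by
    have := hxpos k c
    positivity
  funext k c
  have h3 : (T * p k c - X k c) ^ 2 / (T * p k c) ≤ 0 :=
    calc _ ≤ ∑ k, (T * p k c - X k c) ^ 2 / (T * p k c) :=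
          Finset.single_le_sum (f := fun k => (T * p k c - X k c) ^ 2 / (T * p k c))
            (fun k _ => hterm k c) (Finset.mem_univ k)
      _ ≤ ∑ c, ∑ k, (T * p k c - X k c) ^ 2 / (T * p k c) :=
          Finset.single_le_sum (f := fun c => ∑ k, (T * p k c - X k c) ^ 2 / (T * p k c))
            (fun c _ => Finset.sum_nonneg fun k _ => hterm k c) (Finset.mem_univ c)
      _ ≤ 0 := h2
  have h4 := le_antisymm h3 (hterm k c)
  rw [div_eq_zero_iff] at h4
  have h5 : T * p k c - X k c = 0 := by
    rcases h4 with h4 | h4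
    · exact pow_eq_zero_iff (two_ne_zero) |>.1 h4
    · exact absurd h4 (hxpos k c).ne'
  rw [eq_div_iff hT.ne']
  linarith

theorem isOptimal_profile_div (hv : ∀ k c, 0 < v k c) (hbest : ∀ c k, k ≠ b c → F k c < F (b c) c)
    (hX : ∀ c, IsProfile (b c) (fun k => (v k c : ℝ)) (fun k => F (b c) c - F k c)
      (fun k => X k c)) :
    IsOptimal F v b (fun k c => X k c / ∑ k, ∑ c, X k c) ∧
      ∀ q, IsOptimal F v b q → q = fun k c => X k c / ∑ k, ∑ c, X k c := by
  have hT := sum_profile_pos hX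
  set T := ∑ k, ∑ c, X k c with hTdef
  have hrate : rate F v b (fun k c => X k c / T) = 1 / T / 2 := by
    unfold rate
    rw [iInf_congr (g := fun _ => 1 / T / 2) fun x => by
      rw [eta_profile_div hbest hX hT x.2], ciInf_const]
  have hmem : (fun k c => X k c / T) ∈ allocations K C := by
    refine ⟨fun k c => div_pos ((hX c).pos k) hT, ?_⟩
    simp only [← Finset.sum_div]
    rw [← hTdef, div_self hT.ne']
  refine ⟨⟨hmem, ?_⟩, ?_⟩
  · intro p hp
    simp only [Set.mem_ofPred_eq]
    by_contra hcon
    push Not at hcon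
    have := eq_of_rate_ge hv hX hp (by rw [← hTdef, ← hrate]; exact hcon.le)
    rw [← hTdef] at this
    rw [this] at hcon
    exact lt_irrefl _ hcon
  · intro q hq
    refine eq_of_rate_ge hv hX hq.1 ?_
    rw [← hTdef, ← hrate]
    exact hq.2 hmem

/-- Convergence to the optimal allocation implies the three asymptotic optimality conditions,
since these hold exactly in the limit. -/
theorem tendsto_balance_and_eta (hv : ∀ k c, 0 < v k c)
    (hbest : ∀ c k, k ≠ b c → F k c < F (b c) c)
    (hX : ∀ c, IsProfile (b c) (fun k => (v k c : ℝ)) (fun k => F (b c) c - F k c) (fun k => X k c))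
    {p : ℕ → K → C → ℝ}
    (hp : ∀ k c, Tendsto (fun n => p n k c) atTop (𝓝 (X k c / ∑ k, ∑ c, X k c))) :
    (∀ c, Tendsto (fun n => p n (b c) c ^ 2 / (v (b c) c : ℝ)
      - ∑ k ∈ Finset.univ.filter (fun k => k ≠ b c), p n k c ^ 2 / (v k c : ℝ)) atTop (𝓝 0)) ∧
    (∀ c c' k k', k ≠ b c → k' ≠ b c' →
      Tendsto (fun n => eta F v b (p n) k c - eta F v b (p n) k' c') atTop (𝓝 0)) := by
  have hT := sum_profile_pos hX
  set T := ∑ k, ∑ c, X k c with hTdef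
  constructor
  · intro c
    have h1 : Tendsto (fun n => p n (b c) c ^ 2 / (v (b c) c : ℝ)
        - ∑ k ∈ Finset.univ.filter (fun k => k ≠ b c), p n k c ^ 2 / (v k c : ℝ)) atTop
        (𝓝 ((X (b c) c / T) ^ 2 / (v (b c) c : ℝ)
        - ∑ k ∈ Finset.univ.filter (fun k => k ≠ b c), (X k c / T) ^ 2 / (v k c : ℝ))) :=
      (((hp _ _).pow 2).div_const _).sub
        (tendsto_finsetSum _ fun k _ => ((hp _ _).pow 2).div_const _)
    have h2 : (X (b c) c / T) ^ 2 / (v (b c) c : ℝ)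
        - ∑ k ∈ Finset.univ.filter (fun k => k ≠ b c), (X k c / T) ^ 2 / (v k c : ℝ) = 0 := by
      simp only [div_pow, div_right_comm _ (T ^ 2)]
      rw [← Finset.sum_div, (hX c).balance, sub_self]
    rwa [h2] at h1
  · have heta : ∀ c k, k ≠ b c → Tendsto (fun n => eta F v b (p n) k c) atTop (𝓝 (1 / T)) := by
      intro c k hk
      rw [← eta_profile_div hbest hX hT hk]
      have h1 : ∀ l, 0 < (v l c : ℝ) / (X l c / T) := fun l => by
        have h2 : (0 : ℝ) < v l c := by exact_mod_cast hv _ _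
        have := (hX c).pos l
        positivity
      have h2 : ∀ l, X l c / T ≠ 0 := fun l => (div_pos ((hX c).pos l) hT).ne'
      exact tendsto_const_nhds.div
        ((tendsto_const_nhds.div (hp _ _) (h2 _)).add (tendsto_const_nhds.div (hp _ _) (h2 _)))
        (add_pos (h1 _) (h1 _)).ne'
    intro c c' k k' hk hk'
    simpa using (heta c k hk).sub (heta c' k' hk')

end Optimal

/-! ### Sampling trajectories -/

section Counts

variable {K C : Type*} [DecidableEq K] [DecidableEq C] {a : ℕ → K × C}

theorem sampleCount_succ (a : ℕ → K × C) (n : ℕ) (k : K) (c : C) :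
    sampleCount a (n + 1) k c = sampleCount a n k c + if a n = (k, c) then 1 else 0 := by
  unfold sampleCount
  rw [Finset.range_add_one, Finset.filter_insert]
  split_ifs with h
  · rw [Finset.card_insert_of_notMem (by simp)]
  · rfl

theorem sampleCount_mono (a : ℕ → K × C) (k : K) (c : C) :
    Monotone fun n => sampleCount a n k c :=
  monotone_nat_of_le_succ fun n => by rw [sampleCount_succ]; exact Nat.le_add_right _ _

theorem eventually_ne_of_not_tendsto {k : K} {c : C}
    (h : ¬ Tendsto (fun n => sampleCount a n k c) atTop atTop) :
    ∀ᶠ n in atTop, a n ≠ (k, c) := by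
  by_contra hcon
  refine h (tendsto_atTop_atTop_of_monotone (sampleCount_mono a k c) fun B => ?_)
  induction B with
  | zero => exact ⟨0, Nat.zero_le _⟩
  | succ B ih =>
    obtain ⟨n, hn⟩ := ih
    rw [eventually_atTop] at hcon
    push Not at hcon
    obtain ⟨m, hm, hm'⟩ := hcon n
    refine ⟨m + 1, ?_⟩
    rw [sampleCount_succ, if_pos hm']
    exact Nat.succ_le_succ (hn.trans (sampleCount_mono a k c hm))

theorem sampleCount_eq_of_forall_ne {k : K} {c : C} {T : ℕ} (h : ∀ n, T ≤ n → a n ≠ (k, c))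
    {n : ℕ} (hn : T ≤ n) : sampleCount a n k c = sampleCount a T k c := by
  induction n, hn using Nat.le_induction with
  | base => rfl
  | succ n hn ih => rw [sampleCount_succ, if_neg (h n hn), ih, add_zero]

theorem exists_tendsto_sampleCount [Finite K] [Finite C] (a : ℕ → K × C) :
    ∃ k c, Tendsto (fun n => sampleCount a n k c) atTop atTop := by
  by_contra! hcon
  have h : ∀ᶠ n in atTop, ∀ x : K × C, a n ≠ x := by
    rw [eventually_all]
    exact fun x => eventually_ne_of_not_tendsto (hcon x.1 x.2)
  obtain ⟨n, hn⟩ := h.exists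
  exact hn _ rfl

theorem sum_sampleCount [Fintype K] [Fintype C] (a : ℕ → K × C) (n : ℕ) :
    ∑ k, ∑ c, sampleCount a n k c = n := by
  induction n with
  | zero => simp [sampleCount]
  | succ n ih =>
    simp only [sampleCount_succ, Finset.sum_add_distrib, ih]
    congr 1
    rw [← Fintype.sum_prod_type' (f := fun k c => if a n = (k, c) then 1 else 0)]
    simp

end Counts

/-- Posterior precision of the pair `(k, c)`, for the prior precision `α k c`. -/
noncomputable def prec {K C : Type*} [DecidableEq K] [DecidableEq C]
    (v : K → C → ℝ≥0) (α : K → C → ℝ) (a : ℕ → K × C) (n : ℕ) (k : K) (c : C) : ℝ :=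
  α k c + (sampleCount a n k c : ℝ) / (v k c : ℝ)

/-- Posterior mean of the pair `(k, c)`: here `W k c j` is the sum of the noise in the first `j`
samples of the pair, and `β k c` is the prior precision times the error of the prior mean. -/
noncomputable def fitMean {K C : Type*} [DecidableEq K] [DecidableEq C] (F : K → C → ℝ)
    (v : K → C → ℝ≥0) (α β : K → C → ℝ) (W : K → C → ℕ → ℝ) (a : ℕ → K × C)
    (n : ℕ) (k : K) (c : C) : ℝ :=
  F k c + (β k c + W k c (sampleCount a n k c) / (v k c : ℝ)) / prec v α a n k c

/-- One sample path of the policy from time `n0` on. The prior enters only through its precisions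
`α` and the numbers `β`, and the noise only through its partial sums `W k c` along the
samples of each pair, which obey the law of large numbers. -/
structure IsTrajectory {K C : Type*} [Fintype K] [DecidableEq K] [DecidableEq C] (F : K → C → ℝ)
    (v : K → C → ℝ≥0) (α β : K → C → ℝ) (W : K → C → ℕ → ℝ) (n0 : ℕ) (a : ℕ → K × C) : Prop where
  v_pos : ∀ k c, 0 < v k c
  prior_nonneg : ∀ k c, 0 ≤ α k c
  prec_pos : ∀ n, n0 ≤ n → ∀ k c, 0 < prec v α a n k c
  slln : ∀ k c, Tendsto (fun j : ℕ => W k c j / j) atTop (𝓝 0)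
  step : ∀ n, n0 ≤ n → IsStep (fitMean F v α β W a n) (fun k c => (prec v α a n k c)⁻¹)
    (allocFrac a n) (a n)

section Trajectory

variable {K C : Type*} [Fintype K] [DecidableEq K] [DecidableEq C] {F : K → C → ℝ}
  {v : K → C → ℝ≥0} {α β : K → C → ℝ} {W : K → C → ℕ → ℝ} {n0 : ℕ} {a : ℕ → K × C}

namespace IsTrajectory

variable (h : IsTrajectory F v α β W n0 a)

include h

theorem v_pos' (k : K) (c : C) : (0 : ℝ) < v k c := by exact_mod_cast h.v_pos k c

theorem prec_nonneg (n : ℕ) (k : K) (c : C) : 0 ≤ prec v α a n k c :=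
  add_nonneg (h.prior_nonneg k c) (by positivity)

theorem div_le_prec (n : ℕ) (k : K) (c : C) :
    (sampleCount a n k c : ℝ) / (v k c : ℝ) ≤ prec v α a n k c :=
  le_add_of_nonneg_left (h.prior_nonneg k c)

theorem tendsto_prec {k : K} {c : C} (hN : Tendsto (fun n => sampleCount a n k c) atTop atTop) :
    Tendsto (fun n => prec v α a n k c) atTop atTop :=
  tendsto_atTop_add_const_left _ _
    ((tendsto_natCast_atTop_atTop.comp hN).atTop_div_const (h.v_pos' k c))

theorem tendsto_fitMean {k : K} {c : C}
    (hN : Tendsto (fun n => sampleCount a n k c) atTop atTop) :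
    Tendsto (fun n => fitMean F v α β W a n k c) atTop (𝓝 (F k c)) := by
  have hNr : Tendsto (fun n => (sampleCount a n k c : ℝ)) atTop atTop :=
    tendsto_natCast_atTop_atTop.comp hN
  have hv := h.v_pos' k c
  have h1 : Tendsto (fun n => β k c / (sampleCount a n k c : ℝ)
      + W k c (sampleCount a n k c) / (sampleCount a n k c : ℝ) / (v k c : ℝ)) atTop
      (𝓝 (0 + 0 / (v k c : ℝ))) :=
    (hNr.const_div_atTop _).add (((h.slln k c).comp hN).div_const _)
  have h2 : Tendsto (fun n => α k c / (sampleCount a n k c : ℝ) + 1 / (v k c : ℝ)) atTop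
      (𝓝 (0 + 1 / (v k c : ℝ))) :=
    (hNr.const_div_atTop _).add tendsto_const_nhds
  have h3 := (h1.div h2 (by positivity)).const_add (F k c)
  have h4 : F k c + (0 + 0 / (v k c : ℝ)) / (0 + 1 / (v k c : ℝ)) = F k c := by simp
  rw [h4] at h3
  refine h3.congr' ?_
  filter_upwards [hNr.eventually_gt_atTop 0] with n hn
  have hn' := hn.ne'
  simp only [Pi.div_apply]
  unfold fitMean prec
  congr 1
  rw [← mul_div_mul_right (β k c + _) (α k c + _) (inv_ne_zero hn')]
  congr 1
  · simp only [div_eq_mul_inv]; ring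
  · field_simp

theorem eventually_abs_fitMean_le (k : K) (c : C) :
    ∃ B, ∀ᶠ n in atTop, |fitMean F v α β W a n k c| ≤ B := by
  by_cases hN : Tendsto (fun n => sampleCount a n k c) atTop atTop
  · refine ⟨|F k c| + 1, ?_⟩
    exact ((h.tendsto_fitMean hN).abs.eventually (ge_mem_nhds (lt_add_one _)))
  · obtain ⟨T, hT⟩ := eventually_atTop.1 (eventually_ne_of_not_tendsto hN)
    refine ⟨|fitMean F v α β W a T k c|, ?_⟩
    filter_upwards [eventually_ge_atTop T] with n hn
    unfold fitMean prec
    rw [sampleCount_eq_of_forall_ne hT hn]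

/-- As long as some pair is sampled only finitely often, the criterion `ζ` stays bounded at the
pairs selected by the policy. -/
theorem exists_zeta_le [Nontrivial K] [Finite C] {k0 : K} {c0 : C}
    (hN : ¬ Tendsto (fun n => sampleCount a n k0 c0) atTop atTop) :
    ∃ B0, ∀ᶠ n in atTop, ∀ (b : C → K) (k : K) (c : C),
      (∀ k' c', k' ≠ b c' → zeta (fitMean F v α β W a n) (fun k c => (prec v α a n k c)⁻¹) b k c
        ≤ zeta (fitMean F v α β W a n) (fun k c => (prec v α a n k c)⁻¹) b k' c') →
      zeta (fitMean F v α β W a n) (fun k c => (prec v α a n k c)⁻¹) b k c ≤ B0 := by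
  choose B hB using fun k => h.eventually_abs_fitMean_le k c0
  obtain ⟨T, hT⟩ := eventually_atTop.1 (eventually_ne_of_not_tendsto hN)
  set M := ∑ k, |B k| with hM
  set T' := max T n0
  have hp : 0 < prec v α a T' k0 c0 := h.prec_pos T' (le_max_right _ _) k0 c0
  refine ⟨(2 * M) ^ 2 * prec v α a T' k0 c0, ?_⟩
  filter_upwards [eventually_all.2 hB, eventually_ge_atTop T'] with n h1 h2 b k c hmin
  have hn0 : n0 ≤ n := (le_max_right _ _).trans h2
  have hconst : prec v α a n k0 c0 = prec v α a T' k0 c0 := by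
    unfold prec
    rw [sampleCount_eq_of_forall_ne hT ((le_max_left _ _).trans h2),
      sampleCount_eq_of_forall_ne hT (le_max_left _ _)]
  have hbd : ∀ k, |fitMean F v α β W a n k c0| ≤ M := fun k =>
    (h1 k).trans ((le_abs_self _).trans
      (Finset.single_le_sum (f := fun k => |B k|) (fun _ _ => abs_nonneg _) (Finset.mem_univ k)))
  have key : ∀ k l, (k = k0 ∨ l = k0) →
      (fitMean F v α β W a n k c0 - fitMean F v α β W a n l c0) ^ 2
        / ((prec v α a n k c0)⁻¹ + (prec v α a n l c0)⁻¹)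
      ≤ (2 * M) ^ 2 * prec v α a T' k0 c0 := by
    intro k l hkl
    have hk := inv_pos.2 (h.prec_pos n hn0 k c0)
    have hl := inv_pos.2 (h.prec_pos n hn0 l c0)
    have hden : (prec v α a T' k0 c0)⁻¹ ≤ (prec v α a n k c0)⁻¹ + (prec v α a n l c0)⁻¹ := by
      rw [← hconst]
      rcases hkl with rfl | rfl <;> linarith
    have hnum : (fitMean F v α β W a n k c0 - fitMean F v α β W a n l c0) ^ 2 ≤ (2 * M) ^ 2 := by
      refine sq_le_sq' ?_ ?_ <;>
        linarith [abs_le.1 (hbd k), abs_le.1 (hbd l), (abs_le.1 (hbd k)).1, (abs_le.1 (hbd k)).2,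
          (abs_le.1 (hbd l)).1, (abs_le.1 (hbd l)).2]
    calc _ ≤ (2 * M) ^ 2 / (prec v α a T' k0 c0)⁻¹ := by
          gcongr
      _ = _ := by rw [div_inv_eq_mul]
  by_cases hb : b c0 = k0
  · obtain ⟨l, hl⟩ := exists_ne k0
    exact (hmin l c0 (hb ▸ hl)).trans (key _ _ (Or.inl hb))
  · exact (hmin k0 c0 (Ne.symm hb)).trans (key _ _ (Or.inr rfl))

end IsTrajectory

/-- The comparison of `ψ⁽¹⁾` and `ψ⁽²⁾`, with the common factor `1 / n` removed. -/
theorem psi_lt_iff {n : ℕ} (hn : 0 < n) (b : C → K) (c : C) :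
    psi1 (allocFrac a n) (fun k c => (prec v α a n k c)⁻¹) b c
        < psi2 (allocFrac a n) (fun k c => (prec v α a n k c)⁻¹) b c ↔
      (sampleCount a n (b c) c : ℝ) * prec v α a n (b c) c
        < ∑ k ∈ Finset.univ.filter (fun k => k ≠ b c),
            (sampleCount a n k c : ℝ) * prec v α a n k c := by
  have hn' : (0 : ℝ) < n := by exact_mod_cast hn
  unfold psi1 psi2 allocFrac
  simp only [div_inv_eq_mul, div_mul_eq_mul_div]
  rw [← Finset.sum_div, div_lt_div_iff_of_pos_right hn']

end Trajectory

/-! ### Every pair is sampled infinitely often -/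

/-- If an arm can only grow (by a factor of at most four in one step) while it is below `Q`, or
while all arms of higher rank are below `Q` and it is dominated by the sum of the other arms, then
all arms stay below a fixed multiple of `Q`. -/
theorem le_of_ranked_growth {K : Type*} [Fintype K] [DecidableEq K] {rk : K → ℕ}
    (hrk : Function.Injective rk) {q : ℕ → K → ℝ} {Q : ℝ} (hQ : 0 ≤ Q) {n1 : ℕ}
    (h1 : ∀ k, q n1 k ≤ Q)
    (hstep : ∀ n, n1 ≤ n → (∀ k, q n k ≤ 4 * (Fintype.card K + 1) * 5 ^ rk k * Q) → ∀ x,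
      q (n + 1) x ≤ q n x ∨ (q (n + 1) x ≤ 4 * q n x ∧ (q n x ≤ Q ∨
        ((∀ l, rk x < rk l → q n l ≤ Q) ∧
          q n x ≤ ∑ l ∈ Finset.univ.filter (fun l => l ≠ x), q n l)))) :
    ∀ n, n1 ≤ n → ∀ k, q n k ≤ 4 * (Fintype.card K + 1) * 5 ^ rk k * Q := by
  have hge : ∀ k, Q ≤ (Fintype.card K + 1) * 5 ^ rk k * Q := by
    intro k
    have h2 : (1 : ℝ) ≤ 5 ^ rk k := one_le_pow₀ (by norm_num)
    have h3 : (1 : ℝ) ≤ Fintype.card K + 1 := by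
      have : (0 : ℝ) ≤ Fintype.card K := by positivity
      linarith
    exact le_mul_of_one_le_left hQ (one_le_mul_of_one_le_of_one_le h3 h2)
  intro n hn
  induction n, hn using Nat.le_induction with
  | base =>
    intro k
    linarith [h1 k, hge k]
  | succ n hn ih =>
    intro x
    rcases hstep n hn ih x with h2 | ⟨h2, h3 | ⟨h3, h4⟩⟩
    · exact h2.trans (ih x)
    · linarith [hge x]
    · have hgeom : ∀ R : ℕ, ∑ i ∈ Finset.range R, (4 : ℝ) * 5 ^ i = 5 ^ R - 1 := by
        intro R
        induction R with
        | zero => simp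
        | succ R ihR => rw [Finset.sum_range_succ, ihR]; ring
      have h5 : ∑ l ∈ Finset.univ.filter (fun l => l ≠ x), q n l ≤
          ∑ l ∈ Finset.univ.filter (fun l => rk l < rk x),
            4 * (Fintype.card K + 1) * 5 ^ rk l * Q + ∑ _l : K, Q := by
        rw [Finset.sum_filter, Finset.sum_filter, ← Finset.sum_add_distrib]
        refine Finset.sum_le_sum fun l _ => ?_
        by_cases hl : l = x
        · subst hl
          simpa using hQ
        · rw [if_pos hl]
          by_cases hl2 : rk l < rk x
          · rw [if_pos hl2]
            linarith [ih l]
          · rw [if_neg hl2, zero_add]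
            exact h3 l (lt_of_le_of_ne (not_lt.1 hl2) fun h => hl (hrk h).symm)
      have h6 : ∑ l ∈ Finset.univ.filter (fun l => rk l < rk x),
          4 * ((Fintype.card K : ℝ) + 1) * 5 ^ rk l * Q
            ≤ (Fintype.card K + 1) * (5 ^ rk x - 1) * Q := by
        rw [← hgeom, ← Finset.sum_image
          (f := fun i => 4 * ((Fintype.card K : ℝ) + 1) * 5 ^ i * Q) (g := rk) (by
            intro a _ b _ hab
            exact hrk hab), Finset.mul_sum, Finset.sum_mul]
        calc _ ≤ ∑ i ∈ Finset.range (rk x), 4 * ((Fintype.card K : ℝ) + 1) * 5 ^ i * Q := by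
              refine Finset.sum_le_sum_of_subset_of_nonneg ?_ fun _ _ _ => by positivity
              intro i hi
              simp only [Finset.mem_image, Finset.mem_filter, Finset.mem_univ, true_and] at hi
              obtain ⟨l, hl, rfl⟩ := hi
              exact Finset.mem_range.2 hl
          _ = _ := Finset.sum_congr rfl fun _ _ => by ring
      have h7 : ∑ _l : K, Q = Fintype.card K * Q := by simp
      rw [h7] at h5
      have h8 : q n x ≤ (Fintype.card K + 1) * 5 ^ rk x * Q := by
        nlinarith [h4, h5, h6]
      linarith

/-- The partial sums `w k` of several arms drift apart, in the order given by `rk`, over long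
windows and at arbitrarily large scales: for `j` between `s ^ 2` and `ρ * s ^ 2` the average
`w k j / j` is close to `H * rk k / s`, which is a large multiple of its standard deviation. -/
def IsSpread {K : Type*} (rk : K → ℕ) (w : K → ℕ → ℝ) : Prop :=
  ∀ (ρ : ℕ) (H0 : ℝ), ∃ H, H0 ≤ H ∧ 0 < H ∧ ∃ᶠ s : ℕ in atTop, ∀ k, ∀ j : ℕ, s ^ 2 ≤ j →
    j ≤ ρ * s ^ 2 → |w k j - H * rk k * j / s| ≤ H * j / (4 * s)

section Consistency

variable {K C : Type*} [Fintype K] [DecidableEq K] [DecidableEq C] {F : K → C → ℝ}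
  {v : K → C → ℝ≥0} {α β : K → C → ℝ} {W : K → C → ℕ → ℝ} {n0 : ℕ} {a : ℕ → K × C}

/-- In a window where the noise averages have drifted apart, so have the posterior means. -/
theorem IsTrajectory.eventually_abs_fitMean_sub_le (h : IsTrajectory F v α β W n0 a)
    (k : K) (c : C) (r : ℕ) {H : ℝ} (hH : 0 < H) :
    ∀ᶠ s : ℕ in atTop, ∀ n, s ^ 2 ≤ sampleCount a n k c →
      |W k c (sampleCount a n k c) - H * r * (sampleCount a n k c) / s|
        ≤ H * (sampleCount a n k c) / (4 * s) →
      |fitMean F v α β W a n k c - F k c - H * r / s| ≤ 2 / 5 * (H / s) := by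
  have hv := h.v_pos' k c
  have hα := h.prior_nonneg k c
  filter_upwards [eventually_ge_atTop 1, tendsto_natCast_atTop_atTop.eventually_ge_atTop
    ((|β k c| + α k c * (H * r)) * v k c / (3 / 20 * H))] with s hs1 hs2 n hn hW
  set j := sampleCount a n k c with hj
  have hs : (1 : ℝ) ≤ s := by exact_mod_cast hs1
  have hs0 : (0 : ℝ) < s := by linarith
  have hjs : (s : ℝ) ^ 2 ≤ j := by exact_mod_cast hn
  have hj0 : (0 : ℝ) < j := lt_of_lt_of_le (by positivity) hjs
  have hp : 0 < prec v α a n k c := by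
    unfold prec
    rw [← hj]
    positivity
  have e1 : fitMean F v α β W a n k c - F k c - H * r / s
      = (β k c + (W k c j - H * r * j / s) / v k c - α k c * (H * r / s)) / prec v α a n k c := by
    rw [eq_div_iff hp.ne']
    unfold fitMean
    rw [← hj, add_sub_cancel_left, sub_mul, div_mul_cancel₀ _ hp.ne']
    unfold prec
    rw [← hj]
    field_simp
    ring
  rw [e1, abs_div, abs_of_pos hp, div_le_iff₀ hp]
  rw [div_le_iff₀ (by positivity)] at hs2
  have h1 : |(W k c j - H * r * j / s) / v k c| ≤ H * j / (4 * s) / v k c := by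
    rw [abs_div, abs_of_pos hv]
    gcongr
  have h2 : |α k c * (H * r / s)| ≤ α k c * (H * r) := by
    rw [abs_of_nonneg (by positivity)]
    gcongr
    exact div_le_self (by positivity) hs
  have h3 : |β k c| + α k c * (H * r) ≤ 3 / 20 * (H / s * (j / v k c)) := by
    calc |β k c| + α k c * (H * r) ≤ s * (3 / 20 * H) / v k c := by
          rw [le_div_iff₀ hv]
          exact hs2
      _ = 3 / 20 * (H / s * (s ^ 2 / v k c)) := by field_simp
      _ ≤ _ := by gcongr
  have h4 : H * j / (4 * s) / v k c = 1 / 4 * (H / s * (j / v k c)) := by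
    field_simp
  have h5 : H / s * (j / v k c) ≤ H / s * prec v α a n k c := by
    have := h.div_le_prec n k c
    rw [← hj] at this
    gcongr
  have h6 := abs_sub (β k c + (W k c j - H * r * j / s) / v k c) (α k c * (H * r / s))
  have h7 := abs_add_le (β k c) ((W k c j - H * r * j / s) / v k c)
  linarith

/-- In a window where the noise averages have drifted apart, two arms with equal rewards are
separated by many posterior standard deviations. -/
theorem lt_zeta_of_spread {μk μl Vk Vl vk vl f s H r r' B : ℝ} (hs : 0 < s) (hH : 0 < H)
    (hr : r' + 1 ≤ r) (hk : |μk - f - H * r / s| ≤ 2 / 5 * (H / s))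
    (hl : |μl - f - H * r' / s| ≤ 2 / 5 * (H / s))
    (hVk : 0 < Vk) (hVl : 0 < Vl) (hVk' : Vk ≤ vk / s ^ 2) (hVl' : Vl ≤ vl / s ^ 2)
    (hB : 0 ≤ B) (hBH : 25 * B * (vk + vl) < H ^ 2) :
    μl < μk ∧ B < (μk - μl) ^ 2 / (Vk + Vl) := by
  have hHs : 0 < H / s := by positivity
  have h1 : 1 / 5 * (H / s) ≤ μk - μl := by
    have h2 : H * r' / s + H / s ≤ H * r / s := by
      rw [← add_div]
      gcongr
      nlinarith
    have := (abs_le.1 hk).1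
    have := (abs_le.1 hl).2
    linarith
  refine ⟨by linarith, ?_⟩
  rw [lt_div_iff₀ (by positivity)]
  calc B * (Vk + Vl) ≤ B * (vk / s ^ 2 + vl / s ^ 2) := by gcongr
    _ = 25 * B * (vk + vl) / (25 * s ^ 2) := by field_simp
    _ < H ^ 2 / (25 * s ^ 2) := by gcongr
    _ = (1 / 5 * (H / s)) ^ 2 := by field_simp; norm_num
    _ ≤ (μk - μl) ^ 2 := by gcongr

/-- One more sample multiplies the product of sample size and precision by four at most. -/
theorem count_mul_prec_succ_le {N : ℕ} (hN : 0 < N) {p v : ℝ} (hp : 0 ≤ p) (hv : 0 < v) :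
    ((N + 1 : ℕ) : ℝ) * (p + ((N + 1 : ℕ) : ℝ) / v) ≤ 4 * (N * (p + N / v)) := by
  have h1 : ((N + 1 : ℕ) : ℝ) ≤ 2 * N := by
    have : (1 : ℝ) ≤ N := by exact_mod_cast hN
    push_cast
    linarith
  calc ((N + 1 : ℕ) : ℝ) * (p + ((N + 1 : ℕ) : ℝ) / v) ≤ (2 * N) * (p + (2 * N) / v) := by gcongr
    _ ≤ (2 * N) * (2 * p + (2 * N) / v) := by gcongr; linarith
    _ = _ := by ring

/-- The policy samples every pair infinitely often on every trajectory whose noise spreads the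
arms of each context at arbitrarily large scales. Otherwise `ζ` stays bounded at the selected
pairs. In a context that is selected infinitely often, consider the arms that are sampled
infinitely often. In a window of the spread, any two of them that are already inside the window
are too well separated to be selected against each other; so only the best of them can still be
sampled, and only until it is balanced by the others. Hence no arm ever leaves the window. -/
theorem IsTrajectory.tendsto_sampleCount [Finite C] [Nontrivial K]
    (h : IsTrajectory F v α β W n0 a)
    {rk : C → K → ℕ} (hrk : ∀ c, Function.Injective (rk c))
    (hrkF : ∀ c k l, F k c < F l c → rk c k < rk c l)
    (hW : ∀ c, IsSpread (rk c) (fun k => W k c)) (k0 : K) (c0 : C) :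
    Tendsto (fun n => sampleCount a n k0 c0) atTop atTop := by
  by_contra hcon
  obtain ⟨B0, hB0⟩ := h.exists_zeta_le hcon
  obtain ⟨kS, c, hkS⟩ := exists_tendsto_sampleCount a
  set S : Set K := {k | Tendsto (fun n => sampleCount a n k c) atTop atTop} with hS
  set B := max B0 0 with hB
  set q : ℕ → K → ℝ := fun n k => (sampleCount a n k c : ℝ) * prec v α a n k c with hq
  have hqnonneg : ∀ n k, 0 ≤ q n k := fun n k =>
    mul_nonneg (by positivity) (h.prec_nonneg n k c)
  have hqtop : ∀ k ∈ S, Tendsto (fun n => q n k) atTop atTop := fun k hk =>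
    (tendsto_natCast_atTop_atTop.comp hk).atTop_mul_atTop₀ (h.tendsto_prec hk)
  -- only the arms of `S` are sampled in this context, from some time on
  have ev1 : ∀ᶠ n in atTop, ∀ k, k ∉ S → a n ≠ (k, c) := by
    rw [eventually_all]
    intro k
    by_cases hk : k ∈ S
    · simp [hk]
    · filter_upwards [eventually_ne_of_not_tendsto hk] with n hn _ using hn
  obtain ⟨T1, hT1⟩ := eventually_atTop.1 ev1
  have hqconst : ∀ k, k ∉ S → ∀ n, T1 ≤ n → q n k = q T1 k := by
    intro k hk n hn
    simp only [hq]
    unfold prec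
    rw [sampleCount_eq_of_forall_ne (fun m hm => hT1 m hm k hk) hn]
  have ev2 : ∀ᶠ n in atTop, ∀ u, u ∉ S → ∀ k, k ∈ S → q n u < q n k := by
    rw [eventually_all]
    intro u
    by_cases hu : u ∈ S
    · simp [hu]
    · simp only [hu, not_false_eq_true, forall_true_left]
      rw [eventually_all]
      intro k
      by_cases hk : k ∈ S
      · filter_upwards [(hqtop k hk).eventually_gt_atTop (q T1 u), eventually_ge_atTop T1]
          with n hn hn1 _
        rw [hqconst u hu n hn1]
        exact hn
      · simp [hk]
  have ev3 : ∀ᶠ n in atTop, ∀ k, k ∈ S → 0 < sampleCount a n k c := by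
    rw [eventually_all]
    intro k
    by_cases hk : k ∈ S
    · filter_upwards [hk.eventually_gt_atTop 0] with n hn _ using hn
    · simp [hk]
  -- arms of `S` with different rewards are separated from some time on
  have ev4 : ∀ᶠ n in atTop, ∀ k l, k ∈ S → l ∈ S → F l c < F k c →
      fitMean F v α β W a n l c < fitMean F v α β W a n k c ∧
      B < (fitMean F v α β W a n k c - fitMean F v α β W a n l c) ^ 2
        / ((prec v α a n k c)⁻¹ + (prec v α a n l c)⁻¹) := by
    rw [eventually_all]
    intro k
    rw [eventually_all]
    intro l
    by_cases hkl : k ∈ S ∧ l ∈ S ∧ F l c < F k c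
    · obtain ⟨hk, hl, hF⟩ := hkl
      have hd := (h.tendsto_fitMean hk).sub (h.tendsto_fitMean hl)
      have hgap : 0 < F k c - F l c := sub_pos.2 hF
      have hV : Tendsto (fun n => (prec v α a n k c)⁻¹ + (prec v α a n l c)⁻¹) atTop (𝓝[>] 0) := by
        rw [tendsto_nhdsWithin_iff]
        constructor
        · simpa using (tendsto_inv_atTop_zero.comp (h.tendsto_prec hk)).add
            (tendsto_inv_atTop_zero.comp (h.tendsto_prec hl))
        · filter_upwards [eventually_ge_atTop n0] with n hn
          exact add_pos (inv_pos.2 (h.prec_pos n hn k c)) (inv_pos.2 (h.prec_pos n hn l c))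
      have hz := (hd.pow 2).pos_mul_atTop (pow_pos hgap 2) (tendsto_inv_nhdsGT_zero.comp hV)
      filter_upwards [hd.eventually (lt_mem_nhds hgap), hz.eventually_gt_atTop B]
        with n hn1 hn2 _ _ _
      refine ⟨by linarith, ?_⟩
      rw [div_eq_mul_inv]
      exact hn2
    · refine Eventually.of_forall fun n h1 h2 h3 => absurd ⟨h1, h2, h3⟩ hkl
  obtain ⟨T, hT⟩ := eventually_atTop.1 (ev2.and (ev3.and (ev4.and hB0)))
  set n1 := max (max T T1) (max n0 1) with hn1
  have hn1T : T ≤ n1 := (le_max_left _ _).trans (le_max_left _ _)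
  have hn1T1 : T1 ≤ n1 := (le_max_right _ _).trans (le_max_left _ _)
  have hn1n0 : n0 ≤ n1 := (le_max_left _ _).trans (le_max_right _ _)
  have hn11 : 1 ≤ n1 := (le_max_right _ _).trans (le_max_right _ _)
  -- `q k ≥ κ * s ^ 4` forces `s ^ 2` samples, and `q k ≤ A * κ * s ^ 4` at most `ρ * s ^ 2`
  set κ := ∑ k, (α k c + 1 / (v k c : ℝ)) with hκ
  have hκk : ∀ k, α k c + 1 / (v k c : ℝ) ≤ κ := fun k =>
    Finset.single_le_sum (f := fun k => α k c + 1 / (v k c : ℝ))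
      (fun k _ => add_nonneg (h.prior_nonneg k c) (by positivity)) (Finset.mem_univ k)
  have hκpos : 0 < κ := lt_of_lt_of_le
    (add_pos_of_nonneg_of_pos (h.prior_nonneg kS c) (one_div_pos.2 (h.v_pos' kS c))) (hκk kS)
  set A := ∑ k, 4 * ((Fintype.card K : ℝ) + 1) * 5 ^ rk c k with hA
  have hAk : ∀ k, 4 * ((Fintype.card K : ℝ) + 1) * 5 ^ rk c k ≤ A := fun k =>
    Finset.single_le_sum (f := fun k => 4 * ((Fintype.card K : ℝ) + 1) * 5 ^ rk c k)
      (fun k _ => by positivity) (Finset.mem_univ k)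
  have hApos : 0 ≤ A := Finset.sum_nonneg fun k _ => by positivity
  set vs := ∑ k, (v k c : ℝ) with hvs
  have hvk : ∀ k, (v k c : ℝ) ≤ vs := fun k =>
    Finset.single_le_sum (f := fun k => (v k c : ℝ)) (fun k _ => by positivity) (Finset.mem_univ k)
  have hvs0 : 0 ≤ vs := Finset.sum_nonneg fun k _ => by positivity
  obtain ⟨ρ, hρ⟩ := exists_nat_ge (vs * A * κ + 1)
  have hρ1 : (1 : ℝ) ≤ ρ := by
    have : 0 ≤ vs * A * κ := by positivity
    linarith
  obtain ⟨H, hH0, hHpos, hfreq⟩ := hW c ρ (25 * B * (vs + vs) + 1)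
  have hBnn : 0 ≤ B := le_max_right _ _
  have hHB : 25 * B * (vs + vs) < H ^ 2 := by
    have : 0 ≤ 25 * B * (vs + vs) := by positivity
    nlinarith
  have ev5 : ∀ᶠ s : ℕ in atTop, ∀ k, q n1 k ≤ κ * s ^ 4 := by
    rw [eventually_all]
    intro k
    have : Tendsto (fun s : ℕ => κ * (s : ℝ) ^ 4) atTop atTop :=
      ((tendsto_pow_atTop (by norm_num)).comp tendsto_natCast_atTop_atTop).const_mul_atTop hκpos
    exact this.eventually_ge_atTop _
  obtain ⟨s, hspread, hsQ, hsmean, hs1⟩ := (hfreq.and_eventually (ev5.and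
    ((eventually_all.2 fun k => h.eventually_abs_fitMean_sub_le k c (rk c k) hHpos).and
      (eventually_ge_atTop 1)))).exists
  set Q := κ * (s : ℝ) ^ 4 with hQ
  have hs1' : (1 : ℝ) ≤ s := by exact_mod_cast hs1
  have hs0 : (0 : ℝ) < s := by linarith
  have hwin : ∀ n k, Q ≤ q n k → s ^ 2 ≤ sampleCount a n k c := by
    intro n k hQq
    by_contra hlt
    push Not at hlt
    have h1 : (sampleCount a n k c : ℝ) < (s : ℝ) ^ 2 := by exact_mod_cast hlt
    have hv := h.v_pos' k c
    have hα := h.prior_nonneg k c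
    have h2 : q n k < (s : ℝ) ^ 2 * ((s : ℝ) ^ 2 * κ) := by
      have h3 : prec v α a n k c ≤ (s : ℝ) ^ 2 * κ := by
        calc prec v α a n k c ≤ (s : ℝ) ^ 2 * α k c + (s : ℝ) ^ 2 / v k c := by
              unfold prec
              gcongr
              exact le_mul_of_one_le_left hα (one_le_pow₀ hs1')
          _ = (s : ℝ) ^ 2 * (α k c + 1 / v k c) := by ring
          _ ≤ _ := by gcongr; exact hκk k
      calc q n k ≤ (sampleCount a n k c : ℝ) * ((s : ℝ) ^ 2 * κ) := by
            simp only [hq]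
            gcongr
        _ < _ := by gcongr
    have : (s : ℝ) ^ 2 * ((s : ℝ) ^ 2 * κ) = Q := by rw [hQ]; ring
    linarith
  have hwin' : ∀ n k, q n k ≤ A * Q → sampleCount a n k c ≤ ρ * s ^ 2 := by
    intro n k hqA
    have hv := h.v_pos' k c
    have h1 : (sampleCount a n k c : ℝ) ^ 2 / v k c ≤ A * Q := by
      refine le_trans ?_ hqA
      have := h.div_le_prec n k c
      simp only [hq]
      rw [pow_two, mul_div_assoc]
      gcongr
    rw [div_le_iff₀ hv] at h1
    have h2 : (sampleCount a n k c : ℝ) ^ 2 ≤ ((ρ : ℝ) * s ^ 2) ^ 2 := by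
      calc (sampleCount a n k c : ℝ) ^ 2 ≤ A * Q * vs := by
            refine h1.trans ?_
            have := hvk k
            gcongr
        _ = (vs * A * κ) * (s : ℝ) ^ 4 := by rw [hQ]; ring
        _ ≤ ((ρ : ℝ) * ρ) * (s : ℝ) ^ 4 :=
            mul_le_mul_of_nonneg_right (by nlinarith) (by positivity)
        _ = _ := by ring
    have h3 : (sampleCount a n k c : ℝ) ≤ (ρ : ℝ) * s ^ 2 := le_of_sq_le_sq h2 (by positivity)
    exact_mod_cast h3
  -- separation of the arms inside the window
  have sep : ∀ n, n1 ≤ n → (∀ k, q n k ≤ 4 * (Fintype.card K + 1) * 5 ^ rk c k * Q) →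
      ∀ k l, k ∈ S → l ∈ S → Q ≤ q n k → Q ≤ q n l → rk c l < rk c k →
      fitMean F v α β W a n l c < fitMean F v α β W a n k c ∧
      B < (fitMean F v α β W a n k c - fitMean F v α β W a n l c) ^ 2
        / ((prec v α a n k c)⁻¹ + (prec v α a n l c)⁻¹) := by
    intro n hn hle k l hk hl hqk hql hlt
    have hFle : F l c ≤ F k c := by
      by_contra hF
      exact (hrkF c k l (not_le.1 hF)).not_gt hlt
    rcases hFle.lt_or_eq with hF | hF
    · exact (hT n (hn1T.trans hn)).2.2.1 k l hk hl hF
    · have hcl : ∀ k, Q ≤ q n k →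
          |fitMean F v α β W a n k c - F k c - H * rk c k / s| ≤ 2 / 5 * (H / s) ∧
          (prec v α a n k c)⁻¹ ≤ (v k c : ℝ) / (s : ℝ) ^ 2 := by
        intro k hqk
        have hlow := hwin n k hqk
        refine ⟨hsmean k n hlow (hspread k _ hlow (hwin' n k ((hle k).trans ?_))), ?_⟩
        · have := hAk k
          gcongr
        · rw [← inv_div]
          have hv := h.v_pos' k c
          refine inv_anti₀ (by positivity) (le_trans ?_ (h.div_le_prec n k c))
          gcongr
          exact_mod_cast hlow
      have hn0' := hn1n0.trans hn
      refine lt_zeta_of_spread (f := F k c) (r := rk c k) (r' := rk c l) hs0 hHpos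
        (by exact_mod_cast hlt) (hcl k hqk).1 (hF ▸ (hcl l hql).1)
        (inv_pos.2 (h.prec_pos n hn0' k c)) (inv_pos.2 (h.prec_pos n hn0' l c))
        (hcl k hqk).2 (hcl l hql).2 hBnn (lt_of_le_of_lt ?_ hHB)
      have := hvk k
      have := hvk l
      gcongr
  have hbound := le_of_ranked_growth (hrk c) (q := q) (Q := Q) (by positivity) (n1 := n1) hsQ (by
    intro n hn hle x
    by_cases hx : a n = (x, c)
    swap
    · left
      simp only [hq]
      unfold prec
      rw [sampleCount_succ, if_neg hx, add_zero]
    right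
    have hxS : x ∈ S := by
      by_contra hxS
      exact hT1 n (hn1T1.trans hn) x hxS hx
    obtain ⟨hlt, hpos, -, hzB⟩ := hT n (hn1T.trans hn)
    refine ⟨?_, ?_⟩
    · simp only [hq]
      unfold prec
      rw [sampleCount_succ, if_pos hx]
      exact count_mul_prec_succ_le (hpos x hxS) (h.prior_nonneg x c) (h.v_pos' x c)
    obtain ⟨b, hbmax, k, c', hkb, hmin, hcase1, hcase2⟩ := h.step n (hn1n0.trans hn)
    have hzle := hzB b k c' hmin
    rw [psi_lt_iff (hn11.trans hn)] at hcase1 hcase2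
    have hc' : c' = c := by
      by_cases hψ : (sampleCount a n (b c') c' : ℝ) * prec v α a n (b c') c' <
          ∑ k ∈ Finset.univ.filter (fun k => k ≠ b c'),
            (sampleCount a n k c' : ℝ) * prec v α a n k c'
      · exact (Prod.ext_iff.1 ((hcase1 hψ).symm.trans hx)).2
      · exact (Prod.ext_iff.1 ((hcase2 hψ).symm.trans hx)).2
    subst hc'
    have hsum : ∀ l, l ≠ b c' → q n l ≤ ∑ k ∈ Finset.univ.filter (fun k => k ≠ b c'), q n k :=
      fun l hl => Finset.single_le_sum (f := q n) (fun k _ => hqnonneg n k) (by simpa using hl)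
    have hbS : b c' ∈ S := by
      by_contra hbS
      have hne : kS ≠ b c' := fun e => hbS (e ▸ hkS)
      have h1 := hcase1 ((hlt _ hbS kS hkS).trans_le (hsum kS hne))
      rw [h1] at hx
      have h2 : b c' = x := (Prod.ext_iff.1 hx).1
      exact hbS (h2 ▸ hxS)
    by_cases hψ : q n (b c') < ∑ k ∈ Finset.univ.filter (fun k => k ≠ b c'), q n k
    · have hxb : b c' = x := (Prod.ext_iff.1 ((hcase1 hψ).symm.trans hx)).1
      rw [hxb] at hψ hbS
      by_cases hxQ : q n x ≤ Q
      · exact Or.inl hxQ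
      · refine Or.inr ⟨fun l hl => ?_, hψ.le⟩
        by_cases hlS : l ∈ S
        · by_contra hlQ
          have h1 := (sep n hn hle l x hlS hxS (not_le.1 hlQ).le (not_le.1 hxQ).le hl).1
          have h2 := hbmax c' l
          rw [hxb] at h2
          linarith
        · rw [hqconst l hlS n (hn1T1.trans hn), ← hqconst l hlS n1 hn1T1]
          exact hsQ l
    · have hxk : k = x := (Prod.ext_iff.1 ((hcase2 hψ).symm.trans hx)).1
      subst hxk
      left
      by_contra hxQ
      have h1 : q n k ≤ q n (b c') := (hsum k hkb).trans (not_lt.1 hψ)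
      have hxQ := (not_le.1 hxQ).le
      have h2 : B < zeta (fitMean F v α β W a n) (fun k c => (prec v α a n k c)⁻¹) b k c' := by
        unfold zeta
        rcases lt_or_gt_of_ne (fun e => hkb (hrk c' e)) with hlt' | hlt'
        · exact (sep n hn hle (b c') k hbS hxS (hxQ.trans h1) hxQ hlt').2
        · have h3 := (sep n hn hle k (b c') hxS hbS hxQ (hxQ.trans h1) hlt').2
          rwa [← neg_sq, neg_sub, add_comm] at h3
      exact absurd (hzle.trans (le_max_left B0 0)) (not_le.2 h2))
  obtain ⟨n, hn, hn'⟩ := ((eventually_ge_atTop n1).and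
    ((hqtop kS hkS).eventually_gt_atTop (4 * (Fintype.card K + 1) * 5 ^ rk c kS * Q))).exists
  exact absurd (hbound n hn kS) (not_le.2 hn')

end Consistency

/-! ### Convergence of the allocation along a trajectory -/

section Convergence

variable {K C : Type*} [Fintype K] [DecidableEq K] [Fintype C] [DecidableEq C] {F : K → C → ℝ}
  {v : K → C → ℝ≥0} {α β : K → C → ℝ} {W : K → C → ℕ → ℝ} {n0 : ℕ} {a : ℕ → K × C} {b : C → K}

theorem IsTrajectory.eventually_prec_le (h : IsTrajectory F v α β W n0 a)
    (hN : ∀ k c, Tendsto (fun n => sampleCount a n k c) atTop atTop) {δ : ℝ} (hδ : 0 < δ) :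
    ∀ᶠ n in atTop, ∀ k c,
      prec v α a n k c ≤ (1 + δ) * ((sampleCount a n k c : ℝ) / (v k c : ℝ)) := by
  rw [eventually_all]
  intro k
  rw [eventually_all]
  intro c
  have h1 : Tendsto (fun n => δ * ((sampleCount a n k c : ℝ) / (v k c : ℝ))) atTop atTop :=
    ((tendsto_natCast_atTop_atTop.comp (hN k c)).atTop_div_const (h.v_pos' k c)).const_mul_atTop hδ
  filter_upwards [h1.eventually_ge_atTop (α k c)] with n hn
  unfold prec
  linarith

/-- The posterior gaps have the right sign, and are the true gaps up to a factor. -/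
theorem IsTrajectory.eventually_gap (h : IsTrajectory F v α β W n0 a)
    (hN : ∀ k c, Tendsto (fun n => sampleCount a n k c) atTop atTop)
    (hbest : ∀ c k, k ≠ b c → F k c < F (b c) c) {δ : ℝ} (hδ : 0 < δ) :
    ∀ᶠ n in atTop, ∀ c k, k ≠ b c →
      fitMean F v α β W a n k c < fitMean F v α β W a n (b c) c ∧
      (F (b c) c - F k c) ^ 2 ≤
        (1 + δ) * (fitMean F v α β W a n (b c) c - fitMean F v α β W a n k c) ^ 2 ∧
      (fitMean F v α β W a n (b c) c - fitMean F v α β W a n k c) ^ 2 ≤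
        (1 + δ) * (F (b c) c - F k c) ^ 2 := by
  rw [eventually_all]
  intro c
  rw [eventually_all]
  intro k
  by_cases hk : k = b c
  · simp [hk]
  have hd := (h.tendsto_fitMean (hN (b c) c)).sub (h.tendsto_fitMean (hN k c))
  have hgap : 0 < F (b c) c - F k c := sub_pos.2 (hbest c k hk)
  have hgap2 := pow_pos hgap 2
  filter_upwards [hd.eventually (lt_mem_nhds hgap),
    ((hd.pow 2).const_mul (1 + δ)).eventually (le_mem_nhds
      (show (F (b c) c - F k c) ^ 2 < (1 + δ) * (F (b c) c - F k c) ^ 2 by nlinarith)),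
    (hd.pow 2).eventually (ge_mem_nhds
      (show (F (b c) c - F k c) ^ 2 < (1 + δ) * (F (b c) c - F k c) ^ 2 by nlinarith))]
    with n h1 h2 h3 _
  exact ⟨by linarith, h2, h3⟩

theorem eta_le_eta_of_le {K C : Type*} {v : K → C → ℝ≥0} {F : K → C → ℝ} {b : C → K}
    {p p' : K → C → ℝ} (hp : ∀ k c, 0 < p k c) (hpp : ∀ k c, p k c ≤ p' k c)
    (hv : ∀ k c, 0 < v k c) (k : K) (c : C) : eta F v b p k c ≤ eta F v b p' k c := by
  have h1 : (0 : ℝ) < v (b c) c := by exact_mod_cast hv _ _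
  have h2 : (0 : ℝ) < v k c := by exact_mod_cast hv _ _
  have h3 := hp (b c) c
  have h4 := hp k c
  have h5 := h3.trans_le (hpp (b c) c)
  have h6 := h4.trans_le (hpp k c)
  have := hpp (b c) c
  have := hpp k c
  unfold eta
  gcongr

/-- The criterion `ζ` and the rate `eta` at the sample sizes agree up to factors `1 + δ`. -/
theorem eta_le_zeta_and_zeta_le {d g vb vk Nb Nk pb pk δ : ℝ} (hδ : 0 < δ) (hvb : 0 < vb)
    (hvk : 0 < vk) (hNb : 0 < Nb) (hNk : 0 < Nk) (hpb : Nb / vb ≤ pb) (hpk : Nk / vk ≤ pk)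
    (hpb' : pb ≤ (1 + δ) * (Nb / vb)) (hpk' : pk ≤ (1 + δ) * (Nk / vk))
    (hg : d ^ 2 ≤ (1 + δ) * g ^ 2) (hg' : g ^ 2 ≤ (1 + δ) * d ^ 2) :
    d ^ 2 / (vb / Nb + vk / Nk) ≤ (1 + δ) * (g ^ 2 / (pb⁻¹ + pk⁻¹)) ∧
      g ^ 2 / (pb⁻¹ + pk⁻¹) ≤ (1 + δ) ^ 2 * (d ^ 2 / (vb / Nb + vk / Nk)) := by
  have e : ∀ {V N p : ℝ}, 0 < V → 0 < N → N / V ≤ p → p ≤ (1 + δ) * (N / V) →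
      0 < p⁻¹ ∧ p⁻¹ ≤ V / N ∧ V / N / (1 + δ) ≤ p⁻¹ := by
    intro V N p hV hN h1 h2
    have hp : 0 < p := lt_of_lt_of_le (by positivity) h1
    refine ⟨inv_pos.2 hp, ?_, ?_⟩
    · rw [← inv_div]
      exact inv_anti₀ (by positivity) h1
    · have h3 : V / N / (1 + δ) = ((1 + δ) * (N / V))⁻¹ := by field_simp
      rw [h3]
      exact inv_anti₀ hp h2
  obtain ⟨b1, b2, b3⟩ := e hvb hNb hpb hpb'
  obtain ⟨k1, k2, k3⟩ := e hvk hNk hpk hpk'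
  constructor
  · calc d ^ 2 / (vb / Nb + vk / Nk) ≤ ((1 + δ) * g ^ 2) / (pb⁻¹ + pk⁻¹) := by gcongr
      _ = _ := by ring
  · calc g ^ 2 / (pb⁻¹ + pk⁻¹) ≤ ((1 + δ) * d ^ 2) / (vb / Nb / (1 + δ) + vk / Nk / (1 + δ)) := by
          gcongr
      _ = _ := by field_simp

/-- Once every pair is sampled infinitely often, the allocation converges to the normalized
profiles of the contexts. -/
theorem IsTrajectory.tendsto_allocFrac [Nontrivial K] [Nonempty C]
    (h : IsTrajectory F v α β W n0 a)
    (hN : ∀ k c, Tendsto (fun n => sampleCount a n k c) atTop atTop)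
    (hbest : ∀ c k, k ≠ b c → F k c < F (b c) c) {X : K → C → ℝ}
    (hX : ∀ c, IsProfile (b c) (fun k => (v k c : ℝ)) (fun k => F (b c) c - F k c)
      (fun k => X k c)) (k : K) (c : C) :
    Tendsto (fun n => allocFrac a n k c) atTop (𝓝 (X k c / ∑ k, ∑ c, X k c)) := by
  set N : ℕ → K → C → ℝ := fun n k c => (sampleCount a n k c : ℝ) with hNdef
  set E : ℕ → K → C → ℝ := fun n k c => eta F v b (N n) k c with hEdef
  set m : ℕ → ℝ := fun n => ⨅ x : {x : K × C // x.1 ≠ b x.2}, E n x.1.1 x.1.2 with hm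
  have hmle : ∀ n k c, k ≠ b c → m n ≤ E n k c := fun n k c hk =>
    ciInf_le (f := fun x : {x : K × C // x.1 ≠ b x.2} => E n x.1.1 x.1.2)
      (Set.finite_range _).bddBelow ⟨(k, c), hk⟩
  have hmex : ∀ n, ∃ k c, k ≠ b c ∧ m n = E n k c := by
    intro n
    obtain ⟨x, hx⟩ := exists_eq_ciInf_of_finite
      (f := fun x : {x : K × C // x.1 ≠ b x.2} => E n x.1.1 x.1.2)
    exact ⟨x.1.1, x.1.2, x.2, hx.symm⟩
  have hev : ∀ᶠ n in atTop, ∀ k c, 0 < sampleCount a n k c := by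
    rw [eventually_all]
    intro k
    rw [eventually_all]
    exact fun c => (hN k c).eventually_gt_atTop 0
  obtain ⟨n1, hn1⟩ := eventually_atTop.1 hev
  have hv := h.v_pos'
  have hden : ∀ n, n1 ≤ n → ∀ k c, 0 < (v (b c) c : ℝ) / N n (b c) c + (v k c : ℝ) / N n k c := by
    intro n hn k c
    have h1 : 0 < N n (b c) c := Nat.cast_pos.2 (hn1 n hn (b c) c)
    have h2 : 0 < N n k c := Nat.cast_pos.2 (hn1 n hn k c)
    have := hv (b c) c
    have := hv k c
    positivity
  have hmpos : ∀ n, n1 ≤ n → 0 < m n := by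
    intro n hn
    obtain ⟨k, c, hk, e⟩ := hmex n
    rw [e]
    exact div_pos (pow_pos (sub_pos.2 (hbest c k hk)) 2) (hden n hn k c)
  have hmmono : ∀ i j, n1 ≤ i → i ≤ j → m i ≤ m j := by
    intro i j hi hij
    obtain ⟨k, c, hk, e⟩ := hmex j
    rw [e]
    refine (hmle i k c hk).trans (eta_le_eta_of_le (fun k c => ?_) (fun k c => ?_) h.v_pos k c)
    · exact Nat.cast_pos.2 (hn1 i hi k c)
    · exact Nat.cast_le.2 (sampleCount_mono a k c hij)
  have hq : ∀ n k c, N n k c ^ 2 / v k c ≤ N n k c * prec v α a n k c := by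
    intro n k c
    rw [pow_two, mul_div_assoc]
    exact mul_le_mul_of_nonneg_left (h.div_le_prec n k c) (by simp [hNdef])
  -- the decisions of the policy, in terms of the sample sizes
  have hdec : ∀ δ > 0, ∀ᶠ n in atTop, ∀ k c, a n = (k, c) →
      (k = b c → N n (b c) c ^ 2 / v (b c) c ≤
        (1 + δ) * ∑ k ∈ Finset.univ.filter (fun k => k ≠ b c), N n k c ^ 2 / v k c) ∧
      (k ≠ b c → (∑ l ∈ Finset.univ.filter (fun l => l ≠ b c), N n l c ^ 2 / v l c)
          ≤ (1 + δ) * (N n (b c) c ^ 2 / v (b c) c) ∧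
        (F (b c) c - F k c) ^ 2 ≤
          (1 + δ) * (m n * ((v (b c) c : ℝ) / N n (b c) c + (v k c : ℝ) / N n k c))) := by
    intro δ hδ
    have hcont : Tendsto (fun δ : ℝ => (1 + δ) ^ 3) (𝓝[>] 0) (𝓝 1) := by
      have : Tendsto (fun δ : ℝ => (1 + δ) ^ 3) (𝓝 0) (𝓝 ((1 + 0) ^ 3)) :=
        Continuous.tendsto (by fun_prop) 0
      simpa using this.mono_left nhdsWithin_le_nhds
    obtain ⟨θ, hθ1, hθ⟩ := ((hcont.eventually (gt_mem_nhds (show (1 : ℝ) < 1 + δ by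
      linarith))).and self_mem_nhdsWithin).exists
    have hθ : 0 < θ := hθ
    have hθδ : 1 + θ ≤ 1 + δ := (le_self_pow₀ (by linarith) (by norm_num)).trans hθ1.le
    filter_upwards [h.eventually_prec_le hN hθ, h.eventually_gap hN hbest hθ,
      eventually_ge_atTop (max (max n0 n1) 1)] with n h1 h2 h3 k c hkc
    have hn0 : n0 ≤ n := (le_max_left _ _).trans ((le_max_left _ _).trans h3)
    have hn1' : n1 ≤ n := (le_max_right _ _).trans ((le_max_left _ _).trans h3)
    have hnpos : 0 < n := (le_max_right _ _).trans h3
    have hNpos : ∀ k c, 0 < N n k c := fun k c => Nat.cast_pos.2 (hn1 n hn1' k c)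
    have hq' : ∀ k c, N n k c * prec v α a n k c ≤ (1 + θ) * (N n k c ^ 2 / v k c) := by
      intro k c
      calc N n k c * prec v α a n k c ≤ N n k c * ((1 + θ) * (N n k c / v k c)) :=
            mul_le_mul_of_nonneg_left (h1 k c) (hNpos k c).le
        _ = _ := by ring
    obtain ⟨b', hbmax, k', c', hkb, hmin, hcase1, hcase2⟩ := h.step n hn0
    have hbb : b' = b := by
      funext c
      by_contra hne
      exact absurd (hbmax c (b c)) (not_le.2 (h2 c (b' c) hne).1)
    subst hbb
    rw [psi_lt_iff hnpos] at hcase1 hcase2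
    by_cases hψ : N n (b' c') c' * prec v α a n (b' c') c' <
        ∑ k ∈ Finset.univ.filter (fun k => k ≠ b' c'), N n k c' * prec v α a n k c'
    · have e := (hcase1 hψ).symm.trans hkc
      obtain ⟨rfl, rfl⟩ : b' c' = k ∧ c' = c := Prod.ext_iff.1 e
      refine ⟨fun _ => (hq _ _ _).trans (hψ.le.trans ?_), fun hne => absurd rfl hne⟩
      rw [Finset.mul_sum]
      refine Finset.sum_le_sum fun l _ => (hq' l c').trans ?_
      gcongr
    · have e := (hcase2 hψ).symm.trans hkc
      obtain ⟨rfl, rfl⟩ : k' = k ∧ c' = c := Prod.ext_iff.1 e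
      refine ⟨fun e => absurd e hkb, fun _ => ⟨?_, ?_⟩⟩
      · refine (Finset.sum_le_sum fun l _ => hq n l c').trans ((not_lt.1 hψ).trans
          ((hq' _ _).trans ?_))
        gcongr
      · have hcmp : ∀ k c, k ≠ b' c →
            E n k c ≤ (1 + θ) * zeta (fitMean F v α β W a n) (fun k c => (prec v α a n k c)⁻¹)
              b' k c ∧
            zeta (fitMean F v α β W a n) (fun k c => (prec v α a n k c)⁻¹) b' k c
              ≤ (1 + θ) ^ 2 * E n k c := fun k c hk =>
          eta_le_zeta_and_zeta_le hθ (hv _ _) (hv _ _) (hNpos _ _) (hNpos _ _)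
            (h.div_le_prec n _ _) (h.div_le_prec n _ _) (h1 _ _) (h1 _ _) (h2 c k hk).2.1
            (h2 c k hk).2.2
        obtain ⟨k2, c2, hk2, em⟩ := hmex n
        have h4 : E n k' c' ≤ (1 + δ) * m n := by
          calc E n k' c' ≤ (1 + θ) * ((1 + θ) ^ 2 * E n k2 c2) := by
                refine (hcmp k' c' hkb).1.trans ?_
                gcongr
                exact (hmin k2 c2 hk2).trans (hcmp k2 c2 hk2).2
            _ = (1 + θ) ^ 3 * m n := by rw [em]; ring
            _ ≤ _ := by
                have := hmpos n hn1'
                gcongr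
        have h5 := hden n hn1' k' c'
        rw [← mul_assoc]
        exact (div_le_iff₀ h5).1 h4
  have hratio : ∀ k c, Tendsto (fun n => N n k c / m n) atTop (𝓝 (X k c)) := by
    intro k c
    refine (hX c).tendsto (N := fun n k => sampleCount a n k c) (m := m) (n0 := n1)
      (fun k => hv k c) (fun n k => ?_) (fun k => hN k c) (fun n hn k => hn1 n hn k c) hmpos hmmono
      (fun n hn k hk => ?_) (fun δ hδ => ?_) (fun δ hδ => ?_) k
    · rw [sampleCount_succ]
      split_ifs <;> omega
    · exact (le_div_iff₀ (hden n hn k c)).1 (hmle n k c hk)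
    · filter_upwards [hdec δ hδ] with n hn hne
      have e : a n = (b c, c) := by
        by_contra hcon
        rw [sampleCount_succ, if_neg hcon] at hne
        exact hne rfl
      exact (hn _ _ e).1 rfl
    · filter_upwards [hdec δ hδ] with n hn k hk hne
      have e : a n = (k, c) := by
        by_contra hcon
        rw [sampleCount_succ, if_neg hcon] at hne
        exact hne rfl
      exact (hn _ _ e).2 hk
  have htot : Tendsto (fun n => ∑ k, ∑ c, N n k c / m n) atTop (𝓝 (∑ k, ∑ c, X k c)) :=
    tendsto_finsetSum _ fun k _ => tendsto_finsetSum _ fun c _ => hratio k c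
  have hT := sum_profile_pos hX
  refine ((hratio k c).div htot hT.ne').congr' ?_
  filter_upwards [eventually_ge_atTop n1] with n hn
  have hmn := (hmpos n hn).ne'
  simp only [Pi.div_apply, ← Finset.sum_div]
  rw [div_div_div_cancel_right₀ hmn]
  unfold allocFrac
  congr 1
  simp only [hNdef]
  exact_mod_cast sum_sampleCount a n

end Convergence

/-! ### The posterior under a diagonal prior -/

section Posterior

variable {K C : Type*} [DecidableEq K] [DecidableEq C]

theorem sum_obsTimes_ite (a : ℕ → K × C) (n : ℕ) (k : K) (c : C) (f : ℕ → ℝ) :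
    ∑ i : obsTimes a n k, (if (a i).2 = c then f i else 0)
      = ∑ m ∈ (Finset.range n).filter (fun m => a m = (k, c)), f m := by
  rw [Finset.sum_coe_sort (obsTimes a n k) (fun m => if (a m).2 = c then f m else 0),
    ← Finset.sum_filter, obsTimes, Finset.filter_filter]
  refine Finset.sum_congr (Finset.filter_congr fun m _ => ?_) fun _ _ => rfl
  rw [Prod.ext_iff]

theorem isUnit_gramMatrix {K C : Type*} [DecidableEq K] [Finite C] {S : K → Matrix C C ℝ}
    {v : K → C → ℝ≥0} (hv : ∀ k c, 0 < v k c) (a : ℕ → K × C) (n : ℕ) {k : K} (hS : (S k).PosDef) :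
    IsUnit (gramMatrix S v a n k).det := by
  have h1 : (Matrix.of fun i j : obsTimes a n k => S k (a i).2 (a j).2).PosSemidef :=
    hS.posSemidef.submatrix fun i : obsTimes a n k => (a i).2
  have h2 : (Matrix.diagonal fun i : obsTimes a n k => (v k (a i).2 : ℝ)).PosDef :=
    Matrix.PosDef.diagonal fun i => by exact_mod_cast hv _ _
  exact (Matrix.isUnit_iff_isUnit_det _).1 (Matrix.PosDef.posSemidef_add h1 h2).isUnit

/-- For a diagonal prior, the row vector `Σ₀(c, D_n) A_n⁻¹` is supported on the observations of
`c`, where it is constant. -/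
theorem dotProduct_gramMatrix_inv [Finite C] {S : K → Matrix C C ℝ} {v : K → C → ℝ≥0}
    (hv : ∀ k c, 0 < v k c) (a : ℕ → K × C) (n : ℕ) {k : K} (hS : (S k).PosDef)
    (hdiag : S k = Matrix.diagonal (fun c => S k c c)) (c : C) (f : ℕ → ℝ) :
    (fun i : obsTimes a n k => S k c (a i).2) ⬝ᵥ
      ((gramMatrix S v a n k)⁻¹.mulVec (fun i : obsTimes a n k => f i))
      = S k c c / (S k c c * sampleCount a n k c + v k c) *
        ∑ m ∈ (Finset.range n).filter (fun m => a m = (k, c)), f m := by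
  have hσ : 0 < S k c c := hS.diag_pos
  have hvc : (0 : ℝ) < v k c := by exact_mod_cast hv k c
  have hden : 0 < S k c c * sampleCount a n k c + v k c := by positivity
  set t := S k c c / (S k c c * sampleCount a n k c + v k c) with ht
  have hoff : ∀ d d' : C, S k d d' = if d' = d then S k d d else 0 := by
    intro d d'
    rw [hdiag, Matrix.diagonal_apply, Matrix.diagonal_apply_eq]
    exact if_congr eq_comm rfl rfl
  have hw : (fun i : obsTimes a n k => S k c (a i).2)
      = Matrix.vecMul (fun i : obsTimes a n k => if (a i).2 = c then t else 0)
          (gramMatrix S v a n k) := by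
    funext j
    unfold gramMatrix
    rw [Matrix.vecMul_add, Pi.add_apply, Matrix.vecMul_diagonal]
    have h1 : Matrix.vecMul (fun i : obsTimes a n k => if (a i).2 = c then t else 0)
        (Matrix.of fun i j : obsTimes a n k => S k (a i).2 (a j).2) j
        = (if (a j).2 = c then S k c c else 0) * (sampleCount a n k c * t) := by
      simp only [Matrix.vecMul, dotProduct, Matrix.of_apply, ite_mul, zero_mul]
      have h2 : ∀ i : obsTimes a n k, (if (a i).2 = c then t * S k (a i).2 (a j).2 else 0)
          = if (a i).2 = c then t * (if (a j).2 = c then S k c c else 0) else 0 := by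
        intro i
        by_cases hi : (a i).2 = c
        · rw [if_pos hi, if_pos hi, hi, hoff]
        · rw [if_neg hi, if_neg hi]
      rw [Finset.sum_congr rfl fun i _ => h2 i, sum_obsTimes_ite a n k c
        (fun _ => t * (if (a j).2 = c then S k c c else 0)), Finset.sum_const, nsmul_eq_mul]
      unfold sampleCount
      split_ifs <;> ring
    rw [h1, hoff]
    by_cases hj : (a j).2 = c
    · simp only [hj, if_true]
      rw [ht]
      field_simp
    · simp [hj]
  rw [Matrix.dotProduct_mulVec, hw, Matrix.vecMul_vecMul,
    Matrix.mul_nonsing_inv _ (isUnit_gramMatrix hv a n hS), Matrix.vecMul_one]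
  simp only [dotProduct, ite_mul, zero_mul]
  rw [sum_obsTimes_ite a n k c (fun m => t * f m), Finset.mul_sum]

/-- For either kind of prior, the posterior mean and variance of a pair are those of a Gaussian
model for this pair alone, with prior precision `α` (zero for the uninformative prior). -/
theorem Prior.Independent.exists_precision [Finite C] {prior : Prior K C} {N0 : ℕ}
    {init : ℕ → K × C} (hprior : prior.Independent N0 init) (F : K → C → ℝ) {v : K → C → ℝ≥0}
    (hv : ∀ k c, 0 < v k c) :
    ∃ α β : K → C → ℝ, (∀ k c, 0 ≤ α k c) ∧
      ∀ a : ℕ → K × C, (∀ n < N0, a n = init n) → ∀ n, N0 ≤ n → ∀ k c,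
        0 < prec v α a n k c ∧ prior.postVar v a n k c = (prec v α a n k c)⁻¹ ∧
        ∀ y : ℕ → ℝ, prior.postMean v a y n k c = F k c + (β k c +
          (∑ m ∈ (Finset.range n).filter (fun m => a m = (k, c)), (y m - F k c)) / v k c)
            / prec v α a n k c := by
  have hv' : ∀ k c, (0 : ℝ) < v k c := fun k c => by exact_mod_cast hv k c
  cases prior with
  | gaussian m0 S =>
    have hS : ∀ k c, 0 < S k c c := fun k c => (hprior k).1.diag_pos
    refine ⟨fun k c => 1 / S k c c, fun k c => (m0 k c - F k c) / S k c c,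
      fun k c => (one_div_pos.2 (hS k c)).le, fun a _ n _ k c => ?_⟩
    have h1 := hS k c
    have h2 := hv' k c
    have hp : 0 < prec v (fun k c => 1 / S k c c) a n k c := by
      unfold prec
      positivity
    refine ⟨hp, ?_, fun y => ?_⟩
    · simp only [Prior.postVar, gpCov]
      have h3 : ∀ i : obsTimes a n k, S k (a i).2 c = if (a i).2 = c then S k c c else 0 := by
        intro i
        rw [(hprior k).2, Matrix.diagonal_apply, Matrix.diagonal_apply_eq]
        split_ifs with h
        · rw [h]
        · rfl
      simp only [h3]
      rw [dotProduct_gramMatrix_inv hv a n (hprior k).1 (hprior k).2 c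
        (fun m => if (a m).2 = c then S k c c else 0)]
      have h4 : ∑ m ∈ (Finset.range n).filter (fun m => a m = (k, c)),
          (if (a m).2 = c then S k c c else 0) = sampleCount a n k c * S k c c := by
        rw [Finset.sum_congr rfl fun m hm => if_pos (by
          rw [(Finset.mem_filter.1 hm).2])]
        rw [Finset.sum_const, nsmul_eq_mul]
        rfl
      rw [h4]
      unfold prec
      field_simp
      ring
    · simp only [Prior.postMean, gpMean]
      rw [dotProduct_gramMatrix_inv hv a n (hprior k).1 (hprior k).2 c
        (fun m => y m - m0 k (a m).2)]
      have h4 : ∀ g : ℕ → ℝ, (∀ m, a m = (k, c) → g m = m0 k c) →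
          ∑ m ∈ (Finset.range n).filter (fun m => a m = (k, c)), (y m - g m)
            = ∑ m ∈ (Finset.range n).filter (fun m => a m = (k, c)), (y m - F k c)
              + sampleCount a n k c * (F k c - m0 k c) := by
        intro g hg
        have h5 : (sampleCount a n k c : ℝ) * (F k c - m0 k c)
            = ∑ m ∈ (Finset.range n).filter (fun m => a m = (k, c)), (F k c - m0 k c) := by
          rw [Finset.sum_const, nsmul_eq_mul]
          rfl
        rw [h5, ← Finset.sum_add_distrib]
        refine Finset.sum_congr rfl fun m hm => ?_
        rw [hg m (Finset.mem_filter.1 hm).2]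
        ring
      rw [h4 (fun m => m0 k (a m).2) fun m hm => by rw [hm]]
      unfold prec
      field_simp
      ring
  | uninformative =>
    refine ⟨0, 0, fun k c => le_rfl, fun a ha n hn k c => ?_⟩
    obtain ⟨m, hm, hmx⟩ := hprior k c
    have hpos : 0 < sampleCount a n k c :=
      Finset.card_pos.2 ⟨m, Finset.mem_filter.2 ⟨Finset.mem_range.2 (hm.trans_le hn),
        (ha m hm).trans hmx⟩⟩
    have h1 : (0 : ℝ) < sampleCount a n k c := by exact_mod_cast hpos
    have h2 := hv' k c
    have e : prec v (0 : K → C → ℝ) a n k c = sampleCount a n k c / v k c := by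
      unfold prec
      simp
    rw [e]
    refine ⟨by positivity, ?_, fun y => ?_⟩
    · simp only [Prior.postVar, inv_div]
    · simp only [Prior.postMean, sampleMean, Pi.zero_apply, zero_add]
      have h3 : ∑ m ∈ (Finset.range n).filter (fun m => a m = (k, c)), (y m - F k c)
          = ∑ m ∈ (Finset.range n).filter (fun m => a m = (k, c)), y m
            - sampleCount a n k c * F k c := by
        rw [Finset.sum_sub_distrib, Finset.sum_const, nsmul_eq_mul]
        rfl
      rw [h3]
      field_simp
      ring

end Posterior

/-! ### Adaptive sampling of independent noise -/

section Stack

variable {X : Type*} [DecidableEq X]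

/-- The number of times before `n` at which the sequence `a` takes the value `x`. -/
def visits (a : ℕ → X) (n : ℕ) (x : X) : ℕ :=
  ((Finset.range n).filter (fun m => a m = x)).card

theorem visits_succ (a : ℕ → X) (n : ℕ) (x : X) :
    visits a (n + 1) x = visits a n x + if a n = x then 1 else 0 := by
  unfold visits
  rw [Finset.range_add_one, Finset.filter_insert]
  split_ifs with h
  · rw [Finset.card_insert_of_notMem (by simp)]
  · rfl

theorem visits_mono (a : ℕ → X) (x : X) : Monotone fun n => visits a n x :=
  monotone_nat_of_le_succ fun n => by rw [visits_succ]; exact Nat.le_add_right _ _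

theorem visits_le (a : ℕ → X) (n : ℕ) (x : X) : visits a n x ≤ n :=
  (Finset.card_filter_le _ _).trans_eq (Finset.card_range n)

/-- The values `e 0, …, e (n - 1)` sorted into one stack for each `x`: the entry `(x, j)` is the
value at the visit number `j` to `x`, or that of `u` if there are not so many visits. -/
def stack (a : ℕ → X) (e : ℕ → ℝ) (u : X × ℕ → ℝ) : ℕ → X × ℕ → ℝ
  | 0 => u
  | n + 1 => Function.update (stack a e u n) (a n, visits a n (a n)) (e n)

theorem stack_succ (a : ℕ → X) (e : ℕ → ℝ) (u : X × ℕ → ℝ) (n : ℕ) (i : X × ℕ) :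
    stack a e u (n + 1) i
      = if a n = i.1 ∧ visits a n i.1 = i.2 then e n else stack a e u n i := by
  have h : i = (a n, visits a n (a n)) ↔ a n = i.1 ∧ visits a n i.1 = i.2 := by
    rw [Prod.ext_iff]
    constructor
    · rintro ⟨h1, h2⟩
      exact ⟨h1.symm, by rw [h1]; exact h2.symm⟩
    · rintro ⟨h1, h2⟩
      exact ⟨h1.symm, by rw [h1]; exact h2.symm⟩
  simp only [stack, Function.update_apply]
  exact if_congr h rfl rfl

theorem stack_of_visits_le {a : ℕ → X} {e : ℕ → ℝ} {u : X × ℕ → ℝ} {n : ℕ} {i : X × ℕ}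
    (h : visits a n i.1 ≤ i.2) : stack a e u n i = u i := by
  induction n with
  | zero => rfl
  | succ n ih =>
    rw [visits_succ] at h
    rw [stack_succ, if_neg, ih (by omega)]
    rintro ⟨h1, h2⟩
    rw [if_pos h1] at h
    omega

theorem stack_eq_of_lt_visits {a : ℕ → X} {e : ℕ → ℝ} {u : X × ℕ → ℝ} {n n' : ℕ} {i : X × ℕ}
    (h : i.2 < visits a n i.1) (hn : n ≤ n') : stack a e u n' i = stack a e u n i := by
  induction n', hn using Nat.le_induction with
  | base => rfl
  | succ m hm ih =>
    rw [stack_succ, if_neg, ih]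
    rintro ⟨-, h2⟩
    have := visits_mono a i.1 hm
    simp only at this
    omega

theorem stack_congr_of_lt_visits {a : ℕ → X} {e : ℕ → ℝ} (u u' : X × ℕ → ℝ) {n : ℕ} {i : X × ℕ}
    (h : i.2 < visits a n i.1) : stack a e u n i = stack a e u' n i := by
  induction n with
  | zero => simp [visits] at h
  | succ n ih =>
    rw [stack_succ, stack_succ]
    split_ifs with hc
    · rfl
    · refine ih ?_
      rw [visits_succ] at h
      split_ifs at h with h1
      · have : visits a n i.1 ≠ i.2 := fun h2 => hc ⟨h1, h2⟩
        omega
      · exact h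

theorem sum_stack (a : ℕ → X) (e : ℕ → ℝ) (u : X × ℕ → ℝ) (n : ℕ) (x : X) :
    ∑ j ∈ Finset.range (visits a n x), stack a e u n (x, j)
      = ∑ m ∈ (Finset.range n).filter (fun m => a m = x), e m := by
  induction n with
  | zero => simp [visits]
  | succ n ih =>
    rw [Finset.range_add_one (n := n), Finset.filter_insert, visits_succ]
    have h1 : ∀ j ∈ Finset.range (visits a n x),
        stack a e u (n + 1) (x, j) = stack a e u n (x, j) := fun j hj =>
      stack_eq_of_lt_visits (i := (x, j)) (Finset.mem_range.1 hj) (Nat.le_succ n)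
    split_ifs with h
    · rw [Finset.sum_range_succ, Finset.sum_congr rfl h1, ih, Finset.sum_insert (by simp),
        stack_succ, if_pos ⟨h, rfl⟩, add_comm]
    · rw [add_zero, Finset.sum_congr rfl h1, ih]

open Classical in
/-- The stacks formed by the whole sequence. -/
noncomputable def stackLim (a : ℕ → X) (e : ℕ → ℝ) (u : X × ℕ → ℝ) (i : X × ℕ) : ℝ :=
  if h : ∃ n, i.2 < visits a n i.1 then stack a e u (Nat.find h) i else u i

theorem stackLim_eq_of_lt_visits {a : ℕ → X} {e : ℕ → ℝ} {u : X × ℕ → ℝ} {n : ℕ} {i : X × ℕ}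
    (h : i.2 < visits a n i.1) : stackLim a e u i = stack a e u n i := by
  classical
  have hex : ∃ n, i.2 < visits a n i.1 := ⟨n, h⟩
  unfold stackLim
  rw [dif_pos hex]
  exact (stack_eq_of_lt_visits (Nat.find_spec hex) (Nat.find_min' hex h)).symm

theorem stackLim_eq_of_forall_visits_le {a : ℕ → X} {e : ℕ → ℝ} {u : X × ℕ → ℝ} {i : X × ℕ}
    (h : ∀ n, visits a n i.1 ≤ i.2) : stackLim a e u i = u i := by
  unfold stackLim
  rw [dif_neg]
  rintro ⟨n, hn⟩
  exact absurd (h n) (not_le.2 hn)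

theorem eventually_stack_eq_stackLim (a : ℕ → X) (e : ℕ → ℝ) (u : X × ℕ → ℝ) (i : X × ℕ) :
    ∀ᶠ n in atTop, stack a e u n i = stackLim a e u i := by
  by_cases h : ∃ n, i.2 < visits a n i.1
  · obtain ⟨n, hn⟩ := h
    filter_upwards [eventually_ge_atTop n] with m hm
    rw [stackLim_eq_of_lt_visits hn, stack_eq_of_lt_visits hn hm]
  · push Not at h
    exact Eventually.of_forall fun n => by
      rw [stackLim_eq_of_forall_visits_le h, stack_of_visits_le (h n)]

theorem sum_stackLim (a : ℕ → X) (e : ℕ → ℝ) (u : X × ℕ → ℝ) (n : ℕ) (x : X) :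
    ∑ j ∈ Finset.range (visits a n x), stackLim a e u (x, j)
      = ∑ m ∈ (Finset.range n).filter (fun m => a m = x), e m := by
  rw [← sum_stack a e u]
  exact Finset.sum_congr rfl fun j hj =>
    stackLim_eq_of_lt_visits (i := (x, j)) (Finset.mem_range.1 hj)

end Stack

section Measurability

variable {X Ω : Type*} [DecidableEq X] [MeasurableSpace Ω] {A : ℕ → Ω → X} {ε : ℕ → X → Ω → ℝ}

theorem measurable_visits {T : ℕ} (hA : ∀ n < T, ∀ x, MeasurableSet {ω | A n ω = x}) {n : ℕ}
    (hn : n ≤ T) (x : X) : Measurable fun ω => visits (fun m => A m ω) n x := by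
  induction n with
  | zero => simp [visits]
  | succ n ih =>
    simp only [visits_succ]
    exact (ih (by omega)).add (Measurable.ite (hA n hn x) measurable_const measurable_const)

theorem measurable_stack {T : ℕ} (hA : ∀ n < T, ∀ x, MeasurableSet {ω | A n ω = x})
    (hε : ∀ n < T, ∀ x, Measurable (ε n x)) {U : Ω → X × ℕ → ℝ}
    (hU : ∀ i, Measurable fun ω => U ω i)
    {n : ℕ} (hn : n ≤ T) (i : X × ℕ) :
    Measurable fun ω => stack (fun m => A m ω) (fun m => ε m (A m ω) ω) (U ω) n i := by
  induction n with
  | zero => exact hU i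
  | succ n ih =>
    have h : ∀ ω, stack (fun m => A m ω) (fun m => ε m (A m ω) ω) (U ω) (n + 1) i
        = if A n ω = i.1 ∧ visits (fun m => A m ω) n i.1 = i.2 then ε n i.1 ω
          else stack (fun m => A m ω) (fun m => ε m (A m ω) ω) (U ω) n i := by
      intro ω
      rw [stack_succ]
      split_ifs with hc
      · rw [hc.1]
      · rfl
    simp only [h]
    refine Measurable.ite ?_ (hε n hn i.1) (ih (by omega))
    exact (hA n hn i.1).inter (measurable_visits hA (by omega) i.1 (measurableSet_singleton i.2))

end Measurability

section Law

variable {X Ω : Type*}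

/-- The σ-algebra generated by the noise variables before time `n`. -/
@[reducible] def noiseHistory (ε : ℕ → X → Ω → ℝ) (n : ℕ) : MeasurableSpace Ω :=
  ⨆ i ∈ {i : ℕ × X | i.1 < n}, MeasurableSpace.comap (ε i.1 i.2) inferInstance

theorem noiseHistory_le [MeasurableSpace Ω] {ε : ℕ → X → Ω → ℝ}
    (hε : ∀ n x, Measurable (ε n x)) (n : ℕ) :
    noiseHistory ε n ≤ ‹MeasurableSpace Ω› :=
  iSup₂_le fun i _ => (hε i.1 i.2).comap_le

theorem noiseHistory_mono (ε : ℕ → X → Ω → ℝ) : Monotone (noiseHistory ε) := fun _ _ hij =>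
  biSup_mono fun _ hi => lt_of_lt_of_le hi hij

theorem measurable_noiseHistory (ε : ℕ → X → Ω → ℝ) {m n : ℕ} (hmn : m < n) (x : X) :
    Measurable[noiseHistory ε n] (ε m x) :=
  (comap_measurable (ε m x)).mono
    (le_iSup₂_of_le (f := fun (i : ℕ × X) (_ : i ∈ {i : ℕ × X | i.1 < n}) =>
      MeasurableSpace.comap (ε i.1 i.2) inferInstance) (m, x) hmn le_rfl) le_rfl

theorem indep_noiseHistory [MeasurableSpace Ω] {P : Measure Ω} {ε : ℕ → X → Ω → ℝ}
    (hε : ∀ n x, Measurable (ε n x))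
    (hindep : iIndepFun (fun i : ℕ × X => ε i.1 i.2) P) (n : ℕ) (x : X) :
    Indep (noiseHistory ε n) (MeasurableSpace.comap (ε n x) inferInstance) P := by
  have h1 := indep_iSup_of_disjoint (S := {i : ℕ × X | i.1 < n}) (T := {(n, x)})
    (fun i : ℕ × X => (hε i.1 i.2).comap_le) ((iIndepFun_iff_iIndep _ _ _).1 hindep)
    (Set.disjoint_singleton_right.2 (lt_irrefl n))
  simp only [Set.mem_singleton_iff, iSup_iSup_eq_left] at h1
  exact h1

variable [DecidableEq X] {A : ℕ → Ω → X} {ε : ℕ → X → Ω → ℝ} {ν : X → Measure ℝ}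

open Classical in
/-- The conditional probability, given the first `n` observations, that the entry `i` of the
completed stacks lies in `B i`. -/
noncomputable def entryProb (A : ℕ → Ω → X) (ε : ℕ → X → Ω → ℝ) (ν : X → Measure ℝ)
    (B : X × ℕ → Set ℝ) (n : ℕ) (i : X × ℕ) (ω : Ω) : ENNReal :=
  if i.2 < visits (fun m => A m ω) n i.1 then
    (if stack (fun m => A m ω) (fun m => ε m (A m ω) ω) 0 n i ∈ B i then 1 else 0)
  else ν i.1 (B i)

theorem entryProb_succ (B : X × ℕ → Set ℝ) (n : ℕ) (i : X × ℕ) (ω : Ω) :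
    entryProb A ε ν B (n + 1) i ω
      = if A n ω = i.1 ∧ visits (fun m => A m ω) n i.1 = i.2 then
          (B i).indicator 1 (ε n i.1 ω)
        else entryProb A ε ν B n i ω := by
  classical
  unfold entryProb
  rw [stack_succ, visits_succ]
  split_ifs with h1 h2 h3 h4 h5 h6 <;> simp_all <;> omega

theorem entryProb_of_visits_le (B : X × ℕ → Set ℝ) {n : ℕ} {i : X × ℕ} {ω : Ω}
    (h : visits (fun m => A m ω) n i.1 ≤ i.2) :
    entryProb A ε ν B n i ω = ν i.1 (B i) := by
  unfold entryProb
  rw [if_neg (not_lt.2 h)]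

theorem measurable_entryProb [MeasurableSpace Ω] {T : ℕ}
    (hA : ∀ n < T, ∀ x, MeasurableSet {ω | A n ω = x})
    (hε : ∀ n < T, ∀ x, Measurable (ε n x)) {B : X × ℕ → Set ℝ} (hB : ∀ i, MeasurableSet (B i))
    (i : X × ℕ) : Measurable (entryProb A ε ν B T i) := by
  classical
  unfold entryProb
  refine Measurable.ite ?_ (Measurable.ite ?_ measurable_const measurable_const) measurable_const
  · exact measurable_visits hA le_rfl i.1 (measurableSet_Ioi (a := i.2))
  · exact measurable_stack hA hε (U := fun _ => 0) (fun _ => measurable_const) le_rfl i (hB i)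

variable [MeasurableSpace Ω] {P : Measure Ω} [Finite X] [IsProbabilityMeasure P]

/-- The product of the entry probabilities is a martingale: the next observation fills one vacant
entry with a noise variable that is independent of the past, including the choice of the entry. -/
theorem lintegral_prod_entryProb (hA : ∀ n x, MeasurableSet[noiseHistory ε n] {ω | A n ω = x})
    (hε : ∀ n x, Measurable (ε n x)) (hlaw : ∀ n x, P.map (ε n x) = ν x)
    (hindep : iIndepFun (fun i : ℕ × X => ε i.1 i.2) P) {B : X × ℕ → Set ℝ}
    (hB : ∀ i, MeasurableSet (B i)) (s : Finset (X × ℕ)) (T : ℕ) :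
    ∫⁻ ω, ∏ i ∈ s, entryProb A ε ν B T i ω ∂P = ∏ i ∈ s, ν i.1 (B i) := by
  classical
  cases nonempty_fintype X
  induction T with
  | zero =>
    have h : ∀ ω, ∏ i ∈ s, entryProb A ε ν B 0 i ω = ∏ i ∈ s, ν i.1 (B i) := fun ω =>
      Finset.prod_congr rfl fun i _ => entryProb_of_visits_le B (by simp [visits])
    simp [h]
  | succ T ih =>
    rw [← ih]
    have hA' : ∀ n x, MeasurableSet {ω | A n ω = x} := fun n x => noiseHistory_le hε n _ (hA n x)
    set D : X × ℕ → Set Ω := fun p => {ω | A T ω = p.1 ∧ visits (fun m => A m ω) T p.1 = p.2}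
      with hD
    have hDm : ∀ p, MeasurableSet[noiseHistory ε T] (D p) := fun p =>
      MeasurableSet.inter (hA T p.1) (@measurable_visits X Ω _ (noiseHistory ε T) A T
        (fun n hn x => noiseHistory_mono ε hn.le _ (hA n x)) T le_rfl p.1 _
        (measurableSet_singleton p.2))
    have hgm : ∀ n i, Measurable[noiseHistory ε n] (entryProb A ε ν B n i) := fun n i =>
      @measurable_entryProb X Ω _ A ε ν (noiseHistory ε n) n
        (fun m hm x => noiseHistory_mono ε hm.le _ (hA m x))
        (fun m hm x => measurable_noiseHistory ε hm x) B hB i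
    have hpart : ∀ f : Ω → ENNReal, Measurable f →
        ∫⁻ ω, f ω ∂P = ∑ p ∈ Finset.univ ×ˢ Finset.range (T + 1), ∫⁻ ω, (D p).indicator f ω ∂P := by
      intro f hf
      rw [← lintegral_finsetSum _ fun p _ => hf.indicator (noiseHistory_le hε T _ (hDm p))]
      refine lintegral_congr fun ω => ?_
      rw [Finset.sum_eq_single (A T ω, visits (fun m => A m ω) T (A T ω))]
      · rw [Set.indicator_of_mem]
        exact ⟨rfl, rfl⟩
      · intro p _ hp
        refine Set.indicator_of_notMem (fun hω => hp ?_) _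
        exact Prod.ext hω.1.symm (by rw [hω.1]; exact hω.2.symm)
      · intro hp
        refine absurd ?_ hp
        simp only [Finset.mem_product, Finset.mem_univ, true_and, Finset.mem_range]
        exact Nat.lt_succ_of_le (visits_le _ _ _)
    have hfm : ∀ n, Measurable fun ω => ∏ i ∈ s, entryProb A ε ν B n i ω := fun n =>
      Finset.measurable_fun_prod s fun i _ => (hgm n i).mono (noiseHistory_le hε n) le_rfl
    rw [hpart _ (hfm (T + 1)), hpart _ (hfm T)]
    refine Finset.sum_congr rfl fun p _ => ?_
    have hne : ∀ ω ∈ D p, ∀ i, i ≠ p → entryProb A ε ν B (T + 1) i ω = entryProb A ε ν B T i ω := by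
      intro ω hω i hip
      rw [entryProb_succ, if_neg]
      rintro ⟨h1, h2⟩
      have h3 : i.1 = p.1 := h1.symm.trans hω.1
      exact hip (Prod.ext h3 (h2.symm.trans (by rw [h3]; exact hω.2)))
    by_cases hp : p ∈ s
    · set R : Ω → ENNReal := (D p).indicator fun ω => ∏ i ∈ s.erase p, entryProb A ε ν B T i ω
        with hR
      have hRm : Measurable[noiseHistory ε T] R :=
        Measurable.indicator (Finset.measurable_fun_prod _ fun i _ => hgm T i) (hDm p)
      have e1 : ∀ ω, (D p).indicator (fun ω => ∏ i ∈ s, entryProb A ε ν B (T + 1) i ω) ω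
          = R ω * (B p).indicator 1 (ε T p.1 ω) := by
        intro ω
        by_cases hω : ω ∈ D p
        · rw [hR, Set.indicator_of_mem hω, Set.indicator_of_mem hω, ← Finset.mul_prod_erase _ _ hp,
            mul_comm, entryProb_succ, if_pos (show A T ω = p.1 ∧ _ from hω)]
          congr 1
          exact Finset.prod_congr rfl fun i hi => hne ω hω i (Finset.ne_of_mem_erase hi)
        · rw [hR, Set.indicator_of_notMem hω, Set.indicator_of_notMem hω, zero_mul]
      have e2 : ∀ ω, (D p).indicator (fun ω => ∏ i ∈ s, entryProb A ε ν B T i ω) ω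
          = R ω * ν p.1 (B p) := by
        intro ω
        by_cases hω : ω ∈ D p
        · rw [hR, Set.indicator_of_mem hω, Set.indicator_of_mem hω, ← Finset.mul_prod_erase _ _ hp,
            mul_comm, entryProb_of_visits_le B hω.2.le]
        · rw [hR, Set.indicator_of_notMem hω, Set.indicator_of_notMem hω, zero_mul]
      simp only [e1, e2]
      have hind : Measurable ((B p).indicator (1 : ℝ → ENNReal)) :=
        measurable_one.indicator (hB p)
      rw [lintegral_mul_eq_lintegral_mul_lintegral_of_independent_measurableSpace
        (g := fun ω => (B p).indicator 1 (ε T p.1 ω)) (noiseHistory_le hε T)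
        (hε T p.1).comap_le (indep_noiseHistory hε hindep T p.1) hRm
        (hind.comp (comap_measurable _)),
        lintegral_mul_const _ (hRm.mono (noiseHistory_le hε T) le_rfl)]
      congr 1
      rw [← lintegral_map hind (hε T p.1), hlaw, lintegral_indicator_one (hB p)]
    · refine lintegral_congr fun ω => ?_
      by_cases hω : ω ∈ D p
      · rw [Set.indicator_of_mem hω, Set.indicator_of_mem hω]
        exact Finset.prod_congr rfl fun i hi => hne ω hω i fun e => hp (e ▸ hi)
      · rw [Set.indicator_of_notMem hω, Set.indicator_of_notMem hω]

variable [∀ x, IsProbabilityMeasure (ν x)]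

/-- Completed by independent variables of the right laws, the stacks of adaptively sampled noise
form an array of independent variables. -/
theorem map_stackLim (hA : ∀ n x, MeasurableSet[noiseHistory ε n] {ω | A n ω = x})
    (hε : ∀ n x, Measurable (ε n x)) (hlaw : ∀ n x, P.map (ε n x) = ν x)
    (hindep : iIndepFun (fun i : ℕ × X => ε i.1 i.2) P) :
    Measurable (fun z : Ω × (X × ℕ → ℝ) =>
      stackLim (fun m => A m z.1) (fun m => ε m (A m z.1) z.1) z.2) ∧
    (P.prod (Measure.infinitePi fun i : X × ℕ => ν i.1)).map
      (fun z => stackLim (fun m => A m z.1) (fun m => ε m (A m z.1) z.1) z.2)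
      = Measure.infinitePi fun i : X × ℕ => ν i.1 := by
  classical
  have hA' : ∀ n x, MeasurableSet {ω | A n ω = x} := fun n x => noiseHistory_le hε n _ (hA n x)
  have hm : Measurable (fun z : Ω × (X × ℕ → ℝ) =>
      stackLim (fun m => A m z.1) (fun m => ε m (A m z.1) z.1) z.2) := by
    refine measurable_pi_lambda _ fun i => ?_
    refine measurable_of_tendsto_metrizable (f := fun n (z : Ω × (X × ℕ → ℝ)) =>
      stack (fun m => A m z.1) (fun m => ε m (A m z.1) z.1) z.2 n i) (fun n => ?_) ?_
    · exact measurable_stack (T := n) (A := fun n (z : Ω × (X × ℕ → ℝ)) => A n z.1)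
        (ε := fun n x (z : Ω × (X × ℕ → ℝ)) => ε n x z.1) (U := fun z => z.2)
        (fun n _ x => measurable_fst (hA' n x)) (fun n _ x => (hε n x).comp measurable_fst)
        (fun i => (measurable_pi_apply i).comp measurable_snd) le_rfl i
    · rw [tendsto_pi_nhds]
      intro z
      exact tendsto_const_nhds.congr'
        ((eventually_stack_eq_stackLim _ _ _ i).mono fun n hn => hn.symm)
  refine ⟨hm, Measure.eq_infinitePi _ fun s B hB => ?_⟩
  have hpi : MeasurableSet (Set.pi s B) :=
    MeasurableSet.pi s.countable_toSet fun i _ => hB i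
  rw [Measure.map_apply hm hpi, Measure.prod_apply (hm hpi)]
  -- the conditional probability given `ω`, as the limit of the martingale
  have hinner : ∀ ω, ∀ᶠ n in atTop, ∏ i ∈ s, entryProb A ε ν B n i ω
      = (Measure.infinitePi fun i : X × ℕ => ν i.1) (Prod.mk ω ⁻¹' ((fun z : Ω × (X × ℕ → ℝ) =>
        stackLim (fun m => A m z.1) (fun m => ε m (A m z.1) z.1) z.2) ⁻¹' Set.pi s B)) := by
    intro ω
    set a : ℕ → X := fun m => A m ω with ha
    set e : ℕ → ℝ := fun m => ε m (A m ω) ω with he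
    set t : X × ℕ → Set ℝ := fun i =>
      if ∃ n, i.2 < visits a n i.1 then (if stackLim a e 0 i ∈ B i then Set.univ else ∅) else B i
      with ht
    have hset : (Prod.mk ω ⁻¹' ((fun z : Ω × (X × ℕ → ℝ) =>
        stackLim (fun m => A m z.1) (fun m => ε m (A m z.1) z.1) z.2) ⁻¹' Set.pi s B))
        = Set.pi s t := by
      ext u
      simp only [Set.mem_preimage, Set.mem_pi, SetLike.mem_coe]
      refine forall₂_congr fun i _ => ?_
      simp only [ht]
      split_ifs with h1 h2
      · obtain ⟨n, hn⟩ := h1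
        rw [stackLim_eq_of_lt_visits hn] at h2
        rw [stackLim_eq_of_lt_visits hn, stack_congr_of_lt_visits _ 0 hn]
        simpa using h2
      · obtain ⟨n, hn⟩ := h1
        rw [stackLim_eq_of_lt_visits hn] at h2
        rw [stackLim_eq_of_lt_visits hn, stack_congr_of_lt_visits _ 0 hn]
        simpa using h2
      · push Not at h1
        rw [stackLim_eq_of_forall_visits_le h1]
    have htm : ∀ i, MeasurableSet (t i) := by
      intro i
      simp only [ht]
      split_ifs
      · exact MeasurableSet.univ
      · exact MeasurableSet.empty
      · exact hB i
    rw [hset, Measure.infinitePi_pi _ fun i _ => htm i]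
    have hone : ∀ i, ∀ᶠ n in atTop, entryProb A ε ν B n i ω = ν i.1 (t i) := by
      intro i
      by_cases h1 : ∃ n, i.2 < visits a n i.1
      · obtain ⟨n, hn⟩ := h1
        filter_upwards [eventually_ge_atTop n] with m hm'
        have hmv : i.2 < visits a m i.1 := hn.trans_le (visits_mono a i.1 hm')
        have hti : t i = if stackLim a e 0 i ∈ B i then Set.univ else ∅ := if_pos ⟨n, hn⟩
        unfold entryProb
        rw [if_pos hmv, ← stackLim_eq_of_lt_visits hmv, hti]
        by_cases h2 : stackLim a e 0 i ∈ B i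
        · rw [if_pos h2, if_pos h2, measure_univ]
        · rw [if_neg h2, if_neg h2, measure_empty]
      · simp only [ht]
        rw [if_neg h1]
        push Not at h1
        exact Eventually.of_forall fun n => entryProb_of_visits_le B (h1 n)
    filter_upwards [(eventually_all_finset s).2 fun i _ => hone i] with n hn
    exact Finset.prod_congr rfl hn
  have hlim := tendsto_lintegral_of_dominated_convergence (μ := P) (fun _ => (1 : ENNReal))
    (F := fun n ω => ∏ i ∈ s, entryProb A ε ν B n i ω)
    (fun n => Finset.measurable_fun_prod s fun i _ =>
      measurable_entryProb (fun m _ x => hA' m x) (fun m _ x => hε m x) hB i)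
    (fun n => Eventually.of_forall fun ω => Finset.prod_le_one' fun i _ => by
      unfold entryProb
      split_ifs
      · exact le_rfl
      · exact zero_le_one
      · exact prob_le_one)
    (by simp) (Eventually.of_forall fun ω =>
      tendsto_const_nhds.congr' ((hinner ω).mono fun n hn => hn.symm))
  simp only [lintegral_prod_entryProb hA hε hlaw hindep hB s] at hlim
  exact tendsto_nhds_unique hlim tendsto_const_nhds

/-- On almost every sample path the noise met along the samples of each `x` is the initial part of
a sequence that has every property which is almost sure for independent sampling. -/
theorem ae_exists_stack (hA : ∀ n x, MeasurableSet[noiseHistory ε n] {ω | A n ω = x})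
    (hε : ∀ n x, Measurable (ε n x)) (hlaw : ∀ n x, P.map (ε n x) = ν x)
    (hindep : iIndepFun (fun i : ℕ × X => ε i.1 i.2) P) {p : (X × ℕ → ℝ) → Prop}
    (hp : ∀ᵐ w ∂Measure.infinitePi fun i : X × ℕ => ν i.1, p w) :
    ∀ᵐ ω ∂P, ∃ w, p w ∧ ∀ n x, ∑ j ∈ Finset.range (visits (fun m => A m ω) n x), w (x, j)
      = ∑ m ∈ (Finset.range n).filter (fun m => A m ω = x), ε m x ω := by
  obtain ⟨hm, hmap⟩ := map_stackLim hA hε hlaw hindep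
  rw [← hmap] at hp
  have h1 := Measure.ae_ae_of_ae_prod (ae_of_ae_map hm.aemeasurable hp)
  filter_upwards [h1] with ω hω
  obtain ⟨u, hu⟩ := hω.exists
  refine ⟨_, hu, fun n x => ?_⟩
  rw [sum_stackLim]
  exact Finset.sum_congr rfl fun m hm' => by rw [(Finset.mem_filter.1 hm').2]

end Law

/-! ### Gaussian random walks that follow a line -/

section Walk

variable {Ω : Type*} [MeasurableSpace Ω] {P : Measure Ω} {Y : ℕ → Ω → ℝ} {v : ℝ≥0}

theorem hasGaussianLaw_of_map_eq {Z : Ω → ℝ} (hZ : Measurable Z)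
    (h : P.map Z = gaussianReal 0 v) : HasGaussianLaw Z P :=
  HasLaw.hasGaussianLaw (μ := gaussianReal 0 v) ⟨hZ.aemeasurable, h⟩

theorem integral_eq_zero_of_map_eq {Z : Ω → ℝ} (hZ : Measurable Z)
    (h : P.map Z = gaussianReal 0 v) : ∫ ω, Z ω ∂P = 0 := by
  rw [← integral_map (φ := Z) hZ.aemeasurable (f := fun x => x) (by fun_prop), h,
    integral_id_gaussianReal]

theorem variance_eq_of_map_eq {Z : Ω → ℝ} (hZ : Measurable Z)
    (h : P.map Z = gaussianReal 0 v) : Var[Z; P] = v := by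
  rw [← variance_id_map hZ.aemeasurable, h, variance_id_gaussianReal]

theorem covariance_eq_of_map_eq (hY : ∀ i, Measurable (Y i))
    (hlaw : ∀ i, P.map (Y i) = gaussianReal 0 v) (hindep : iIndepFun Y P) (i j : ℕ) :
    cov[Y i, Y j; P] = if i = j then (v : ℝ) else 0 := by
  have hL : ∀ i, MemLp (Y i) 2 P := fun i => (hasGaussianLaw_of_map_eq (hY i) (hlaw i)).memLp_two
  split_ifs with h
  · subst h
    rw [covariance_self (hY i).aemeasurable, variance_eq_of_map_eq (hY i) (hlaw i)]
  · exact (hindep.indepFun h).covariance_eq_zero (hL i) (hL j)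

variable [IsProbabilityMeasure P]

theorem covariance_sum_range (hY : ∀ i, Measurable (Y i))
    (hlaw : ∀ i, P.map (Y i) = gaussianReal 0 v) (hindep : iIndepFun Y P) {m j : ℕ} (hj : j ≤ m) :
    cov[fun ω => ∑ i ∈ Finset.range m, Y i ω, fun ω => ∑ i ∈ Finset.range j, Y i ω; P]
      = j * v := by
  have hL : ∀ i, MemLp (Y i) 2 P := fun i => (hasGaussianLaw_of_map_eq (hY i) (hlaw i)).memLp_two
  rw [covariance_fun_sum_fun_sum' (fun i _ => hL i) (fun i _ => hL i)]
  simp only [covariance_eq_of_map_eq hY hlaw hindep]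
  rw [Finset.sum_comm]
  have h : ∀ y ∈ Finset.range j, (∑ x ∈ Finset.range m, if x = y then (v : ℝ) else 0) = v := by
    intro y hy
    rw [Finset.sum_ite_eq' (Finset.range m) y, if_pos]
    exact Finset.mem_range.2 ((Finset.mem_range.1 hy).trans_le hj)
  rw [Finset.sum_congr rfl h]
  simp

theorem map_sum_range (hY : ∀ i, Measurable (Y i))
    (hlaw : ∀ i, P.map (Y i) = gaussianReal 0 v) (hindep : iIndepFun Y P) (m : ℕ) :
    P.map (fun ω => ∑ i ∈ Finset.range m, Y i ω) = gaussianReal 0 (m * v) := by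
  have hg : ∀ i, HasGaussianLaw (Y i) P := fun i => hasGaussianLaw_of_map_eq (hY i) (hlaw i)
  have h1 : HasGaussianLaw (fun ω => ∑ i ∈ Finset.range m, Y i ω) P := by
    have h := iIndepFun.hasGaussianLaw_fun_sum (X := fun i : Fin m => Y i)
      (fun i => hg i) (hindep.precomp Fin.val_injective)
    simpa only [Finset.sum_range] using h
  rw [h1.map_eq_gaussianReal]
  congr 1
  · rw [integral_finsetSum _ fun i _ => (hg i).integrable]
    exact Finset.sum_eq_zero fun i _ => integral_eq_zero_of_map_eq (hY i) (hlaw i)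
  · rw [← covariance_self h1.aemeasurable, covariance_sum_range hY hlaw hindep le_rfl]
    rw [← NNReal.coe_natCast, ← NNReal.coe_mul, Real.toNNReal_coe]

theorem integral_abs_sum_range_le (hY : ∀ i, Measurable (Y i))
    (hlaw : ∀ i, P.map (Y i) = gaussianReal 0 v) (hindep : iIndepFun Y P) (m : ℕ) :
    ∫ ω, |∑ i ∈ Finset.range m, Y i ω| ∂P ≤ √(m * v) := by
  have hm : Measurable fun ω => ∑ i ∈ Finset.range m, Y i ω := by fun_prop
  have hmap := map_sum_range hY hlaw hindep m
  have hL : MemLp (fun ω => ∑ i ∈ Finset.range m, Y i ω) 2 P :=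
    (hasGaussianLaw_of_map_eq hm hmap).memLp_two
  refine Real.le_sqrt_of_sq_le ?_
  have h1 := variance_nonneg (fun ω => |∑ i ∈ Finset.range m, Y i ω|) P
  have hL' : MemLp (fun ω => |∑ i ∈ Finset.range m, Y i ω|) 2 P := hL.abs
  rw [variance_eq_sub hL'] at h1
  have h2 := variance_eq_of_map_eq hm hmap
  rw [variance_eq_sub hL, integral_eq_zero_of_map_eq hm hmap] at h2
  simp only [Pi.pow_apply, sq_abs] at h1 h2
  push_cast at h2
  linarith

/-- Doob's maximal inequality for the absolute value of the walk. -/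
theorem measure_max_abs_sum_le (hY : ∀ i, Measurable (Y i))
    (hlaw : ∀ i, P.map (Y i) = gaussianReal 0 v) (hindep : iIndepFun Y P) {m : ℕ} {t : ℝ}
    (ht : 0 < t) (hmt : 2 * √(m * v) ≤ t) :
    P {ω | ∃ j ≤ m, t ≤ |∑ i ∈ Finset.range j, Y i ω|} ≤ 1 / 2 := by
  have hint : ∀ i, Integrable (Y i) P := fun i =>
    (hasGaussianLaw_of_map_eq (hY i) (hlaw i)).integrable
  set e : ℕ → Unit → Ω → ℝ := fun n _ => Y n with he
  have hem : ∀ n x, Measurable (e n x) := fun n _ => hY n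
  let 𝒢 : Filtration ℕ ‹MeasurableSpace Ω› :=
    ⟨noiseHistory e, noiseHistory_mono e, noiseHistory_le hem⟩
  have hinj : Function.Injective (Prod.fst : ℕ × Unit → ℕ) := fun a b h => Prod.ext h rfl
  have hind : ∀ n, Indep (noiseHistory e n) (MeasurableSpace.comap (Y n) inferInstance) P :=
    fun n => indep_noiseHistory hem (hindep.precomp hinj) n ()
  set S : ℕ → Ω → ℝ := fun j ω => ∑ i ∈ Finset.range j, Y i ω with hS
  have hSint : ∀ n, Integrable (S n) P := fun n => integrable_finsetSum _ fun i _ => hint i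
  have hadp : StronglyAdapted 𝒢 S := fun n => by
    refine Measurable.stronglyMeasurable ?_
    refine Finset.measurable_fun_sum _ fun i hi => ?_
    exact measurable_noiseHistory e (Finset.mem_range.1 hi) ()
  have hmart : Martingale S 𝒢 P := by
    refine martingale_nat hadp hSint fun n => ?_
    have h1 : S (n + 1) = S n + Y n := by
      ext ω
      simp [hS, Finset.sum_range_succ]
    have h2 := condExp_add (m := 𝒢 n) (hSint n) (hint n)
    have h3 : P[S n | 𝒢 n] = S n :=
      condExp_of_stronglyMeasurable (𝒢.le n) (hadp n) (hSint n)
    have h4 : P[Y n | 𝒢 n] =ᵐ[P] fun _ => P[Y n] :=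
      condExp_indep_eq (hY n).comap_le (𝒢.le n) (comap_measurable (Y n)).stronglyMeasurable
        (hind n).symm
    rw [h1]
    filter_upwards [h2, h4] with ω hω1 hω2
    rw [hω1, Pi.add_apply, h3, hω2, integral_eq_zero_of_map_eq (hY n) (hlaw n), add_zero]
  have hsub : Submartingale (S ⊔ -S) 𝒢 P := hmart.submartingale.sup hmart.neg.submartingale
  have habs : ∀ n ω, (S ⊔ -S) n ω = |S n ω| := fun n ω => rfl
  have hmax := maximal_ineq hsub (fun n ω => by rw [habs]; exact abs_nonneg _)
    (ε := t.toNNReal) m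
  simp only [habs, Real.coe_toNNReal t ht.le] at hmax
  have hset : {ω | ∃ j ≤ m, t ≤ |S j ω|} = {ω | t ≤ (Finset.range (m + 1)).sup'
      Finset.nonempty_range_add_one fun k => |S k ω|} := by
    ext ω
    simp only [Set.mem_ofPred_eq, Finset.le_sup'_iff, Finset.mem_range, Nat.lt_succ_iff]
  rw [hset]
  refine (ENNReal.mul_le_mul_iff_right (a := ((t.toNNReal : ℝ≥0) : ENNReal)) ?_
    ENNReal.coe_ne_top).1 (hmax.trans ?_)
  · simpa using ht
  · have h1 : ∫ ω in {ω | t ≤ (Finset.range (m + 1)).sup'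
        Finset.nonempty_range_add_one fun k => |S k ω|}, |S m ω| ∂P ≤ t / 2 := by
      refine (setIntegral_le_integral (hSint m).abs
        (Eventually.of_forall fun ω => abs_nonneg _)).trans ?_
      have := integral_abs_sum_range_le hY hlaw hindep m
      simp only [hS]
      linarith
    refine (ENNReal.ofReal_le_ofReal h1).trans_eq ?_
    rw [ENNReal.ofReal_div_of_pos two_pos, ENNReal.div_eq_inv_mul, mul_comm, one_div]
    simp [ENNReal.ofReal]

/-- The bridge of a Gaussian walk is independent of its endpoint. -/
theorem indepFun_bridge (hY : ∀ i, Measurable (Y i))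
    (hlaw : ∀ i, P.map (Y i) = gaussianReal 0 v) (hindep : iIndepFun Y P) {m : ℕ} (hm : 0 < m) :
    IndepFun (fun ω (_ : Unit) => ∑ i ∈ Finset.range m, Y i ω)
      (fun ω (j : Fin (m + 1)) => ∑ i ∈ Finset.range j, Y i ω
        - (j / m : ℝ) * ∑ i ∈ Finset.range m, Y i ω) P := by
  have hg : ∀ i, HasGaussianLaw (Y i) P := fun i => hasGaussianLaw_of_map_eq (hY i) (hlaw i)
  have hL : ∀ j, MemLp (fun ω => ∑ i ∈ Finset.range j, Y i ω) 2 P := fun j =>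
    memLp_finsetSum _ fun i _ => (hg i).memLp_two
  refine HasGaussianLaw.indepFun_of_covariance_eval
    (X := fun (_ : Unit) ω => ∑ i ∈ Finset.range m, Y i ω)
    (Y := fun (j : Fin (m + 1)) ω => ∑ i ∈ Finset.range j, Y i ω
        - (j / m : ℝ) * ∑ i ∈ Finset.range m, Y i ω) ?_ fun _ j => ?_
  · let L : (Fin m → ℝ) →ₗ[ℝ] (Unit → ℝ) × (Fin (m + 1) → ℝ) :=
      { toFun := fun x => (fun _ => ∑ i, x i, fun j =>
          (∑ i : Fin m, if (i : ℕ) < j then x i else 0) - (j / m : ℝ) * ∑ i, x i)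
        map_add' := fun x y => by
          ext j
          · simp [Finset.sum_add_distrib]
          · simp only [Pi.add_apply, ite_add_zero, Finset.sum_add_distrib, Prod.snd_add]
            ring
        map_smul' := fun c x => by
          ext j
          · simp [Finset.mul_sum]
          · simp only [Pi.smul_apply, smul_eq_mul, ← mul_ite_zero, ← Finset.mul_sum, Prod.smul_snd,
              RingHom.id_apply]
            ring }
    have h := (iIndepFun.hasGaussianLaw (X := fun i : Fin m => Y i) (fun i => hg i)
      (hindep.precomp Fin.val_injective)).map_fun (LinearMap.toContinuousLinearMap L)
    refine h.congr (Eventually.of_forall fun ω => Prod.ext ?_ ?_)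
    · funext _
      simp [L, Finset.sum_range]
    · funext j
      have h1 : (∑ i : Fin m, if (i : ℕ) < j then Y i ω else 0) = ∑ i ∈ Finset.range j, Y i ω := by
        rw [← Finset.sum_range (fun i => if i < (j : ℕ) then Y i ω else 0),
          ← Finset.sum_filter]
        congr 1
        ext i
        have := j.2
        simp only [Finset.mem_filter, Finset.mem_range]
        omega
      simp only [L, LinearMap.coe_toContinuousLinearMap', LinearMap.coe_mk, AddHom.coe_mk, h1,
        ← Finset.sum_range (fun i => Y i ω)]
  · rw [covariance_fun_sub_right (hL m) (hL j) ((hL m).const_mul _), covariance_const_mul_right,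
      covariance_sum_range hY hlaw hindep (Nat.lt_succ_iff.1 j.2),
      covariance_sum_range hY hlaw hindep le_rfl]
    have : (m : ℝ) ≠ 0 := by positivity
    field_simp
    ring

/-- A Gaussian random walk stays within `β * s` of a line of slope `α / s` during `ρ * s ^ 2` steps
with a probability that does not depend on the scale `s`. It suffices that the endpoint is near the
line and the bridge is small, and these two events are independent. -/
theorem exists_le_measure_near_line (hv : v ≠ 0) {ρ : ℕ} (hρ : 0 < ρ) (α : ℝ) {β : ℝ} (hβ : 0 < β)
    (hβρ : 8 * √(ρ * v) ≤ β) : ∃ δ : ENNReal, δ ≠ 0 ∧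
    ∀ {Ω : Type*} [MeasurableSpace Ω] {P : Measure Ω} [IsProbabilityMeasure P] {Y : ℕ → Ω → ℝ},
      (∀ i, Measurable (Y i)) → (∀ i, P.map (Y i) = gaussianReal 0 v) → iIndepFun Y P →
      ∀ s : ℕ, 0 < s → δ ≤ P {ω | ∀ j ≤ ρ * s ^ 2,
        |∑ i ∈ Finset.range j, Y i ω - j * α / s| ≤ β * s} := by
  refine ⟨gaussianReal 0 (ρ * v) (Set.Icc (ρ * α - β / 2) (ρ * α + β / 2)) * (1 / 2), ?_, ?_⟩
  · refine mul_ne_zero (fun h => ?_) (by simp)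
    have h1 := gaussianReal_absolutelyContinuous' 0 (v := ρ * v)
      (mul_ne_zero (by exact_mod_cast hρ.ne') hv) h
    rw [Real.volume_Icc, ENNReal.ofReal_eq_zero] at h1
    linarith
  intro Ω _ P _ Y hY hlaw hindep s hs
  set m := ρ * s ^ 2 with hm
  have hm0 : 0 < m := by positivity
  have hs0 : (0 : ℝ) < s := by exact_mod_cast hs
  have hm0' : (0 : ℝ) < m := by exact_mod_cast hm0
  have hmr : (m : ℝ) = ρ * s ^ 2 := by rw [hm]; push_cast; ring
  set G1 : Set (Unit → ℝ) := {x | |x () - m * α / s| ≤ β * s / 2} with hG1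
  set G2 : Set (Fin (m + 1) → ℝ) := {x | ∀ j, |x j| ≤ β * s / 2} with hG2
  have hG1m : MeasurableSet G1 := measurableSet_le (by fun_prop) measurable_const
  have hG2m : MeasurableSet G2 := by
    rw [hG2, Set.ofPred_forall]
    exact MeasurableSet.iInter fun j => measurableSet_le (by fun_prop) measurable_const
  have hind := (indepFun_bridge hY hlaw hindep hm0).measure_inter_preimage_eq_mul _ _ hG1m hG2m
  have hSm : Measurable fun ω => ∑ i ∈ Finset.range m, Y i ω := by fun_prop
  -- by scaling, the law of the endpoint in units of `s` does not depend on `s`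
  have hP1 : P ((fun ω (_ : Unit) => ∑ i ∈ Finset.range m, Y i ω) ⁻¹' G1)
      = gaussianReal 0 (ρ * v) (Set.Icc (ρ * α - β / 2) (ρ * α + β / 2)) := by
    have h1 : (fun ω (_ : Unit) => ∑ i ∈ Finset.range m, Y i ω) ⁻¹' G1
        = (fun ω => ∑ i ∈ Finset.range m, Y i ω) ⁻¹' {x | |x - m * α / s| ≤ β * s / 2} := rfl
    have h2 : (gaussianReal 0 (ρ * v)).map (fun x => (s : ℝ) * x) = gaussianReal 0 (m * v) := by
      rw [gaussianReal_map_const_mul, mul_zero]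
      congr 1
      ext
      push_cast
      rw [hmr]
      ring
    rw [h1, ← Measure.map_apply hSm (measurableSet_le (by fun_prop) measurable_const),
      map_sum_range hY hlaw hindep, ← h2, Measure.map_apply (by fun_prop)
      (measurableSet_le (by fun_prop) measurable_const)]
    congr 1
    ext x
    have h3 : s * x - m * α / s = s * (x - ρ * α) := by
      rw [hmr]
      field_simp
    simp only [Set.mem_preimage, Set.mem_ofPred_eq, Set.mem_Icc, h3, abs_mul, abs_of_pos hs0]
    rw [show β * s / 2 = s * (β / 2) by ring, mul_le_mul_iff_right₀ hs0, abs_le]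
    constructor
    · rintro ⟨h4, h5⟩
      constructor <;> linarith
    · rintro ⟨h4, h5⟩
      constructor <;> linarith
  -- the bridge is small if the walk is, which Doob's inequality gives for `β ≥ 8 * √(ρ * v)`
  have hP2 : 1 / 2 ≤ P ((fun ω (j : Fin (m + 1)) => ∑ i ∈ Finset.range j, Y i ω
        - (j / m : ℝ) * ∑ i ∈ Finset.range m, Y i ω) ⁻¹' G2) := by
    have hmax := measure_max_abs_sum_le hY hlaw hindep (m := m) (t := β * s / 4) (by positivity) (by
      have h1 : √(m * v) = s * √(ρ * v) := by
        rw [hmr, show (ρ * s ^ 2 * v : ℝ) = s ^ 2 * (ρ * v) by ring,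
          Real.sqrt_mul (by positivity), Real.sqrt_sq hs0.le]
      rw [h1]
      nlinarith)
    have hMm : MeasurableSet {ω | ∃ j ≤ m, β * s / 4 ≤ |∑ i ∈ Finset.range j, Y i ω|} := by
      have h1 : {ω | ∃ j ≤ m, β * s / 4 ≤ |∑ i ∈ Finset.range j, Y i ω|}
          = ⋃ j, ⋃ _ : j ≤ m, {ω | β * s / 4 ≤ |∑ i ∈ Finset.range j, Y i ω|} := by
        ext ω
        simp
      rw [h1]
      exact MeasurableSet.iUnion fun j => MeasurableSet.iUnion fun _ =>
        measurableSet_le measurable_const (by fun_prop)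
    have hhalf : (1 / 2 : ENNReal) = 1 - 1 / 2 := by
      rw [one_div, ENNReal.one_sub_inv_two]
    calc (1 / 2 : ENNReal) = 1 - 1 / 2 := hhalf
      _ ≤ 1 - P {ω | ∃ j ≤ m, β * s / 4 ≤ |∑ i ∈ Finset.range j, Y i ω|} := tsub_le_tsub_left hmax 1
      _ = P {ω | ∃ j ≤ m, β * s / 4 ≤ |∑ i ∈ Finset.range j, Y i ω|}ᶜ :=
        (prob_compl_eq_one_sub hMm).symm
      _ ≤ _ := by
        refine measure_mono fun ω hω j => ?_
        have hω' : ∀ j ≤ m, |∑ i ∈ Finset.range j, Y i ω| < β * s / 4 := by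
          intro j hj
          by_contra h
          exact hω ⟨j, hj, not_lt.1 h⟩
        have hj : (j : ℕ) ≤ m := Nat.lt_succ_iff.1 j.2
        have h1 := hω' j hj
        have h2 := hω' m le_rfl
        have h3 : (j / m : ℝ) ≤ 1 := (div_le_one hm0').2 (by exact_mod_cast hj)
        have h4 : |(j / m : ℝ) * ∑ i ∈ Finset.range m, Y i ω| ≤ β * s / 4 := by
          rw [abs_mul, abs_of_nonneg (by positivity : (0 : ℝ) ≤ j / m)]
          exact (mul_le_of_le_one_left (abs_nonneg _) h3).trans h2.le
        exact (abs_sub _ _).trans (by linarith)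
  calc _ ≤ _ := mul_le_mul' le_rfl hP2
    _ = _ := by rw [← hP1, ← hind]
    _ ≤ _ := by
      refine measure_mono fun ω hω j hj => ?_
      have h1 : |∑ i ∈ Finset.range m, Y i ω - m * α / s| ≤ β * s / 2 := hω.1
      have h2 : |∑ i ∈ Finset.range j, Y i ω - (j / m : ℝ) * ∑ i ∈ Finset.range m, Y i ω|
          ≤ β * s / 2 := hω.2 ⟨j, Nat.lt_succ_iff.2 hj⟩
      have h3 : (j / m : ℝ) ≤ 1 := (div_le_one hm0').2 (by exact_mod_cast hj)
      have h4 : |(j / m : ℝ) * (∑ i ∈ Finset.range m, Y i ω - m * α / s)| ≤ β * s / 2 := by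
        rw [abs_mul, abs_of_nonneg (by positivity : (0 : ℝ) ≤ j / m)]
        exact (mul_le_of_le_one_left (abs_nonneg _) h3).trans h1
      have h5 : ∑ i ∈ Finset.range j, Y i ω - j * α / s
          = (∑ i ∈ Finset.range j, Y i ω - (j / m : ℝ) * ∑ i ∈ Finset.range m, Y i ω)
            + (j / m : ℝ) * (∑ i ∈ Finset.range m, Y i ω - m * α / s) := by
        field_simp
        ring
      rw [h5]
      exact (abs_add_le _ _).trans (by linarith)

end Walk

/-! ### Spread of independent Gaussian random walks -/

/-- Events that depend on disjoint groups of independent variables are independent. -/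
theorem measure_biInter_of_disjoint {ι κ Ω : Type*} [MeasurableSpace Ω] {P : Measure Ω}
    [IsProbabilityMeasure P] {Y : κ → Ω → ℝ} (hY : ∀ i, Measurable (Y i)) (hindep : iIndepFun Y P)
    {S : ι → Set κ} (hS : Pairwise (Function.onFun Disjoint S)) {E : ι → Set Ω}
    (hE : ∀ i, MeasurableSet[⨆ k ∈ S i, MeasurableSpace.comap (Y k) inferInstance] (E i))
    (s : Finset ι) : P (⋂ i ∈ s, E i) = ∏ i ∈ s, P (E i) := by
  classical
  induction s using Finset.induction_on with
  | empty => simp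
  | insert a s ha ih =>
    rw [Finset.set_biInter_insert, Finset.prod_insert ha, ← ih]
    have hdis : Disjoint (S a) (⋃ i ∈ s, S i) := by
      rw [Set.disjoint_iUnion₂_right]
      exact fun i hi => hS fun h => ha (h ▸ hi)
    refine (Indep_iff _ _ P).1 (indep_iSup_of_disjoint (fun k => (hY k).comap_le)
      ((iIndepFun_iff_iIndep _ _ _).1 hindep) hdis) _ _ (hE a) ?_
    refine Finset.measurableSet_biInter s fun i hi => ?_
    exact (biSup_mono fun k hk => Set.mem_biUnion hi hk :
      (⨆ k ∈ S i, MeasurableSpace.comap (Y k) inferInstance)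
        ≤ ⨆ k ∈ ⋃ i ∈ s, S i, MeasurableSpace.comap (Y k) inferInstance) _ (hE i)

/-- The starting times of the successive windows in which the walks are observed. A window is so
much longer than its starting time that what happened before the window is negligible. -/
def windowStart (ρ : ℕ) : ℕ → ℕ
  | 0 => 0
  | t + 1 => windowStart ρ t + ρ * (windowStart ρ t ^ 2 + t + 1) ^ 2

/-- The scale of a window: the square root of its length, up to the factor `ρ`. -/
def windowScale (ρ t : ℕ) : ℕ := windowStart ρ t ^ 2 + t + 1

theorem windowStart_succ (ρ t : ℕ) :
    windowStart ρ (t + 1) = windowStart ρ t + ρ * windowScale ρ t ^ 2 := rfl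

theorem windowStart_mono (ρ : ℕ) : Monotone (windowStart ρ) :=
  monotone_nat_of_le_succ fun _ => Nat.le_add_right _ _

section Windows

variable {X Ω : Type*} [MeasurableSpace Ω] {P : Measure Ω}
  [IsProbabilityMeasure P] {Y : X × ℕ → Ω → ℝ} {v : X → ℝ≥0}

/-- Independent Gaussian walks follow prescribed lines, all at the same time, in infinitely many
windows. -/
theorem ae_frequently_near_line [Finite X] (hY : ∀ i, Measurable (Y i))
    (hlaw : ∀ i, P.map (Y i) = gaussianReal 0 (v i.1)) (hindep : iIndepFun Y P)
    (hv : ∀ x, v x ≠ 0) {ρ : ℕ} (hρ : 0 < ρ) (α : X → ℝ) {β : ℝ} (hβ : 0 < β)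
    (hβρ : ∀ x, 8 * √(ρ * v x) ≤ β) :
    ∀ᵐ ω ∂P, ∃ᶠ t in atTop, ∀ x, ∀ j ≤ ρ * windowScale ρ t ^ 2,
      |∑ i ∈ Finset.range j, Y (x, windowStart ρ t + i) ω - j * α x / windowScale ρ t|
        ≤ β * windowScale ρ t := by
  cases nonempty_fintype X
  choose δ hδ0 hδ using fun x => exists_le_measure_near_line (hv x) hρ (α x) hβ (hβρ x)
  set E : X × ℕ → Set Ω := fun p => {ω | ∀ j ≤ ρ * windowScale ρ p.2 ^ 2,
      |∑ i ∈ Finset.range j, Y (p.1, windowStart ρ p.2 + i) ω - j * α p.1 / windowScale ρ p.2|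
        ≤ β * windowScale ρ p.2} with hE
  -- the event `E (x, t)` depends on the variables of `S (x, t)`
  set S : X × ℕ → Set (X × ℕ) := fun p =>
    {i | i.1 = p.1 ∧ windowStart ρ p.2 ≤ i.2 ∧ i.2 < windowStart ρ (p.2 + 1)} with hS
  have hSdis : Pairwise (Function.onFun Disjoint S) := by
    rintro ⟨x, t⟩ ⟨x', t'⟩ hne
    refine Set.disjoint_left.2 ?_
    rintro ⟨y, i⟩ ⟨h1, h2, h3⟩ ⟨h1', h2', h3'⟩
    simp only at h1 h2 h3 h1' h2' h3'
    refine hne (Prod.ext (h1.symm.trans h1') ?_)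
    rcases lt_trichotomy t t' with h | h | h
    · have := windowStart_mono ρ (Nat.succ_le_of_lt h)
      simp only [Nat.succ_eq_add_one] at this
      omega
    · exact h
    · have := windowStart_mono ρ (Nat.succ_le_of_lt h)
      simp only [Nat.succ_eq_add_one] at this
      omega
  have hEm : ∀ p, MeasurableSet[⨆ k ∈ S p, MeasurableSpace.comap (Y k) inferInstance] (E p) := by
    intro p
    have h1 : E p = ⋂ j, ⋂ _ : j ≤ ρ * windowScale ρ p.2 ^ 2,
        {ω | |∑ i ∈ Finset.range j, Y (p.1, windowStart ρ p.2 + i) ω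
          - j * α p.1 / windowScale ρ p.2| ≤ β * windowScale ρ p.2} := by
      ext ω
      simp [hE]
    rw [h1]
    refine MeasurableSet.iInter fun j => MeasurableSet.iInter fun hj => ?_
    refine @measurableSet_le _ _ _ _ _ (_) _ _ _ _ _ ?_ measurable_const
    refine Measurable.comp (g := fun x : ℝ => |x - j * α p.1 / windowScale ρ p.2|) (by fun_prop) ?_
    refine Finset.measurable_fun_sum _ fun i hi => ?_
    refine (comap_measurable (Y (p.1, windowStart ρ p.2 + i))).mono ?_ le_rfl
    refine le_iSup₂_of_le (f := fun k (_ : k ∈ S p) =>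
      MeasurableSpace.comap (Y k) inferInstance) (p.1, windowStart ρ p.2 + i) ?_ le_rfl
    refine ⟨rfl, Nat.le_add_right _ _, ?_⟩
    have := Finset.mem_range.1 hi
    rw [windowStart_succ]
    simp only
    omega
  have hEm' : ∀ p, MeasurableSet (E p) := fun p =>
    (iSup₂_le fun k _ => (hY k).comap_le : (⨆ k ∈ S p, MeasurableSpace.comap (Y k) inferInstance)
      ≤ ‹MeasurableSpace Ω›) _ (hEm p)
  have hprod := measure_biInter_of_disjoint hY hindep hSdis hEm
  have hinter : ∀ T : Finset ℕ, (⋂ t ∈ T, ⋂ x, E (x, t))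
      = ⋂ p ∈ (Finset.univ : Finset X) ×ˢ T, E p := by
    intro T
    ext ω
    simp only [Set.mem_iInter, Finset.mem_product, Finset.mem_univ, true_and, Prod.forall]
    exact ⟨fun h x t ht => h t ht x, fun h t ht x => h x t ht⟩
  have hone : ∀ t, P (⋂ x, E (x, t)) = ∏ x, P (E (x, t)) := by
    intro t
    have h1 := hinter {t}
    simp only [Finset.mem_singleton, Set.iInter_iInter_eq_left] at h1
    rw [h1, hprod, Finset.prod_product]
    simp
  have hm : ∀ t, MeasurableSet (⋂ x, E (x, t)) := fun t => MeasurableSet.iInter fun x => hEm' _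
  have hlim := measure_limsup_eq_one (μ := P) (s := fun t => ⋂ x, E (x, t)) hm
    ((iIndepSet_iff_meas_biInter hm).2 fun T => by
      rw [hinter, hprod, Finset.prod_product_right]
      exact Finset.prod_congr rfl fun t _ => (hone t).symm) (by
    refine top_le_iff.1 ?_
    rw [← ENNReal.tsum_const_eq_top_of_ne_zero (α := ℕ)
      (Finset.prod_ne_zero_iff.2 fun x _ => hδ0 x : ∏ x, δ x ≠ 0)]
    refine ENNReal.tsum_le_tsum fun t => ?_
    rw [hone]
    refine Finset.prod_le_prod' fun x _ => ?_
    exact hδ x (Y := fun i => Y (x, windowStart ρ t + i)) (fun i => hY _) (fun i => hlaw _)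
      (hindep.precomp fun i j h => by simpa using h) (windowScale ρ t) (Nat.succ_pos _))
  have hae : ∀ᵐ ω ∂P, ω ∈ limsup (fun t => ⋂ x, E (x, t)) atTop :=
    (mem_ae_iff_prob_eq_one (MeasurableSet.measurableSet_limsup hm)).2 hlim
  filter_upwards [hae] with ω hω
  rw [mem_limsup_iff_frequently_mem] at hω
  exact hω.mono fun t ht x => Set.mem_iInter.1 ht x

end Windows

/-- In a window where the increments of a walk follow a line of slope `H * r / s`, so does the walk
itself, because its value at the beginning of the window is small. -/
theorem abs_sum_sub_le_of_window {y : ℕ → ℝ} {n t s ρ : ℕ} {B H r : ℝ} (hs : s = n ^ 2 + t + 1)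
    (hH : 0 < H) (hr : 0 ≤ r) (hB : ∀ n : ℕ, |∑ i ∈ Finset.range n, y i| ≤ B * n)
    (ht : 16 * (B + H * r) ^ 2 / H ^ 2 ≤ t)
    (hy : ∀ j ≤ ρ * s ^ 2, |∑ i ∈ Finset.range j, y (n + i) - j * (H * r) / s| ≤ H / 8 * s)
    {j : ℕ} (h1 : s ^ 2 ≤ j) (h2 : j ≤ ρ * s ^ 2) :
    |∑ i ∈ Finset.range j, y i - H * r * j / s| ≤ H * j / (4 * s) := by
  have hs1 : 1 ≤ s := by omega
  have hnj : n ≤ j := by nlinarith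
  obtain ⟨l, rfl⟩ := Nat.exists_eq_add_of_le hnj
  have hs0 : (0 : ℝ) < s := by exact_mod_cast hs1
  have hs' : (s : ℝ) = n ^ 2 + t + 1 := by rw [hs]; push_cast; ring
  have hl := hy l (by omega)
  have hn := hB n
  have hns : n * (H * r) / s ≤ n * (H * r) := div_le_self (by positivity)
    (by exact_mod_cast hs1)
  have hns0 : 0 ≤ n * (H * r) / s := by positivity
  have hlast : H * s / 4 ≤ H * ↑(n + l) / (4 * s) := by
    rw [div_le_div_iff₀ (by norm_num) (by positivity)]
    have : (s : ℝ) ^ 2 ≤ ↑(n + l) := by exact_mod_cast h1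
    nlinarith
  -- `n` is at most the square root of `s`, so a multiple of `n` is small against `s`
  have hsmall : n * (B + H * r) ≤ H / 8 * s := by
    rw [div_le_iff₀ (by positivity)] at ht
    have h3 : H * (n * (B + H * r)) ≤ H * (H / 8 * s) := by
      rw [hs']
      nlinarith [sq_nonneg (H * n - 4 * (B + H * r)), sq_nonneg H]
    exact le_of_mul_le_mul_left h3 hH
  have hsplit : ∑ i ∈ Finset.range (n + l), y i - H * r * ↑(n + l) / s
      = ∑ i ∈ Finset.range n, y i
        + (∑ i ∈ Finset.range l, y (n + i) - l * (H * r) / s) - n * (H * r) / s := by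
    rw [Finset.sum_range_add]
    push_cast
    ring
  rw [hsplit]
  rw [abs_le] at hn hl ⊢
  constructor <;> nlinarith [hn.1, hn.2, hl.1, hl.2]

theorem exists_abs_le_mul_of_tendsto {w : ℕ → ℝ} (h0 : w 0 = 0)
    (hw : Tendsto (fun n : ℕ => w n / n) atTop (𝓝 0)) : ∃ B, ∀ n : ℕ, |w n| ≤ B * n := by
  obtain ⟨B, hB⟩ := hw.abs.bddAbove_range
  refine ⟨B, fun n => ?_⟩
  rcases Nat.eq_zero_or_pos n with rfl | hn
  · simp [h0]
  · have h1 : |w n / n| ≤ B := hB ⟨n, rfl⟩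
    rwa [abs_div, Nat.abs_cast, div_le_iff₀ (by exact_mod_cast hn)] at h1

/-- Independent Gaussian sequences satisfy, almost surely, the law of large numbers, and their
partial sums drift apart in every prescribed order. -/
theorem ae_tendsto_and_isSpread {K C : Type*} [Finite K] [Finite C] {v : K → C → ℝ≥0}
    (hv : ∀ k c, 0 < v k c) (rk : C → K → ℕ) :
    ∀ᵐ w ∂Measure.infinitePi fun i : (K × C) × ℕ => gaussianReal 0 (v i.1.1 i.1.2),
      (∀ k c, Tendsto (fun n : ℕ => (∑ i ∈ Finset.range n, w ((k, c), i)) / (n : ℝ)) atTop (𝓝 0)) ∧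
      ∀ c, IsSpread (rk c) fun k n => ∑ i ∈ Finset.range n, w ((k, c), i) := by
  set P := Measure.infinitePi fun i : (K × C) × ℕ => gaussianReal 0 (v i.1.1 i.1.2) with hP
  set Y : (K × C) × ℕ → ((K × C) × ℕ → ℝ) → ℝ := fun i w => w i with hYdef
  have hY : ∀ i, Measurable (Y i) := fun i => measurable_pi_apply i
  have hlaw : ∀ i, P.map (Y i) = gaussianReal 0 (v i.1.1 i.1.2) := fun i =>
    Measure.infinitePi_map_eval _ i
  have hindep : iIndepFun Y P := iIndepFun_infinitePi (X := fun _ x => x) fun _ => measurable_id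
  have hslln : ∀ᵐ w ∂P, ∀ x : K × C,
      Tendsto (fun n : ℕ => (∑ i ∈ Finset.range n, w (x, i)) / (n : ℝ)) atTop (𝓝 0) := by
    refine ae_all_iff.2 fun x => ?_
    have h1 := strong_law_ae_real (μ := P) (fun i => Y (x, i))
      (hasGaussianLaw_of_map_eq (hY _) (hlaw (x, 0))).integrable
      (fun i j hij => hindep.indepFun (by simpa using hij))
      (fun i => ⟨(hY _).aemeasurable, (hY _).aemeasurable, by rw [hlaw, hlaw]⟩)
    rwa [integral_eq_zero_of_map_eq (hY _) (hlaw (x, 0))] at h1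
  have hfreq : ∀ᵐ w ∂P, ∀ ρ M : ℕ, 0 < ρ → 0 < M → (∀ x : K × C, 64 * √(ρ * v x.1 x.2) ≤ M) →
      ∃ᶠ t in atTop, ∀ x : K × C, ∀ j ≤ ρ * windowScale ρ t ^ 2,
        |∑ i ∈ Finset.range j, w (x, windowStart ρ t + i)
          - (j : ℝ) * (M * rk x.2 x.1) / windowScale ρ t| ≤ (M / 8 : ℝ) * windowScale ρ t := by
    refine ae_all_iff.2 fun ρ => ae_all_iff.2 fun M => ?_
    by_cases h : 0 < ρ ∧ 0 < M ∧ ∀ x : K × C, 64 * √(ρ * v x.1 x.2) ≤ M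
    · have hM : (0 : ℝ) < M := by exact_mod_cast h.2.1
      filter_upwards [ae_frequently_near_line (v := fun x : K × C => v x.1 x.2) hY hlaw hindep
        (fun x => (hv x.1 x.2).ne') h.1 (fun x => (M * rk x.2 x.1 : ℝ)) (β := M / 8) (by positivity)
        fun x => by linarith [h.2.2 x]] with w hw _ _ _
      exact hw
    · exact Eventually.of_forall fun w h1 h2 h3 => absurd ⟨h1, h2, h3⟩ h
  filter_upwards [hslln, hfreq] with w hw1 hw2
  refine ⟨fun k c => hw1 (k, c), fun c ρ H0 => ?_⟩
  obtain ⟨M1, hM1⟩ := (Set.finite_range fun x : K × C => 64 * √((ρ + 1 : ℕ) * v x.1 x.2)).bddAbove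
  set M := ⌈max H0 M1⌉₊ + 1 with hM
  have hMle : max H0 M1 ≤ M := (Nat.le_ceil _).trans (by rw [hM]; push_cast; linarith)
  have hM0 : (0 : ℝ) < M := by rw [hM]; positivity
  refine ⟨M, (le_max_left _ _).trans hMle, hM0, ?_⟩
  have hf := hw2 (ρ + 1) M (Nat.succ_pos _) (Nat.succ_pos _)
    fun x => (hM1 ⟨x, rfl⟩).trans ((le_max_right _ _).trans hMle)
  choose B hB using fun x : K × C => exists_abs_le_mul_of_tendsto
    (w := fun n => ∑ i ∈ Finset.range n, w (x, i)) (by simp) (hw1 x)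
  have hlarge : ∀ᶠ t : ℕ in atTop, ∀ k,
      16 * (B (k, c) + M * rk c k) ^ 2 / (M : ℝ) ^ 2 ≤ t :=
    eventually_all.2 fun k => tendsto_natCast_atTop_atTop.eventually_ge_atTop _
  have hscale : Tendsto (windowScale (ρ + 1)) atTop atTop :=
    tendsto_atTop_mono (fun t => by unfold windowScale; simp only [id_eq]; omega) tendsto_id
  refine hscale.frequently ((hf.and_eventually hlarge).mono ?_)
  rintro t ⟨ht1, ht2⟩ k j hj1 hj2
  exact abs_sum_sub_le_of_window (n := windowStart (ρ + 1) t) (y := fun i => w ((k, c), i)) rfl hM0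
    (Nat.cast_nonneg _) (hB (k, c)) (ht2 k) (ht1 (k, c)) hj1
    (hj2.trans (Nat.mul_le_mul_right _ (Nat.le_succ ρ)))

/-! ### Sample paths of the policy -/

/-- A real function on a finite set can be refined to a strict ranking. -/
theorem exists_injective_rank {K : Type*} [Fintype K] (f : K → ℝ) :
    ∃ rk : K → ℕ, Function.Injective rk ∧ ∀ k l, f k < f l → rk k < rk l := by
  classical
  set g : K → ℝ ×ₗ Fin (Fintype.card K) := fun k => toLex (f k, Fintype.equivFin K k) with hg
  have hmono : ∀ k l, g k < g l → (Finset.univ.filter fun i => g i < g k).card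
      < (Finset.univ.filter fun i => g i < g l).card := by
    intro k l hkl
    refine Finset.card_lt_card (Finset.ssubset_iff_of_subset (fun i hi => ?_) |>.2 ⟨k, ?_, ?_⟩)
    · rw [Finset.mem_filter] at hi ⊢
      exact ⟨hi.1, hi.2.trans hkl⟩
    · simpa using hkl
    · simp
  refine ⟨fun k => (Finset.univ.filter fun i => g i < g k).card, fun k l hkl => ?_,
    fun k l hkl => hmono k l (Prod.Lex.toLex_lt_toLex.2 (Or.inl hkl))⟩
  have h1 : g k = g l := by
    rcases lt_trichotomy (g k) (g l) with h | h | h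
    · exact absurd hkl (hmono k l h).ne
    · exact h
    · exact absurd hkl (hmono l k h).ne'
  exact (Fintype.equivFin K).injective (congrArg Prod.snd (toLex.injective h1))

section Policy

variable {K C Ω : Type*} [Fintype K] [DecidableEq K] [DecidableEq C]
  {F : K → C → ℝ} {v : K → C → ℝ≥0} {ε : ℕ → K → C → Ω → ℝ} {prior : Prior K C} {N0 : ℕ}
  {init : ℕ → K × C} {A : ℕ → Ω → K × C}

/-- The decision at time `n` is a function of all the noise before time `n`, observed or not. -/
theorem IsPolicy.measurableSet_noiseHistory [Finite C] (hA : IsPolicy F v ε prior N0 init A) (n : ℕ)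
    (x : K × C) :
    MeasurableSet[noiseHistory (fun n (x : K × C) => ε n x.1 x.2) n] {ω | A n ω = x} := by
  cases nonempty_fintype C
  induction n using Nat.strong_induction_on generalizing x with
  | _ n ih =>
    have hle : history F ε A n ≤ noiseHistory (fun n (x : K × C) => ε n x.1 x.2) n := by
      refine iSup_le fun m => ?_
      rintro _ ⟨B, hB, rfl⟩
      have h1 : observation F ε A m ⁻¹' B = ⋃ x : K × C,
          {ω | A m ω = x} ∩ (fun ω => F x.1 x.2 + ε m x.1 x.2 ω) ⁻¹' B := by
        ext ω
        simp only [observation, Set.mem_preimage, Set.mem_iUnion, Set.mem_inter_iff,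
          Set.mem_ofPred_eq]
        constructor
        · exact fun h => ⟨A m ω, rfl, h⟩
        · rintro ⟨x, rfl, h⟩
          exact h
      rw [h1]
      refine MeasurableSet.iUnion fun x => MeasurableSet.inter
        (noiseHistory_mono _ m.2.le _ (ih m m.2 x)) ?_
      exact (measurable_const.add (measurable_noiseHistory (fun n (x : K × C) => ε n x.1 x.2)
        m.2 x)) hB
    exact hle _ (hA.nonanticipating n x)

/-- Under the policy, almost every sample path is a trajectory whose noise is spread out. -/
theorem IsPolicy.ae_exists_isTrajectory [Finite C] [MeasurableSpace Ω] {P : Measure Ω}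
    [IsProbabilityMeasure P] (hv : ∀ k c, 0 < v k c) (hε_meas : ∀ n k c, Measurable (ε n k c))
    (hε_law : ∀ n k c, P.map (ε n k c) = gaussianReal 0 (v k c))
    (hε_indep : iIndepFun (fun i : ℕ × K × C => ε i.1 i.2.1 i.2.2) P)
    (hprior : prior.Independent N0 init) (hA : IsPolicy F v ε prior N0 init A) (rk : C → K → ℕ) :
    ∃ α β : K → C → ℝ, ∀ᵐ ω ∂P, ∃ W : K → C → ℕ → ℝ,
      IsTrajectory F v α β W N0 (fun m => A m ω) ∧ ∀ c, IsSpread (rk c) fun k => W k c := by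
  obtain ⟨α, β, hα, hpost⟩ := hprior.exists_precision F hv
  refine ⟨α, β, ?_⟩
  filter_upwards [ae_exists_stack (ε := fun n (x : K × C) => ε n x.1 x.2)
    (ν := fun x : K × C => gaussianReal 0 (v x.1 x.2)) hA.measurableSet_noiseHistory
    (fun n x => hε_meas n x.1 x.2) (fun n x => hε_law n x.1 x.2) hε_indep
    (ae_tendsto_and_isSpread hv rk)] with ω hω
  obtain ⟨w, ⟨hslln, hspread⟩, hsum⟩ := hω
  refine ⟨fun k c n => ∑ i ∈ Finset.range n, w ((k, c), i), ⟨hv, hα, ?_, hslln, ?_⟩, hspread⟩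
  · exact fun n hn k c => (hpost _ (fun n hn => hA.initial n hn ω) n hn k c).1
  · intro n hn
    have hmean : prior.postMean v (fun m => A m ω) (fun m => observation F ε A m ω) n
        = fitMean F v α β (fun k c n => ∑ i ∈ Finset.range n, w ((k, c), i))
          (fun m => A m ω) n := by
      funext k c
      rw [(hpost _ (fun n hn => hA.initial n hn ω) n hn k c).2.2]
      unfold fitMean
      congr 4
      refine Eq.trans (Finset.sum_congr rfl fun m hm => ?_) (hsum n (k, c)).symm
      have hm' : A m ω = (k, c) := (Finset.mem_filter.1 hm).2
      simp only [observation, hm', add_sub_cancel_left]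
    have hvar : prior.postVar v (fun m => A m ω) n
        = fun k c => (prec v α (fun m => A m ω) n k c)⁻¹ := by
      funext k c
      exact (hpost _ (fun n hn => hA.initial n hn ω) n hn k c).2.1
    have h := hA.step n hn ω
    rwa [hmean, hvar] at h

end Policy

end GPCOCBA

theorem mainTheorem4 {K C Ω : Type*} [Fintype K] [DecidableEq K] [Nontrivial K]
    [Fintype C] [DecidableEq C] [Nonempty C]
    [MeasurableSpace Ω] (P : Measure Ω) [IsProbabilityMeasure P]
    (F : K → C → ℝ) (piStar : C → K)
    (hbest : ∀ c k, k ≠ piStar c → F k c < F (piStar c) c)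
    (v : K → C → ℝ≥0) (hv : ∀ k c, 0 < v k c)
    (ε : ℕ → K → C → Ω → ℝ)
    (hε_meas : ∀ n k c, Measurable (ε n k c))
    (hε_law : ∀ n k c, P.map (ε n k c) = gaussianReal 0 (v k c))
    (hε_indep : iIndepFun (fun i : ℕ × K × C => ε i.1 i.2.1 i.2.2) P)
    (prior : GPCOCBA.Prior K C) (N0 : ℕ) (init : ℕ → K × C)
    (hprior : prior.Independent N0 init)
    (A : ℕ → Ω → K × C)
    (hA : GPCOCBA.IsPolicy F v ε prior N0 init A) :
    (∀ᵐ ω ∂P,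
      (∀ c, Tendsto (fun n =>
        GPCOCBA.allocFrac (fun m => A m ω) n (piStar c) c ^ 2 / (v (piStar c) c : ℝ)
          - ∑ k ∈ Finset.univ.filter (fun k => k ≠ piStar c),
              GPCOCBA.allocFrac (fun m => A m ω) n k c ^ 2 / (v k c : ℝ)) atTop (𝓝 0)) ∧
      (∀ c k k', k ≠ piStar c → k' ≠ piStar c → Tendsto (fun n =>
        GPCOCBA.eta F v piStar (GPCOCBA.allocFrac (fun m => A m ω) n) k c
          - GPCOCBA.eta F v piStar (GPCOCBA.allocFrac (fun m => A m ω) n) k' c) atTop (𝓝 0)) ∧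
      (∀ c c' k k', c ≠ c' → k ≠ piStar c → k' ≠ piStar c' → Tendsto (fun n =>
        GPCOCBA.eta F v piStar (GPCOCBA.allocFrac (fun m => A m ω) n) k c
          - GPCOCBA.eta F v piStar (GPCOCBA.allocFrac (fun m => A m ω) n) k' c') atTop (𝓝 0))) ∧
    ∃ pStar : K → C → ℝ,
      GPCOCBA.IsOptimal F v piStar pStar ∧
      (∀ q, GPCOCBA.IsOptimal F v piStar q → q = pStar) ∧
      ∀ᵐ ω ∂P, ∀ k c, Tendsto (fun n => GPCOCBA.allocFrac (fun m => A m ω) n k c) atTop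
        (𝓝 (pStar k c)) := by
  choose rk hrk hrkF using fun c => GPCOCBA.exists_injective_rank (F · c)
  choose X' hX' using fun c => GPCOCBA.exists_isProfile (v := fun k => (v k c : ℝ))
    (d := fun k => F (piStar c) c - F k c) (piStar c) (fun k => by exact_mod_cast hv k c)
    fun k hk => sub_pos.2 (hbest c k hk)
  obtain ⟨α, β, htraj⟩ := hA.ae_exists_isTrajectory hv hε_meas hε_law hε_indep hprior rk
  have hlim : ∀ᵐ ω ∂P, ∀ k c, Tendsto (fun n => GPCOCBA.allocFrac (fun m => A m ω) n k c) atTop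
      (𝓝 (X' c k / ∑ k, ∑ c, X' c k)) := by
    filter_upwards [htraj] with ω ⟨W, hT, hW⟩ k c
    exact hT.tendsto_allocFrac (hT.tendsto_sampleCount hrk hrkF hW) hbest
      (X := fun k c => X' c k) hX' k c
  obtain ⟨hopt, huniq⟩ := GPCOCBA.isOptimal_profile_div (X := fun k c => X' c k) hv hbest hX'
  refine ⟨?_, _, hopt, huniq, hlim⟩
  filter_upwards [hlim] with ω hω
  obtain ⟨h1, h2⟩ := GPCOCBA.tendsto_balance_and_eta (X := fun k c => X' c k) hv hbest hX' hω
  exact ⟨h1, fun c k k' hk hk' => h2 c c k k' hk hk',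
    fun c c' k k' _ hk hk' => h2 c c' k k' hk hk'⟩
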